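/- **Notation.** Let $N\ge 0$, let $t=(t_1,\dots,t_N)$, and let $A$ be a symmetric $N\times N$ matrix with integer entries. The Nahm sum of $A$ is $$f_A(t,q)=\sum_{n\in\mathbb Z_{\ge0}^N}\frac{(-1)^{\mathrm{diag}(A)\cdot n}\,q^{\frac12(n^tAn+\mathrm{diag}(A)\cdot n)}}{(q;q)_{n_1}\cdots(q;q)_{n_N}}\,t_1^{n_1}\cdots t_N^{n_N}\in\mathbb Q(q)[\![t]\!],\qquad (q;q)_n=\prod_{k=1}^n(1-q^k),$$ and its symmetrisation is $f_A^{\mathrm{sym}}(t,q)=f_A(t,q)\,f_A(t,q^{-1})$. Put $$R_A=\mathbb Z[t][z_1^{\pm1},\dots,z_N^{\pm1},\tfrac1\delta]\Big/\Big(1-z_i-(-1)^{A_{ii}}t_i\prod_{j=1}^Nz_j^{A_{ij}},\ i=1,\dots,N\Big),$$ $$\delta=\det\big(\mathrm{diag}(1-z)A+\mathrm{diag}(z)\big)\prod_{j=1}^Nz_j^{-A_{jj}};$$ this is an étale $\mathbb Z[t]$-algebra. Fix complex roots of unity $\zeta_m$ of exact order $m$ ($m\ge1$) with $\zeta_{mm'}=\zeta_m\zeta_{m'}$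 for coprime $m,m'$ and $(\zeta_{p^r})^p=\zeta_{p^{r-1}}$ for primes $p$ and $r\ge1$. For an étale $\mathbb Z[t]$-algebra $R$ and $m\ge1$ put $R_m=R\otimes_{\mathbb Z[t]}\mathbb Z[\zeta_m][t_1^{1/m},\dots,t_N^{1/m}]$, regarded as mapping to $R_{pm}$ in the evident way. For a prime $p$, let $\varphi_p:R_m\to(R_m)^\wedge_p=\varprojlim_nR_m/(p^n)$ be the unique ring homomorphism that fixes $\zeta_m$, sends $t_i^{1/m}$ to $(t_i^{1/m})^p$, and satisfies $\varphi_p(r)\equiv r^p\bmod p$ for $r\in R$. The Habiro ring $\mathcal H_{R/\mathbb Z[t]}$ is the ring of collections $(f_m(q-\zeta_m))_{m\ge1}\in\prod_{m\ge1}R_m[\![q-\zeta_m]\!]$ such that for all $m\ge1$ and all primes $p$ $$f_m\big((q-\zeta_{pm})+(\zeta_{pm}-\zeta_m)\big)=\varphi_pf_{pm}(q-\zeta_{pm})\quad\text{in }(R_{pm})^\wedge_p[\![q-\zeta_{pm}]\!],$$ where $\varphi_p$ acts on coefficients (the left side converges because $\zeta_{pm}-\zeta_m$ is $p$-adically topologically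 nilpotent). **Theorem.** For every such $A$ and every such collection $(\zeta_m)$, one has $f_A^{\mathrm{sym}}(t,q)\in\mathcal H_{R_A/\mathbb Z[t]}$, in the following sense. There is an embedding of $\mathbb Z[t]$-algebras $R_A\hookrightarrow\mathbb Z[\![t]\!]$, inducing maps $(R_A)_m\to\mathbb Z[\zeta_m][\![t^{1/m}]\!]$; the series $f_A^{\mathrm{sym}}(t,q)$ lies in $\mathbb Z[q^{\pm1}][\![t]\!]$; and there is an element $(f_m)_{m\ge1}$ of $\mathcal H_{R_A/\mathbb Z[t]}$ such that, for every $m\ge1$, the image of $f_m$ in $\mathbb Z[\zeta_m][\![t^{1/m}]\!][\![q-\zeta_m]\!]$ is the expansion of $f_A^{\mathrm{sym}}(t^{1/m},q)$ at $q=\zeta_m$. -/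

import Mathlib

open scoped TensorProduct

noncomputable section

namespace Habiro

/-- A ring homomorphism out of a tensor product of commutative rings, from homomorphisms on the
two factors that agree on the base ring. -/
def tensorLift {P A B C : Type*} [CommRing P] [CommRing A] [CommRing B] [CommRing C]
    [Algebra P A] [Algebra P B] (f : A →+* C) (g : B →+* C)
    (h : f.comp (algebraMap P A) = g.comp (algebraMap P B)) : A ⊗[P] B →+* C :=
  letI : Algebra P C := (f.comp (algebraMap P A)).toAlgebra
  (Algebra.TensorProduct.lift (S := P)
    ({ f with commutes' := fun _ => rfl } : A →ₐ[P] C)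
    ({ g with commutes' := fun r => (RingHom.congr_fun h r).symm } : B →ₐ[P] C)
    (fun _ _ => Commute.all _ _)).toRingHom

theorem tensorLift_tmul {P A B C : Type*} [CommRing P] [CommRing A] [CommRing B] [CommRing C]
    [Algebra P A] [Algebra P B] (f : A →+* C) (g : B →+* C)
    (h : f.comp (algebraMap P A) = g.comp (algebraMap P B)) (a : A) (b : B) :
    tensorLift f g h (a ⊗ₜ[P] b) = f a * g b := by
  let _ : Algebra P C := (f.comp (algebraMap P A)).toAlgebra
  exact Algebra.TensorProduct.lift_tmul (S := P)
    ({ f with commutes' := fun _ => rfl } : A →ₐ[P] C)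
    ({ g with commutes' := fun r => (RingHom.congr_fun h r).symm } : B →ₐ[P] C)
    (fun _ _ => Commute.all _ _) a b

/-! ### Compatible roots of unity and the rings `R[λ^{1/m}, ζ_m]` -/

/-- A collection of complex roots of unity `ζ_m` of exact order `m` with
`ζ_{mm'} = ζ_m ζ_{m'}` for coprime `m, m'` and `(ζ_{p^{r+1}})^p = ζ_{p^r}` for primes `p`. -/
structure CompatibleRoots where
  root : ℕ+ → ℂ
  primitive : ∀ m : ℕ+, IsPrimitiveRoot (root m) m
  mul : ∀ m m' : ℕ+, Nat.Coprime m m' → root (m * m') = root m * root m'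
  pow : ∀ p : ℕ+, (p : ℕ).Prime → ∀ r : ℕ, root (p ^ (r + 1)) ^ (p : ℕ) = root (p ^ r)

/-- The ring `ℤ[ζ_m] ⊆ ℂ`. -/
abbrev CycInt (ζ : CompatibleRoots) (m : ℕ+) : Subalgebra ℤ ℂ := Algebra.adjoin ℤ {ζ.root m}

/-- `ζ_m` as an element of `ℤ[ζ_m]`. -/
def zeta (ζ : CompatibleRoots) (m : ℕ+) : CycInt ζ m :=
  ⟨ζ.root m, Algebra.subset_adjoin (Set.mem_singleton _)⟩

theorem zeta_pow (ζ : CompatibleRoots) (m : ℕ+) : zeta ζ m ^ (m : ℕ) = 1 :=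
  Subtype.ext (by simpa [zeta] using (ζ.primitive m).pow_eq_one)

theorem cycInt_le (ζ : CompatibleRoots) (k m : ℕ+) : CycInt ζ m ≤ CycInt ζ (k * m) := by
  refine Algebra.adjoin_le (Set.singleton_subset_iff.2 ?_)
  have h : ζ.root m ^ ((k * m : ℕ+) : ℕ) = 1 := by
    rw [PNat.mul_coe, mul_comm, pow_mul, (ζ.primitive m).pow_eq_one, one_pow]
  obtain ⟨i, -, hi⟩ := (ζ.primitive (k * m)).eq_pow_of_pow_eq_one h
  have h' : ζ.root (k * m) ^ i ∈ CycInt ζ (k * m) :=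
    pow_mem (Algebra.subset_adjoin (Set.mem_singleton _)) i
  exact hi ▸ h'

/-- The inclusion `ℤ[ζ_m] ⊆ ℤ[ζ_{km}]`. -/
def cycIncl (ζ : CompatibleRoots) (k m : ℕ+) : CycInt ζ m →+* CycInt ζ (k * m) :=
  (Subalgebra.inclusion (cycInt_le ζ k m)).toRingHom

/-- The ring `ℤ[λ^{1/m}, ζ_m]`: polynomials over `ℤ[ζ_m]` whose variable `X i` stands for
`λ_i^{1/m}`. -/
def RootPoly (σ : Type*) (ζ : CompatibleRoots) (m : ℕ+) : Type _ := MvPolynomial σ (CycInt ζ m)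

instance (σ : Type*) (ζ : CompatibleRoots) (m : ℕ+) : CommRing (RootPoly σ ζ m) :=
  inferInstanceAs (CommRing (MvPolynomial σ (CycInt ζ m)))

/-- The coefficient inclusion `ℤ[ζ_m] → ℤ[λ^{1/m}, ζ_m]`. -/
def RootPoly.C {σ : Type*} {ζ : CompatibleRoots} {m : ℕ+} : CycInt ζ m →+* RootPoly σ ζ m :=
  MvPolynomial.C

/-- The element `λ_i^{1/m}` of `ℤ[λ^{1/m}, ζ_m]`. -/
def RootPoly.X {σ : Type*} {ζ : CompatibleRoots} {m : ℕ+} (i : σ) : RootPoly σ ζ m :=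
  MvPolynomial.X i

/-- The homomorphism from `ℤ[λ^{1/m}, ζ_m]` given by its values on `ℤ[ζ_m]` and `λ^{1/m}`. -/
def RootPoly.evalHom {σ : Type*} {ζ : CompatibleRoots} {m : ℕ+} {S : Type*} [CommRing S]
    (f : CycInt ζ m →+* S) (x : σ → S) : RootPoly σ ζ m →+* S :=
  MvPolynomial.eval₂Hom f x

@[simp] theorem RootPoly.evalHom_C {σ : Type*} {ζ : CompatibleRoots} {m : ℕ+} {S : Type*}
    [CommRing S] (f : CycInt ζ m →+* S) (x : σ → S) (a : CycInt ζ m) :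
    RootPoly.evalHom f x (RootPoly.C a) = f a := MvPolynomial.eval₂Hom_C f x a

@[simp] theorem RootPoly.evalHom_X {σ : Type*} {ζ : CompatibleRoots} {m : ℕ+} {S : Type*}
    [CommRing S] (f : CycInt ζ m →+* S) (x : σ → S) (i : σ) :
    RootPoly.evalHom f x (RootPoly.X i) = x i := MvPolynomial.eval₂Hom_X' f x i

theorem RootPoly.hom_ext {σ : Type*} {ζ : CompatibleRoots} {m : ℕ+} {S : Type*} [CommRing S]
    {f g : RootPoly σ ζ m →+* S} (hC : ∀ a, f (RootPoly.C a) = g (RootPoly.C a))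
    (hX : ∀ i, f (RootPoly.X i) = g (RootPoly.X i)) : f = g :=
  MvPolynomial.ringHom_ext hC hX

/-- `ℤ[λ^{1/m}, ζ_m]` as a `ℤ[λ]`-algebra: `λ_i ↦ (λ_i^{1/m})^m`. -/
instance (σ : Type*) (ζ : CompatibleRoots) (m : ℕ+) :
    Algebra (MvPolynomial σ ℤ) (RootPoly σ ζ m) :=
  (MvPolynomial.eval₂Hom (Int.castRingHom _) fun i => RootPoly.X i ^ (m : ℕ)).toAlgebra

theorem RootPoly.algebraMap_X {σ : Type*} {ζ : CompatibleRoots} {m : ℕ+} (i : σ) :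
    algebraMap (MvPolynomial σ ℤ) (RootPoly σ ζ m) (MvPolynomial.X i) =
      RootPoly.X i ^ (m : ℕ) :=
  MvPolynomial.eval₂Hom_X' _ _ i

/-- Two homomorphisms from `ℤ[λ]` agree if they agree on the variables. -/
theorem polyInt_hom_ext {σ S : Type*} [CommRing S] {f g : MvPolynomial σ ℤ →+* S}
    (hX : ∀ i, f (MvPolynomial.X i) = g (MvPolynomial.X i)) : f = g :=
  MvPolynomial.ringHom_ext (fun n => by simp) hX

section RootRing

variable (σ : Type*) (R : Type*) [CommRing R] [Algebra (MvPolynomial σ ℤ) R]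
  (ζ : CompatibleRoots)

/-- `R_m = R[λ^{1/m}, ζ_m] = R ⊗_{ℤ[λ]} ℤ[λ^{1/m}, ζ_m]`. -/
abbrev RootRing (m : ℕ+) : Type _ := R ⊗[MvPolynomial σ ℤ] RootPoly σ ζ m

/-- The structure map `R → R_m`. -/
def RootRing.ofBase (m : ℕ+) : R →+* RootRing σ R ζ m :=
  Algebra.TensorProduct.includeLeftRingHom

/-- The structure map `ℤ[λ^{1/m}, ζ_m] → R_m`. -/
def RootRing.ofPoly (m : ℕ+) : RootPoly σ ζ m →+* RootRing σ R ζ m :=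
  (Algebra.TensorProduct.includeRight (R := MvPolynomial σ ℤ) (A := R)
    (B := RootPoly σ ζ m)).toRingHom

/-- The element `λ_i^{1/m}` of `R_m`. -/
def RootRing.lam (m : ℕ+) (i : σ) : RootRing σ R ζ m := RootRing.ofPoly σ R ζ m (RootPoly.X i)

/-- The structure map `ℤ[ζ_m] → R_m`. -/
def RootRing.ofCyc (m : ℕ+) : CycInt ζ m →+* RootRing σ R ζ m :=
  (RootRing.ofPoly σ R ζ m).comp RootPoly.C

theorem RootRing.comp_algebraMap (m : ℕ+) :
    (RootRing.ofBase σ R ζ m).comp (algebraMap (MvPolynomial σ ℤ) R) =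
      (RootRing.ofPoly σ R ζ m).comp (algebraMap (MvPolynomial σ ℤ) (RootPoly σ ζ m)) := by
  exact RingHom.ext fun x => ((Algebra.TensorProduct.includeRight (R := MvPolynomial σ ℤ) (A := R)
    (B := RootPoly σ ζ m)).commutes x).symm

theorem RootRing.ofBase_X (m : ℕ+) (i : σ) :
    RootRing.ofBase σ R ζ m (algebraMap (MvPolynomial σ ℤ) R (MvPolynomial.X i)) =
      RootRing.lam σ R ζ m i ^ (m : ℕ) := by
  have h := RingHom.congr_fun (RootRing.comp_algebraMap σ R ζ m) (MvPolynomial.X i)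
  simpa [RootPoly.algebraMap_X, RootRing.lam] using h

theorem RootRing.hom_ext {m : ℕ+} {S : Type*} [CommRing S] {f g : RootRing σ R ζ m →+* S}
    (hR : ∀ r, f (RootRing.ofBase σ R ζ m r) = g (RootRing.ofBase σ R ζ m r))
    (hC : ∀ a, f (RootRing.ofCyc σ R ζ m a) = g (RootRing.ofCyc σ R ζ m a))
    (hX : ∀ i, f (RootRing.lam σ R ζ m i) = g (RootRing.lam σ R ζ m i)) : f = g := by
  have h2 : f.comp (RootRing.ofPoly σ R ζ m) = g.comp (RootRing.ofPoly σ R ζ m) :=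
    RootPoly.hom_ext hC hX
  refine RingHom.ext fun x => ?_
  induction x using TensorProduct.induction_on with
  | zero => simp
  | add x y hx hy => simp [hx, hy]
  | tmul a b =>
    have e : a ⊗ₜ[MvPolynomial σ ℤ] b =
        RootRing.ofBase σ R ζ m a * RootRing.ofPoly σ R ζ m b := by
      simp [RootRing.ofBase, RootRing.ofPoly]
    rw [e, map_mul, map_mul, hR]
    congr 1
    exact RingHom.congr_fun h2 b

/-- The map `ℤ[λ^{1/m}, ζ_m] → ℤ[λ^{1/(km)}, ζ_{km}]` with `λ^{1/m} = (λ^{1/(km)})^k`. -/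
def RootPoly.incl (k m : ℕ+) : RootPoly σ ζ m →+* RootPoly σ ζ (k * m) :=
  RootPoly.evalHom (RootPoly.C.comp (cycIncl ζ k m)) fun i => RootPoly.X i ^ (k : ℕ)

theorem RootPoly.incl_comp_algebraMap (k m : ℕ+) :
    (RootPoly.incl σ ζ k m).comp (algebraMap (MvPolynomial σ ℤ) (RootPoly σ ζ m)) =
      algebraMap (MvPolynomial σ ℤ) (RootPoly σ ζ (k * m)) := by
  refine polyInt_hom_ext fun i => ?_
  simp [RootPoly.incl, RootPoly.algebraMap_X, pow_mul]

/-- The map `R_m → R_{km}`, `R`-linear, with `ζ_m ↦ ζ_m` and `λ^{1/m} ↦ (λ^{1/(km)})^k`. -/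
def RootRing.incl (k m : ℕ+) : RootRing σ R ζ m →+* RootRing σ R ζ (k * m) :=
  tensorLift (RootRing.ofBase σ R ζ (k * m))
    ((RootRing.ofPoly σ R ζ (k * m)).comp (RootPoly.incl σ ζ k m))
    (by rw [RingHom.comp_assoc, RootPoly.incl_comp_algebraMap, RootRing.comp_algebraMap])

/-! ### The Frobenius lifts -/

/-- The quotient `R_m / (p^n)`; the `p`-adic completion of `R_m` is the limit of these over `n`. -/
abbrev RootRing.Mod (m : ℕ+) (p n : ℕ) : Type _ :=
  RootRing σ R ζ m ⧸ Ideal.span {((p : RootRing σ R ζ m)) ^ n}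

/-- The projection `R_m → R_m / (p^n)`. -/
abbrev RootRing.toMod (m : ℕ+) (p n : ℕ) : RootRing σ R ζ m →+* RootRing.Mod σ R ζ m p n :=
  Ideal.Quotient.mk _

/-- `φ` is the reduction modulo `p^n` of the map `φ_p : R_m → (R_m)^∧_p`: it fixes `ζ_m`, sends
`λ_i^{1/m}` to its `p`-th power (so `λ_i` to `λ_i^p`), and lifts the `p`-th power map of `R / p`. -/
structure IsFrobeniusMod (m : ℕ+) (p n : ℕ) (φ : RootRing σ R ζ m →+* RootRing.Mod σ R ζ m p n) :
    Prop where
  cyc : ∀ a, φ (RootRing.ofCyc σ R ζ m a) = RootRing.toMod σ R ζ m p n (RootRing.ofCyc σ R ζ m a)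
  lam : ∀ i, φ (RootRing.lam σ R ζ m i) = RootRing.toMod σ R ζ m p n (RootRing.lam σ R ζ m i ^ p)
  base : ∀ r : R, (p : RootRing.Mod σ R ζ m p n) ∣
    φ (RootRing.ofBase σ R ζ m r) - RootRing.toMod σ R ζ m p n (RootRing.ofBase σ R ζ m r ^ p)

theorem isNilpotent_span_p (m : ℕ+) (p n : ℕ) :
    IsNilpotent (Ideal.span {(p : RootRing.Mod σ R ζ m p n)}) := by
  refine ⟨n, ?_⟩
  rw [Ideal.span_singleton_pow, Ideal.zero_eq_bot, Ideal.span_singleton_eq_bot]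
  have h := Ideal.Quotient.eq_zero_iff_mem.2
    (Ideal.mem_span_singleton_self ((p : RootRing σ R ζ m) ^ n))
  rw [← map_natCast (RootRing.toMod σ R ζ m p n), ← map_pow]
  exact h

/-- The `p`-th power map on a ring in which `p = 0`. -/
def powHom {S : Type*} [CommRing S] {p : ℕ} (hp : p.Prime) (h : (p : S) = 0) : S →+* S where
  toFun x := x ^ p
  map_one' := one_pow p
  map_mul' x y := mul_pow x y p
  map_zero' := zero_pow hp.ne_zero
  map_add' x y := by
    obtain ⟨r, hr⟩ := exists_add_pow_prime_eq hp x y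
    rw [hr, h]
    ring

theorem sub_pow_prime_pow {S : Type*} [CommRing S] {p : ℕ} (hp : p.Prime) (h : (p : S) = 0)
    (x y : S) (k : ℕ) : (x - y) ^ p ^ k = x ^ p ^ k - y ^ p ^ k := by
  induction k with
  | zero => simp
  | succ k ih =>
    rw [pow_succ, pow_mul, ih, pow_mul, pow_mul]
    exact map_sub (powHom hp h) _ _

/-- For étale `R` there is exactly one Frobenius lift modulo `p^n`. -/
theorem existsUnique_frobeniusMod [Algebra.Etale (MvPolynomial σ ℤ) R] (m : ℕ+) {p : ℕ}
    (hp : p.Prime) (n : ℕ) : ∃! φ, IsFrobeniusMod σ R ζ m p n φ := by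
  set B := RootRing.Mod σ R ζ m p n
  set π : RootRing σ R ζ m →+* B := RootRing.toMod σ R ζ m p n
  set I : Ideal B := Ideal.span {(p : B)}
  have hI : IsNilpotent I := isNilpotent_span_p σ R ζ m p n
  have hp0 : ((p : ℕ) : B ⧸ I) = 0 := by
    have := Ideal.Quotient.eq_zero_iff_mem.2 (Ideal.mem_span_singleton_self (p : B))
    simpa using this
  let _ : Algebra (MvPolynomial σ ℤ) B :=
    (MvPolynomial.eval₂Hom (Int.castRingHom B)
      fun i => π (RootRing.lam σ R ζ m i ^ p) ^ (m : ℕ)).toAlgebra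
  have halg : ∀ i, algebraMap (MvPolynomial σ ℤ) B (MvPolynomial.X i) =
      π (RootRing.lam σ R ζ m i ^ p) ^ (m : ℕ) := fun i => MvPolynomial.eval₂Hom_X' _ _ i
  let g₀ : R →+* B ⧸ I :=
    (powHom (S := B ⧸ I) hp hp0).comp
      ((Ideal.Quotient.mk I).comp (π.comp (RootRing.ofBase σ R ζ m)))
  have hg₀ : ∀ r, g₀ r = Ideal.Quotient.mk I (π (RootRing.ofBase σ R ζ m r ^ p)) := by
    intro r; simp [g₀, powHom]
  have hg : g₀.comp (algebraMap (MvPolynomial σ ℤ) R) =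
      algebraMap (MvPolynomial σ ℤ) (B ⧸ I) := by
    refine polyInt_hom_ext (S := B ⧸ I) fun i => ?_
    rw [RingHom.comp_apply, hg₀, RootRing.ofBase_X, ← Ideal.Quotient.mk_algebraMap, halg,
      ← map_pow π, pow_right_comm]
  let g : R →ₐ[MvPolynomial σ ℤ] B ⧸ I := { g₀ with commutes' := RingHom.congr_fun hg }
  have key : ∀ (h : R →ₐ[MvPolynomial σ ℤ] B),
      (Ideal.Quotient.mkₐ (MvPolynomial σ ℤ) I).comp h = g ↔
        ∀ r, (p : B) ∣ h r - π (RootRing.ofBase σ R ζ m r ^ p) := by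
    intro h
    rw [AlgHom.ext_iff]
    refine forall_congr' fun r => ?_
    rw [← Ideal.mem_span_singleton, ← Ideal.Quotient.eq, ← hg₀]
    rfl
  obtain ⟨h, hh⟩ := Algebra.FormallySmooth.exists_lift I hI g
  refine ⟨tensorLift h.toRingHom
    (RootPoly.evalHom (π.comp (RootRing.ofCyc σ R ζ m)) fun i => π (RootRing.lam σ R ζ m i ^ p)) ?_,
    ⟨?_, ?_, ?_⟩, ?_⟩
  · refine polyInt_hom_ext fun i => ?_
    simp [RootPoly.algebraMap_X, halg]
  · intro a
    have e : RootRing.ofCyc σ R ζ m a = (1 : R) ⊗ₜ[MvPolynomial σ ℤ] RootPoly.C a := rfl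
    rw [e, tensorLift_tmul, map_one, one_mul, RootPoly.evalHom_C]
    rfl
  · intro i
    have e : RootRing.lam σ R ζ m i = (1 : R) ⊗ₜ[MvPolynomial σ ℤ] RootPoly.X i := rfl
    conv_lhs => rw [e]
    rw [tensorLift_tmul, map_one, one_mul, RootPoly.evalHom_X]
  · intro r
    have e : RootRing.ofBase σ R ζ m r = r ⊗ₜ[MvPolynomial σ ℤ] (1 : RootPoly σ ζ m) := rfl
    have := (key h).1 hh r
    rw [e, tensorLift_tmul, map_one, mul_one]
    exact this
  · intro φ hφ
    let h' : R →ₐ[MvPolynomial σ ℤ] B :=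
      { φ.comp (RootRing.ofBase σ R ζ m) with
        commutes' := RingHom.congr_fun (f := (φ.comp (RootRing.ofBase σ R ζ m)).comp
            (algebraMap (MvPolynomial σ ℤ) R))
          (polyInt_hom_ext fun i => by
            rw [RingHom.comp_apply, RingHom.comp_apply, RootRing.ofBase_X, map_pow, hφ.lam, halg]) }
    have hh' : h' = h := by
      refine Algebra.FormallyUnramified.ext I hI fun r => ?_
      have h1 := (key h').2 hφ.base
      exact (DFunLike.congr_fun h1 r).trans (DFunLike.congr_fun hh r).symm
    refine RootRing.hom_ext σ R ζ (fun r => ?_) (fun a => ?_) (fun i => ?_)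
    · have e : RootRing.ofBase σ R ζ m r = r ⊗ₜ[MvPolynomial σ ℤ] (1 : RootPoly σ ζ m) := rfl
      have h2 : φ (RootRing.ofBase σ R ζ m r) = h r := DFunLike.congr_fun hh' r
      rw [h2, e, tensorLift_tmul, map_one, mul_one]
      rfl
    · have e : RootRing.ofCyc σ R ζ m a = (1 : R) ⊗ₜ[MvPolynomial σ ℤ] RootPoly.C a := rfl
      rw [hφ.cyc, e, tensorLift_tmul, map_one, one_mul, RootPoly.evalHom_C]
      rfl
    · have e : RootRing.lam σ R ζ m i = (1 : R) ⊗ₜ[MvPolynomial σ ℤ] RootPoly.X i := rfl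
      rw [hφ.lam]
      conv_rhs => rw [e]
      rw [tensorLift_tmul, map_one, one_mul, RootPoly.evalHom_X]

/-- The Frobenius `φ_p` on `R_m`, modulo `p^n`. -/
def frobeniusMod [Algebra.Etale (MvPolynomial σ ℤ) R] (m : ℕ+) {p : ℕ} (hp : p.Prime) (n : ℕ) :
    RootRing σ R ζ m →+* RootRing.Mod σ R ζ m p n :=
  (existsUnique_frobeniusMod σ R ζ m hp n).choose

/-! ### Re-expansion and the Habiro ring -/

/-- `ζ_{pm} - ζ_m` in `ℤ[ζ_{pm}]`. -/
def zetaDiff (p m : ℕ+) : CycInt ζ (p * m) :=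
  zeta ζ (p * m) - cycIncl ζ p m (zeta ζ m)

/-- `ζ_{pm} - ζ_m` is `p`-adically topologically nilpotent. -/
theorem exists_dvd_zetaDiff_pow {p : ℕ+} (hp : (p : ℕ).Prime) (m : ℕ+) :
    ∃ k : ℕ, ((p : ℕ) : CycInt ζ (p * m)) ∣ zetaDiff ζ p m ^ k := by
  obtain ⟨r, a, ha, hm⟩ := Nat.exists_eq_pow_mul_and_not_dvd m.ne_zero p hp.ne_one
  have ha0 : 0 < a := Nat.pos_of_ne_zero fun h => ha (h ▸ dvd_zero _)
  obtain ⟨a', rfl⟩ : ∃ a' : ℕ+, (a' : ℕ) = a := ⟨⟨a, ha0⟩, rfl⟩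
  obtain rfl : m = p ^ r * a' := PNat.eq (by simpa using hm)
  have hco : Nat.Coprime (p : ℕ) a' := (Nat.Prime.coprime_iff_not_dvd hp).2 ha
  have h1 : ζ.root (p * (p ^ r * a')) = ζ.root (p ^ (r + 1)) * ζ.root a' := by
    rw [← mul_assoc, ← pow_succ', ζ.mul _ _ (by simpa using hco.pow_left (r + 1))]
  have h2 : ζ.root (p ^ r * a') = ζ.root (p ^ r) * ζ.root a' :=
    ζ.mul _ _ (by simpa using hco.pow_left r)
  have h3 : ζ.root (p ^ (r + 1)) ^ ((p : ℕ) ^ (r + 1)) = 1 := by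
    simpa using (ζ.primitive (p ^ (r + 1))).pow_eq_one
  have h4 : ζ.root (p ^ r) ^ ((p : ℕ) ^ (r + 1)) = 1 := by
    have : ζ.root (p ^ r) ^ ((p : ℕ) ^ r) = 1 := by
      simpa using (ζ.primitive (p ^ r)).pow_eq_one
    rw [pow_succ, pow_mul, this, one_pow]
  refine ⟨(p : ℕ) ^ (r + 1), ?_⟩
  rw [← Ideal.mem_span_singleton, ← Ideal.Quotient.eq_zero_iff_mem, map_pow]
  have hp0 : ((p : ℕ) : CycInt ζ (p * (p ^ r * a')) ⧸
      Ideal.span {((p : ℕ) : CycInt ζ (p * (p ^ r * a')))}) = 0 := by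
    rw [← map_natCast (Ideal.Quotient.mk _)]
    exact Ideal.Quotient.eq_zero_iff_mem.2 (Ideal.mem_span_singleton_self _)
  rw [zetaDiff, map_sub, sub_pow_prime_pow hp hp0, ← map_pow, ← map_pow, ← map_sub, sub_eq_zero.2,
    map_zero]
  apply Subtype.ext
  change ζ.root (p * (p ^ r * a')) ^ ((p : ℕ) ^ (r + 1)) =
    ζ.root (p ^ r * a') ^ ((p : ℕ) ^ (r + 1))
  rw [h1, h2, mul_pow, mul_pow, h3, h4]

theorem isNilpotent_zetaDiff {p : ℕ+} (hp : (p : ℕ).Prime) (m : ℕ+) (n : ℕ) :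
    IsNilpotent (RootRing.toMod σ R ζ (p * m) p n
      (RootRing.ofCyc σ R ζ (p * m) (zetaDiff ζ p m))) := by
  obtain ⟨k, c, hc⟩ := exists_dvd_zetaDiff_pow ζ hp m
  refine ⟨k * n, ?_⟩
  rw [← map_pow, ← map_pow, pow_mul, hc, mul_pow, map_mul, map_pow, map_natCast]
  exact Ideal.Quotient.eq_zero_iff_mem.2 (Ideal.mul_mem_right _ _
    (Ideal.mem_span_singleton_self _))

theorem hasSubst_shift {p : ℕ+} (hp : (p : ℕ).Prime) (m : ℕ+) (n : ℕ) :
    PowerSeries.HasSubst (PowerSeries.X + PowerSeries.C (RootRing.toMod σ R ζ (p * m) p n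
      (RootRing.ofCyc σ R ζ (p * m) (zetaDiff ζ p m)))) := by
  have h := isNilpotent_zetaDiff σ R ζ hp m n
  change IsNilpotent (PowerSeries.constantCoeff _)
  simpa using h

/-- Re-expansion `f_m(q - ζ_m) ↦ f_m((q - ζ_{pm}) + (ζ_{pm} - ζ_m))`, modulo `p^n`: the variable
of `R_m⟦X⟧` is `X = q - ζ_m` and the one of `(R_{pm} / p^n)⟦X⟧` is `X = q - ζ_{pm}`. -/
def reexpand {p : ℕ+} (hp : (p : ℕ).Prime) (m : ℕ+) (n : ℕ) :
    PowerSeries (RootRing σ R ζ m) →+* PowerSeries (RootRing.Mod σ R ζ (p * m) p n) :=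
  (PowerSeries.substAlgHom (hasSubst_shift σ R ζ hp m n)).toRingHom.comp
    (PowerSeries.map ((RootRing.toMod σ R ζ (p * m) p n).comp (RootRing.incl σ R ζ p m)))

/-- The Habiro ring of an étale `ℤ[λ]`-algebra `R`: the collections of series
`f_m ∈ R_m⟦q - ζ_m⟧`, `m ≥ 1`, such that for all `m ≥ 1` and all primes `p` the re-expansion of
`f_m` at `ζ_{pm}` equals `φ_p f_{pm}` in `(R_{pm})^∧_p⟦q - ζ_{pm}⟧`, that is, modulo every
power `p^n`. -/
def habiroRing [Algebra.Etale (MvPolynomial σ ℤ) R] :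
    Subring (∀ m : ℕ+, PowerSeries (RootRing σ R ζ m)) :=
  ⨅ (m : ℕ+) (p : ℕ+) (hp : (p : ℕ).Prime) (n : ℕ),
    RingHom.eqLocus ((reexpand σ R ζ hp m n).comp (Pi.evalRingHom _ m))
      ((PowerSeries.map (frobeniusMod σ R ζ (p * m) hp n)).comp
        (Pi.evalRingHom (fun m : ℕ+ => PowerSeries (RootRing σ R ζ m)) (p * m)))

/-! ### Expansions of `q`-series at roots of unity -/

variable {σ R}

/-- For `R ⊆ ℤ⟦λ⟧`, the induced map `R_m → ℤ[ζ_m]⟦λ^{1/m}⟧`. The variable `X i` of the target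
stands for `λ_i^{1/m}`, so `ℤ⟦λ⟧` is mapped there by `λ_i ↦ X i ^ m`. -/
def rootSeries (ι : R →ₐ[MvPolynomial σ ℤ] MvPowerSeries σ ℤ) (m : ℕ+) :
    RootRing σ R ζ m →+* MvPowerSeries σ (CycInt ζ m) :=
  tensorLift
    ((MvPowerSeries.expand (m : ℕ) m.ne_zero).toRingHom.comp
      ((MvPowerSeries.map (Int.castRingHom (CycInt ζ m))).comp ι.toRingHom))
    (RootPoly.evalHom MvPowerSeries.C MvPowerSeries.X)
    (polyInt_hom_ext fun i => by
      have h : ι (algebraMap (MvPolynomial σ ℤ) R (MvPolynomial.X i)) = MvPowerSeries.X i := by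
        rw [ι.commutes]
        exact MvPolynomial.coe_X i
      simp [RootPoly.algebraMap_X, h])

/-- `q = ζ_m + (q - ζ_m)`, a unit of `ℤ[ζ_m]⟦q - ζ_m⟧`. -/
def qUnit (m : ℕ+) : (PowerSeries (CycInt ζ m))ˣ :=
  IsUnit.unit (a := PowerSeries.C (zeta ζ m) + PowerSeries.X) (by
    rw [PowerSeries.isUnit_iff_constantCoeff]
    simpa using IsUnit.of_pow_eq_one (zeta_pow ζ m) m.ne_zero)

/-- The expansion `ℤ[q^{±1}] → ℤ[ζ_m]⟦q - ζ_m⟧` at `q = ζ_m`. -/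
def expandAt (m : ℕ+) : LaurentPolynomial ℤ →+* PowerSeries (CycInt ζ m) :=
  LaurentPolynomial.eval₂ (Int.castRingHom _) (qUnit ζ m)

/-- `f = (f_m)_m` is the collection of expansions of `F(λ, q) ∈ ℤ[q^{±1}]⟦λ⟧`: under
`R_m ⊆ ℤ[ζ_m]⟦λ^{1/m}⟧`, the series `f_m` is the expansion of `F(λ^{1/m}, q)` at `q = ζ_m`.
This is compared coefficient by coefficient, at `(λ^{1/m})^n (q - ζ_m)^k`. -/
def IsExpansion (ι : R →ₐ[MvPolynomial σ ℤ] MvPowerSeries σ ℤ)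
    (F : MvPowerSeries σ (LaurentPolynomial ℤ)) (f : ∀ m : ℕ+, PowerSeries (RootRing σ R ζ m)) :
    Prop :=
  ∀ (m : ℕ+) (n : σ →₀ ℕ) (k : ℕ),
    MvPowerSeries.coeff n (rootSeries ζ ι m (PowerSeries.coeff k (f m))) =
      PowerSeries.coeff k (expandAt ζ m (MvPowerSeries.coeff n F))

end RootRing

/-! ### The Nahm sum -/

section Nahm

variable {N : ℕ} (A : Matrix (Fin N) (Fin N) ℤ)

/-- The Nahm sum `f_A(t, q)` over a field, where `q` is not a root of unity. For symmetric `A` the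
integer division by `2` in the exponent of `q` is exact. -/
def nahmSum {K : Type*} [Field K] (q : K) : MvPowerSeries (Fin N) K := fun n =>
  (-1) ^ (∑ i, A i i * (n i : ℤ)) *
    q ^ ((∑ i, ∑ j, (n i : ℤ) * A i j * (n j : ℤ) + ∑ i, A i i * (n i : ℤ)) / 2) /
    ∏ i, ∏ k ∈ Finset.range (n i), (1 - q ^ (k + 1))

/-- The symmetrisation `f_A(t, q) f_A(t, q⁻¹)` in `ℚ(q)⟦t⟧`. -/
def nahmSym : MvPowerSeries (Fin N) (RatFunc ℚ) :=
  nahmSum A RatFunc.X * nahmSum A (RatFunc.X)⁻¹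

/-- The inclusion `ℤ[q^{±1}] ⊆ ℚ(q)`. -/
def laurentToRatFunc : LaurentPolynomial ℤ →+* RatFunc ℚ :=
  LaurentPolynomial.eval₂ (Int.castRingHom _) (Units.mk0 RatFunc.X RatFunc.X_ne_zero)

/-! ### The étale algebra `R_A` -/

/-- `ℤ[t][z_1^{±1}, …, z_N^{±1}]`. -/
abbrev Laurent (N : ℕ) : Type := AddMonoidAlgebra (MvPolynomial (Fin N) ℤ) (Fin N → ℤ)

/-- The Laurent monomial `z^a = ∏ z_j^{a_j}`. -/
def zMon (a : Fin N → ℤ) : Laurent N := AddMonoidAlgebra.single a 1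

/-- The variable `z_i`. -/
def zVar (i : Fin N) : Laurent N := zMon (Pi.single i 1)

/-- The variable `t_i`. -/
def tVar (i : Fin N) : Laurent N := algebraMap (MvPolynomial (Fin N) ℤ) _ (MvPolynomial.X i)

/-- `1 - z_i - (-1)^{A_ii} t_i ∏_j z_j^{A_ij}`. -/
def nahmEq (i : Fin N) : Laurent N :=
  1 - zVar i - (((-1 : ℤˣ) ^ A i i : ℤˣ) : ℤ) * tVar i * zMon (A i)

/-- `δ = det(diag(1 - z) A + diag(z)) ∏_j z_j^{-A_jj}`. -/
def delta : Laurent N :=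
  (Matrix.diagonal (fun i => 1 - zVar i) * A.map (fun a : ℤ => (a : Laurent N)) +
    Matrix.diagonal zVar).det * zMon (fun j => -A j j)

/-- `R_A = ℤ[t][z^{±1}, 1/δ] / (1 - z - (-1)^A t z^A)`. -/
abbrev NahmRing : Type :=
  Localization.Away (delta A) ⧸
    Ideal.span (Set.range fun i => algebraMap (Laurent N) (Localization.Away (delta A)) (nahmEq A i))

section Universal

variable {B : Type} [CommRing B]

/-- The unit `1 + u` for `u` in an ideal of square zero. -/
def oneAdd (I : Ideal B) (hI : I ^ 2 = ⊥) : Multiplicative I →* B where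
  toFun u := 1 + (u.toAdd : B)
  map_one' := by simp
  map_mul' u v := by
    have h : (u.toAdd : B) * (v.toAdd : B) = 0 := by
      have := Ideal.mul_mem_mul u.toAdd.2 v.toAdd.2
      rwa [← pow_two, hI, Ideal.mem_bot] at this
    simp only [toAdd_mul, Submodule.coe_add]
    linear_combination -h

/-- `1 + u` as a unit. -/
def oneAddUnit (I : Ideal B) (hI : I ^ 2 = ⊥) : Multiplicative I →* Bˣ :=
  (oneAdd I hI).toHomUnits

theorem prod_oneAddUnit (I : Ideal B) (hI : I ^ 2 = ⊥) (u : Fin N → I) (a : Fin N → ℤ) :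
    ((∏ j, oneAddUnit I hI (Multiplicative.ofAdd (u j)) ^ a j : Bˣ) : B) =
      1 + ∑ j, (a j : B) * u j := by
  have h : ∏ j, Multiplicative.ofAdd (u j) ^ a j =
      Multiplicative.ofAdd (∑ j, a j • u j) := by
    rw [ofAdd_sum]
    rfl
  simp_rw [← map_zpow]
  rw [← map_prod, h]
  change 1 + ((∑ j, a j • u j : I) : B) = _
  simp

variable [Algebra (MvPolynomial (Fin N) ℤ) B]

/-- Evaluation of Laurent polynomials at units. -/
def evalL (w : Fin N → Bˣ) : Laurent N →ₐ[MvPolynomial (Fin N) ℤ] B :=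
  AddMonoidAlgebra.lift _ B (Fin N → ℤ)
    { toFun := fun a => ((∏ j, w j ^ (a.toAdd j) : Bˣ) : B)
      map_one' := by simp
      map_mul' := fun a b => by simp [zpow_add, Finset.prod_mul_distrib] }

theorem evalL_zMon (w : Fin N → Bˣ) (a : Fin N → ℤ) :
    evalL w (zMon a) = ((∏ j, w j ^ a j : Bˣ) : B) := by
  rw [evalL, zMon, AddMonoidAlgebra.lift_single, one_smul]
  rfl

theorem evalL_zVar (w : Fin N → Bˣ) (i : Fin N) : evalL w (zVar i) = w i := by
  rw [zVar, evalL_zMon, Finset.prod_eq_single i]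
  · simp
  · intro j _ hj; simp [hj]
  · simp

theorem evalL_tVar (w : Fin N → Bˣ) (i : Fin N) :
    evalL w (tVar i) = algebraMap (MvPolynomial (Fin N) ℤ) B (MvPolynomial.X i) :=
  (evalL w).commutes _

/-- The summand `(-1)^{A_ii} t_i ∏_j w_j^{A_ij}` of the Nahm equation, at `w`. -/
def rhs (w : Fin N → Bˣ) (i : Fin N) : B :=
  ((((-1 : ℤˣ) ^ A i i : ℤˣ) : ℤ) : B) * algebraMap (MvPolynomial (Fin N) ℤ) B (MvPolynomial.X i)
    * ((∏ j, w j ^ A i j : Bˣ) : B)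

theorem evalL_nahmEq (w : Fin N → Bˣ) (i : Fin N) :
    evalL w (nahmEq A i) = 1 - w i - rhs A w i := by
  rw [nahmEq, map_sub, map_sub, map_one, map_mul, map_mul, evalL_zVar, evalL_tVar, evalL_zMon,
    map_intCast, rhs]

theorem evalL_delta (w : Fin N → Bˣ) :
    IsUnit (evalL w (delta A)) ↔ IsUnit
      (Matrix.diagonal (fun i => 1 - (w i : B)) * A.map (fun a : ℤ => (a : B)) +
        Matrix.diagonal (fun i => (w i : B))).det := by
  rw [delta, map_mul, evalL_zMon, Units.isUnit_mul_units, AlgHom.map_det]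
  congr! 2
  rw [AlgHom.mapMatrix_apply, Matrix.map_add _ (map_add _), Matrix.map_mul,
    Matrix.diagonal_map (map_zero _), Matrix.diagonal_map (map_zero _), Matrix.map_map]
  congr! 3
  · simp [evalL_zVar]
  · ext i; simp
  · simp [evalL_zVar]

/-- `z_i` as a unit of `R_A`. -/
def zUnit (i : Fin N) : (NahmRing A)ˣ where
  val := Ideal.Quotient.mk _ (algebraMap _ _ (zMon (Pi.single i 1)))
  inv := Ideal.Quotient.mk _ (algebraMap _ _ (zMon (-Pi.single i 1)))
  val_inv := by
    rw [← map_mul, ← map_mul, zMon, zMon, AddMonoidAlgebra.single_mul_single, add_neg_cancel,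
      one_mul, ← AddMonoidAlgebra.one_def, map_one, map_one]
  inv_val := by
    rw [← map_mul, ← map_mul, zMon, zMon, AddMonoidAlgebra.single_mul_single, neg_add_cancel,
      one_mul, ← AddMonoidAlgebra.one_def, map_one, map_one]

/-- The structure map `ℤ[t][z^{±1}] → R_A`. -/
def toNahm : Laurent N →ₐ[MvPolynomial (Fin N) ℤ] NahmRing A :=
  (Ideal.Quotient.mkₐ _ _).comp (IsScalarTower.toAlgHom _ _ (Localization.Away (delta A)))

theorem evalL_unique (f : Laurent N →ₐ[MvPolynomial (Fin N) ℤ] B) (w : Fin N → Bˣ)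
    (h : ∀ i, f (zVar i) = w i) : f = evalL w := by
  let F : Multiplicative (Fin N → ℤ) →* Bˣ :=
    ((f : Laurent N →* B).comp (AddMonoidAlgebra.of (MvPolynomial (Fin N) ℤ) _)).toHomUnits
  have hF : ∀ a, f (zMon a) = F (Multiplicative.ofAdd a) := fun a => rfl
  have hF' : ∀ i, F (Multiplicative.ofAdd (Pi.single i 1)) = w i := fun i => Units.ext (h i)
  refine AddMonoidAlgebra.algHom_ext (fun a => ?_) (by ext)
  change f (zMon a) = evalL w (zMon a)
  rw [hF, evalL_zMon]
  congr 1
  have ha : a = ∑ j, a j • (Pi.single j 1 : Fin N → ℤ) := by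
    ext i
    simp [Finset.sum_apply, Pi.single_apply]
  conv_lhs => rw [ha]
  rw [ofAdd_sum, map_prod]
  refine Finset.prod_congr rfl fun j _ => ?_
  rw [ofAdd_zsmul, map_zpow, hF']

theorem comp_toNahm (f : NahmRing A →ₐ[MvPolynomial (Fin N) ℤ] B) :
    f.comp (toNahm A) = evalL (fun i => Units.map f.toMonoidHom (zUnit A i)) :=
  evalL_unique _ _ fun _ => rfl

theorem nahm_hom_ext {f g : NahmRing A →ₐ[MvPolynomial (Fin N) ℤ] B}
    (h : ∀ i, f (zUnit A i) = g (zUnit A i)) : f = g := by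
  have h1 : f.comp (toNahm A) = g.comp (toNahm A) := by
    rw [comp_toNahm, comp_toNahm]
    congr 1
    ext i
    exact h i
  refine Ideal.Quotient.algHom_ext _ ?_
  refine AlgHom.coe_ringHom_injective ?_
  refine IsLocalization.ringHom_ext (Submonoid.powers (delta A)) ?_
  exact congrArg AlgHom.toRingHom h1

theorem nahm_hom_spec (f : NahmRing A →ₐ[MvPolynomial (Fin N) ℤ] B) :
    (∀ i, evalL (fun i => Units.map f.toMonoidHom (zUnit A i)) (nahmEq A i) = 0) ∧
      IsUnit (evalL (fun i => Units.map f.toMonoidHom (zUnit A i)) (delta A)) := by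
  rw [← comp_toNahm]
  constructor
  · intro i
    have : toNahm A (nahmEq A i) = 0 :=
      Ideal.Quotient.eq_zero_iff_mem.2 (Ideal.subset_span ⟨i, rfl⟩)
    rw [AlgHom.comp_apply, this, map_zero]
  · have : IsUnit (toNahm A (delta A)) :=
      (IsLocalization.Away.algebraMap_isUnit (S := Localization.Away (delta A)) (delta A)).map
        (Ideal.Quotient.mk _)
    exact this.map f

theorem exists_nahm_hom (w : Fin N → Bˣ) (h1 : ∀ i, evalL w (nahmEq A i) = 0)
    (h2 : IsUnit (evalL w (delta A))) :
    ∃ f : NahmRing A →ₐ[MvPolynomial (Fin N) ℤ] B, ∀ i, f (zUnit A i) = w i := by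
  have h3 : ∀ y : Submonoid.powers (delta A), IsUnit (evalL w y) := by
    rintro ⟨_, n, rfl⟩
    simpa using h2.pow n
  let f₁ : Localization.Away (delta A) →ₐ[MvPolynomial (Fin N) ℤ] B :=
    IsLocalization.liftAlgHom (M := Submonoid.powers (delta A)) (f := evalL w) h3
  have hf₁ : ∀ x, f₁ (algebraMap _ _ x) = evalL w x := fun x => IsLocalization.lift_eq h3 x
  refine ⟨Ideal.Quotient.liftₐ _ f₁ ?_, fun i => ?_⟩
  · intro a ha
    refine (Ideal.span_le (I := RingHom.ker f₁)).2 ?_ ha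
    rintro _ ⟨i, rfl⟩
    exact (hf₁ _).trans (h1 i)
  · exact (hf₁ (zVar i)).trans (evalL_zVar w i)

/-- The matrix of the linearised Nahm equations. -/
def linMat (w : Fin N → Bˣ) : Matrix (Fin N) (Fin N) B :=
  Matrix.diagonal (fun i => rhs A w i) * A.map (fun a : ℤ => (a : B)) +
    Matrix.diagonal (fun i => (w i : B))

theorem nahm_taylor (I : Ideal B) (hI : I ^ 2 = ⊥) (w : Fin N → Bˣ) (u : Fin N → I) (i : Fin N) :
    evalL (fun j => w j * oneAddUnit I hI (Multiplicative.ofAdd (u j))) (nahmEq A i) =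
      evalL w (nahmEq A i) - (linMat A w).mulVec (fun j => (u j : B)) i := by
  have h : (linMat A w).mulVec (fun j => (u j : B)) i =
      rhs A w i * ∑ j, (A i j : B) * u j + w i * u i := by
    rw [linMat, Matrix.add_mulVec, ← Matrix.mulVec_mulVec, Pi.add_apply, Matrix.mulVec_diagonal,
      Matrix.mulVec_diagonal]
    rfl
  have h2 : ((oneAddUnit I hI (Multiplicative.ofAdd (u i)) : Bˣ) : B) = 1 + u i := rfl
  rw [evalL_nahmEq, evalL_nahmEq, h]
  simp only [rhs, mul_zpow, Finset.prod_mul_distrib, Units.val_mul, prod_oneAddUnit, h2]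
  ring

theorem isUnit_linMat (w : Fin N → Bˣ) (h1 : ∀ i, evalL w (nahmEq A i) = 0)
    (h2 : IsUnit (evalL w (delta A))) : IsUnit (linMat A w).det := by
  rw [evalL_delta] at h2
  have h : rhs A w = fun i => 1 - (w i : B) := by
    funext i
    have := h1 i
    rw [evalL_nahmEq] at this
    linear_combination -this
  rwa [linMat, h]

theorem comp_evalL {C : Type} [CommRing C] [Algebra (MvPolynomial (Fin N) ℤ) C]
    (π : B →ₐ[MvPolynomial (Fin N) ℤ] C) (w : Fin N → Bˣ) :
    π.comp (evalL w) = evalL (fun i => Units.map π.toMonoidHom (w i)) :=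
  evalL_unique _ _ fun i => by rw [AlgHom.comp_apply, evalL_zVar]; rfl

theorem map_linMat {C : Type} [CommRing C] [Algebra (MvPolynomial (Fin N) ℤ) C]
    (π : B →ₐ[MvPolynomial (Fin N) ℤ] C) (w : Fin N → Bˣ) :
    π (linMat A w).det = (linMat A fun i => Units.map π.toMonoidHom (w i)).det := by
  have h (i : Fin N) : π (rhs A w i) = rhs A (fun i => Units.map π.toMonoidHom (w i)) i := by
    have h1 := DFunLike.congr_fun (comp_evalL π w) (nahmEq A i)
    rw [AlgHom.comp_apply, evalL_nahmEq, evalL_nahmEq, map_sub, map_sub, map_one] at h1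
    exact sub_right_injective h1
  rw [AlgHom.map_det]
  congr 1
  rw [AlgHom.mapMatrix_apply, linMat, linMat, Matrix.map_add _ (map_add _), Matrix.map_mul,
    Matrix.diagonal_map (map_zero _), Matrix.diagonal_map (map_zero _), Matrix.map_map]
  congr! 3
  · simp [h]
  · ext i; simp

end Universal

theorem nahm_formallyEtale : Algebra.FormallyEtale (MvPolynomial (Fin N) ℤ) (NahmRing A) := by
  rw [Algebra.FormallyEtale.iff_comp_bijective]
  intro B _ _ I hI
  constructor
  · intro f g hfg
    set w : Fin N → Bˣ := fun i => Units.map f.toMonoidHom (zUnit A i)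
    set w' : Fin N → Bˣ := fun i => Units.map g.toMonoidHom (zUnit A i)
    have hmem : ∀ i, ((w i)⁻¹ * w' i : Bˣ) - (1 : B) ∈ I := by
      intro i
      have h0 : (w' i : B) - w i ∈ I := by
        rw [← Ideal.Quotient.eq]
        exact (DFunLike.congr_fun hfg (zUnit A i : NahmRing A)).symm
      have := I.mul_mem_left (((w i)⁻¹ : Bˣ) : B) h0
      rwa [mul_sub, Units.inv_mul, ← Units.val_mul] at this
    let u : Fin N → I := fun i => ⟨_, hmem i⟩
    have hw : w' = fun j => w j * oneAddUnit I hI (Multiplicative.ofAdd (u j)) := by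
      funext j
      apply Units.ext
      have h2 : ((oneAddUnit I hI (Multiplicative.ofAdd (u j)) : Bˣ) : B) =
        1 + (((w j)⁻¹ * w' j : Bˣ) - 1) := rfl
      rw [Units.val_mul, h2, add_sub_cancel, Units.val_mul, Units.mul_inv_cancel_left]
    obtain ⟨hf1, hf2⟩ := nahm_hom_spec A f
    obtain ⟨hg1, -⟩ := nahm_hom_spec A g
    have hM : (linMat A w).mulVec (fun j => (u j : B)) = 0 := by
      funext i
      have h3 := nahm_taylor A I hI w u i
      rw [← hw, hf1 i] at h3
      have h4 := (hg1 i).symm.trans h3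
      simpa using h4
    have hinj := Matrix.mulVec_injective_of_isUnit
      ((Matrix.isUnit_iff_isUnit_det _).2 (isUnit_linMat A w hf1 hf2))
    have hu := hinj (hM.trans (Matrix.mulVec_zero _).symm)
    refine nahm_hom_ext A fun i => ?_
    have h5 : ((w i)⁻¹ * w' i : Bˣ) - (1 : B) = 0 := congrFun hu i
    rw [sub_eq_zero, ← Units.val_one, Units.val_inj, inv_mul_eq_one] at h5
    exact congrArg Units.val h5
  · intro f
    obtain ⟨h1, h2⟩ := nahm_hom_spec A f
    set v : Fin N → (B ⧸ I)ˣ := fun i => Units.map f.toMonoidHom (zUnit A i)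
    let π := Ideal.Quotient.mkₐ (MvPolynomial (Fin N) ℤ) I
    have hnil : IsNilpotent I := ⟨2, hI⟩
    have hlift : ∀ i, ∃ b : Bˣ, π b = v i := by
      intro i
      obtain ⟨b, hb⟩ := Ideal.Quotient.mk_surjective (v i : B ⧸ I)
      have hb' : IsUnit b := by
        rw [← hnil.isUnit_quotient_mk_iff, hb]
        exact (v i).isUnit
      exact ⟨hb'.unit, hb⟩
    choose w hw using hlift
    have hv : (fun i => Units.map π.toMonoidHom (w i)) = v := funext fun i => Units.ext (hw i)
    have hMu : IsUnit (linMat A w).det := by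
      rw [← hnil.isUnit_quotient_mk_iff]
      have h3 := map_linMat A π w
      rw [hv] at h3
      have h4 := isUnit_linMat A v h1 h2
      rw [← h3] at h4
      exact h4
    have he : ∀ i, evalL w (nahmEq A i) ∈ I := by
      intro i
      rw [← Ideal.Quotient.eq_zero_iff_mem]
      have h3 := DFunLike.congr_fun (comp_evalL π w) (nahmEq A i)
      rw [hv, h1] at h3
      exact h3
    let u : Fin N → I := fun i => ⟨((linMat A w)⁻¹.mulVec fun j => evalL w (nahmEq A j)) i,
      by
        rw [Matrix.mulVec, dotProduct]
        exact I.sum_mem fun j _ => I.mul_mem_left _ (he j)⟩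
    have hu : (linMat A w).mulVec (fun j => (u j : B)) = fun j => evalL w (nahmEq A j) := by
      change (linMat A w).mulVec ((linMat A w)⁻¹.mulVec _) = _
      rw [Matrix.mulVec_mulVec, Matrix.mul_nonsing_inv _ hMu, Matrix.one_mulVec]
    let w' : Fin N → Bˣ := fun j => w j * oneAddUnit I hI (Multiplicative.ofAdd (u j))
    have hv' : (fun i => Units.map π.toMonoidHom (w' i)) = v := by
      funext i
      apply Units.ext
      have h3 : π (1 + (u i : B)) = 1 := by
        rw [map_add, map_one, add_eq_left]
        exact Ideal.Quotient.eq_zero_iff_mem.2 (u i).2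
      change π ((w i : B) * (1 + (u i : B))) = _
      rw [map_mul, h3, mul_one, hw]
    obtain ⟨g, hg⟩ := exists_nahm_hom A w' (fun i => by
      rw [nahm_taylor, hu, sub_self]) (by
      rw [← hnil.isUnit_quotient_mk_iff]
      have h3 := DFunLike.congr_fun (comp_evalL π w') (delta A)
      rw [hv'] at h3
      rw [← h3] at h2
      exact h2)
    refine ⟨g, nahm_hom_ext A fun i => ?_⟩
    rw [AlgHom.comp_apply, hg]
    exact congrArg Units.val (congrFun hv' i)

instance nahm_etale : Algebra.Etale (MvPolynomial (Fin N) ℤ) (NahmRing A) where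
  formallyEtale := nahm_formallyEtale A
  finitePresentation := by
    have : Algebra.FiniteType (Laurent N) (Localization.Away (delta A)) :=
      IsLocalization.finiteType_of_monoid_fg (Submonoid.powers (delta A)) _
    have : Algebra.FiniteType (MvPolynomial (Fin N) ℤ) (Localization.Away (delta A)) :=
      Algebra.FiniteType.trans (S := Laurent N) inferInstance inferInstance
    have : Algebra.FiniteType (MvPolynomial (Fin N) ℤ) (NahmRing A) :=
      Algebra.FiniteType.of_surjective (Ideal.Quotient.mkₐ _ _) (Ideal.Quotient.mkₐ_surjective _ _)
    exact Algebra.FinitePresentation.of_finiteType.1 inferInstance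

end Nahm

end Habiro

end

noncomputable section

namespace Habiro

/-! ### Multivariate Lagrange inversion -/

/-! Once n = k + l is fixed, the difference of the quadratic exponents at k and l is linear in k.
The coefficient of t^n in the symmetrised sum therefore factors, by the q-binomial theorem, into a
sign, a power of q and the q-binomials ∏_{j=1}^{n_i} (q^s - q^j)/(1 - q^j) with s = (A n)_i + A_ii
(`coeff_nahmSum_mul`). These are Laurent polynomials for every integer s (`exists_gauss`), so the
sum lies over ℤ[q^{±1}].

On the algebraic side, the series L_c = ∑ t^n ∏ (±1)^{n_i} [w_i^{n_i}] (1 - w_i)^{(A n)_i + c_i}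
satisfy Pascal-type contiguity relations, and these force L_{c+d} L_0 = L_c L_d. Hence c ↦ L_c / L_0
is a monomial map c ↦ z^c, and z solves the Nahm equations. A determinant computation, which is the
Lagrange–Good formula, identifies 1 / L_0 with the Jacobian (`det_jacobian_mul`). As δ is inverted
in R_A, this gives a map R_A → ℤ⟦t⟧ whose image contains every L_c (`lagSeries_mem_range`). Implicit
differentiation shows that the image is stable under t_i ∂/∂t_i, so multiplying coefficients by a
polynomial in n stays in its linear span (`hadamard_mem_span`).

The two sides meet at q = ζ + x with ζ of order m. For n and s in fixed residue classes modulo m,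
the q-binomial is the ordinary binomial [w^{n'}](1 - w)^{s'} times a series in x whose coefficients
are polynomials in n' and s' (`exists_gauss_interp`). Thus each x-coefficient of the sum is, on each
residue class of exponents, a polynomial multiple of the coefficients of some L_c. It lies in the
span of (R_A)_m over the fraction field of ℤ[ζ_m].

Denominators disappear because an integer divides an element of R_A as soon as it divides all its
power series coefficients (`nahm_dvd_of_dvd_coeff`): every element is a fraction of polynomials in w
= 1 - z, and w_i is t_i times a unit. The same principle passes to (R_A)_m
(`dvd_of_dvd_coeff_rootSeries`); its case of the integer 0 in R_A gives injectivity of R_A → ℤ⟦t⟧.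

It also makes the gluing condition checkable on power series modulo p^n. There φ_p is the
substitution λ ↦ λ^p (`modSeries_frobeniusMod`), the inclusion into R_{pm} has the same effect on
exponents, and both sides become the expansion of the same Laurent polynomials at ζ_{pm}
(`mem_habiroRing_of_isExpansion`). -/

/-- The coefficient of `w^n` in `(1 - w)^s`. -/
def bin (s : ℤ) (n : ℕ) : ℤ := (-1) ^ n * Ring.choose s n

@[simp] theorem bin_zero (s : ℤ) : bin s 0 = 1 := by simp [bin]

theorem bin_add_one (s : ℤ) (n : ℕ) : bin (s + 1) (n + 1) = bin s (n + 1) - bin s n := by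
  rw [bin, bin, bin, Ring.choose_succ_succ]
  ring

/-- Compare coefficients in w d/dw (1 - w)^s = s((1 - w)^s - (1 - w)^{s-1}). This relation produces
the null vector in `det_jacobian_mul`. -/
theorem mul_bin (s : ℤ) (n : ℕ) : (n : ℤ) * bin s n + s * (bin (s - 1) n - bin s n) = 0 := by
  cases n with
  | zero => simp
  | succ n =>
    have h1 := bin_add_one (s - 1) n
    have h2 := Ring.choose_smul_choose s (Nat.le_add_left 1 n)
    rw [sub_add_cancel] at h1
    simp only [Nat.choose_one_right, Ring.choose_one_right, Nat.add_sub_cancel, nsmul_eq_mul,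
      Nat.cast_one] at h2
    rw [h1, sub_sub_cancel, ← h1, bin, bin]
    rw [pow_succ]
    linear_combination (-(-1) ^ n) * h2

theorem prod_sub_prod_eq_mul {ι R : Type*} [Fintype ι] [DecidableEq ι] [CommRing R]
    {f g h : ι → R} {a : R} {i : ι} (hi : f i - g i = a * h i) (hf : ∀ j, j ≠ i → f j = h j)
    (hg : ∀ j, j ≠ i → g j = h j) : ∏ j, f j - ∏ j, g j = a * ∏ j, h j := by
  rw [← Finset.mul_prod_erase _ f (Finset.mem_univ i),
    ← Finset.mul_prod_erase _ g (Finset.mem_univ i),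
    ← Finset.mul_prod_erase _ h (Finset.mem_univ i),
    Finset.prod_congr rfl fun j hj => hf j (Finset.ne_of_mem_erase hj),
    Finset.prod_congr rfl fun j hj => hg j (Finset.ne_of_mem_erase hj), ← sub_mul, hi, mul_assoc]

section Lagrange

variable {N : ℕ} (A : Matrix (Fin N) (Fin N) ℤ)

/-- The sign `(-1)^{A_ii}`. -/
def sgn (i : Fin N) : ℤ := (((-1 : ℤˣ) ^ A i i : ℤˣ) : ℤ)

theorem sgn_mul_self (i : Fin N) : sgn A i * sgn A i = 1 := by
  rw [sgn, ← Units.val_mul, Int.units_mul_self, Units.val_one]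

/-- The entry `(A n)_i`. -/
def lin (n : Fin N →₀ ℕ) (i : Fin N) : ℤ := ∑ j, A i j * (n j : ℤ)

theorem lin_add (a b : Fin N →₀ ℕ) (i : Fin N) : lin A (a + b) i = lin A a i + lin A b i := by
  simp [lin, mul_add, Finset.sum_add_distrib]

theorem lin_single (j : Fin N) (i : Fin N) : lin A (Finsupp.single j 1) i = A i j := by
  simp [lin, Finsupp.single_apply]

/-- The series `∑_n t^n ∏_i (-1)^{A_ii n_i} [w_i^{n_i}] (1 - w_i)^{(A n)_i + c_i}`. -/
def lagSeries (c : Fin N → ℤ) : MvPowerSeries (Fin N) ℤ := fun n =>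
  ∏ i, sgn A i ^ n i * bin (lin A n i + c i) (n i)

theorem coeff_lagSeries (c : Fin N → ℤ) (n : Fin N →₀ ℕ) :
    MvPowerSeries.coeff n (lagSeries A c) =
      ∏ i, sgn A i ^ n i * bin (lin A n i + c i) (n i) := rfl

/-- Pascal's rule in slot i. Replacing n by n + e_i adds column i of A to A n; by symmetry this is
row i, and it can be read as a shift of c. -/
theorem lagSeries_sub (hA : A.IsSymm) (c : Fin N → ℤ) (i : Fin N) :
    lagSeries A c - lagSeries A (c + Pi.single i 1) =
      MvPowerSeries.monomial (Finsupp.single i 1) (sgn A i) * lagSeries A (c + A i) := by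
  ext n
  rw [map_sub, MvPowerSeries.coeff_monomial_mul]
  split_ifs with h
  · obtain ⟨n, rfl⟩ := exists_add_of_le h
    rw [add_tsub_cancel_left, coeff_lagSeries, coeff_lagSeries, coeff_lagSeries]
    refine prod_sub_prod_eq_mul (i := i) ?_ (fun j hj => ?_) fun j hj => ?_
    · rw [lin_add, lin_single, Finsupp.add_apply, Finsupp.single_eq_same, Pi.add_apply,
        Pi.single_eq_same, Pi.add_apply, add_comm 1 (n i), ← add_assoc, bin_add_one, pow_succ,
        show A i i + lin A n i + c i = lin A n i + (c i + A i i) by ring]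
      ring
    · rw [lin_add, lin_single, Finsupp.add_apply, Finsupp.single_eq_of_ne hj, zero_add,
        Pi.add_apply, hA.apply]
      ring_nf
    · rw [lin_add, lin_single, Finsupp.add_apply, Finsupp.single_eq_of_ne hj, zero_add,
        Pi.add_apply, Pi.add_apply, Pi.single_eq_of_ne hj, hA.apply]
      ring_nf
  · have h0 : n i = 0 := by
      by_contra h0
      exact h (Finsupp.single_le_iff.2 (Nat.one_le_iff_ne_zero.2 h0))
    rw [sub_eq_zero, coeff_lagSeries, coeff_lagSeries]
    refine Finset.prod_congr rfl fun j _ => ?_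
    by_cases hj : j = i
    · subst hj; simp [h0]
    · rw [Pi.add_apply, Pi.single_eq_of_ne hj, add_zero]

/-- Families satisfying the contiguity relations of `lagSeries` are determined by one member. -/
theorem contiguous_eq_zero {Y : (Fin N → ℤ) → MvPowerSeries (Fin N) ℤ}
    (hY : ∀ c i, Y c - Y (c + Pi.single i 1) =
      MvPowerSeries.monomial (Finsupp.single i 1) (sgn A i) * Y (c + A i))
    (h0 : Y 0 = 0) (c : Fin N → ℤ) : Y c = 0 := by
  suffices h : ∀ d : ℕ, ∀ n : Fin N →₀ ℕ, n.degree < d → ∀ c, MvPowerSeries.coeff n (Y c) = 0 by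
    ext n
    exact h _ n (Nat.lt_succ_self _) c
  intro d
  induction d with
  | zero => intro n hn; simp at hn
  | succ d ih =>
    intro n hn c
    -- The right-hand side of the relation carries a factor t_i, so it only involves coefficients of
    -- lower degree, which vanish by induction. The coefficient at n is thus invariant under unit
    -- shifts of c, hence equal to its value at c = 0.
    have step : ∀ c i, MvPowerSeries.coeff n (Y (c + Pi.single i 1)) =
        MvPowerSeries.coeff n (Y c) := by
      intro c i
      have h1 := congrArg (MvPowerSeries.coeff n) (hY c i)
      rw [map_sub, MvPowerSeries.coeff_monomial_mul] at h1
      split_ifs at h1 with h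
      · obtain ⟨n, rfl⟩ := exists_add_of_le h
        rw [add_tsub_cancel_left, ih n (by simp at hn; omega), mul_zero, sub_eq_zero] at h1
        exact h1.symm
      · exact (sub_eq_zero.1 h1).symm
    have step' : ∀ (i : Fin N) (k : ℤ) c, MvPowerSeries.coeff n (Y (c + Pi.single i k)) =
        MvPowerSeries.coeff n (Y c) := by
      intro i k
      induction k using Int.induction_on with
      | zero => simp
      | succ k ih => intro c; rw [Pi.single_add, ← add_assoc, step, ih]
      | pred k ih =>
        intro c
        rw [← step _ i, add_assoc, ← Pi.single_add, sub_add_cancel, ih]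
    have h2 : ∀ s : Finset (Fin N), MvPowerSeries.coeff n (Y (∑ i ∈ s, Pi.single i (c i))) = 0 := by
      intro s
      induction s using Finset.induction_on with
      | empty => simp [h0]
      | insert i s hi ih => rw [Finset.sum_insert hi, add_comm, step', ih]
    rw [← Finset.univ_sum_single c]
    exact h2 _

/-- For fixed d, both sides satisfy the same linear contiguity relations in c, and they agree at c =
0. -/
theorem lagSeries_mul (hA : A.IsSymm) (c d : Fin N → ℤ) :
    lagSeries A (c + d) * lagSeries A 0 = lagSeries A c * lagSeries A d := by
  have h := contiguous_eq_zero A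
    (Y := fun c => lagSeries A (c + d) * lagSeries A 0 - lagSeries A c * lagSeries A d) ?_ (by
      simp [mul_comm]) c
  · exact sub_eq_zero.1 h
  · intro c i
    have h1 := lagSeries_sub A hA (c + d) i
    have h2 := lagSeries_sub A hA c i
    rw [add_right_comm] at h1
    rw [add_right_comm c d (A i)] at h1
    linear_combination lagSeries A 0 * h1 - lagSeries A d * h2

theorem constantCoeff_lagSeries (c : Fin N → ℤ) :
    MvPowerSeries.constantCoeff (lagSeries A c) = 1 := by
  rw [← MvPowerSeries.coeff_zero_eq_constantCoeff_apply, coeff_lagSeries]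
  simp

theorem isUnit_lagSeries (c : Fin N → ℤ) : IsUnit (lagSeries A c) := by
  rw [MvPowerSeries.isUnit_iff_constantCoeff, constantCoeff_lagSeries]
  exact isUnit_one

/-- The unit `lagSeries A c`. -/
def lagUnit (c : Fin N → ℤ) : (MvPowerSeries (Fin N) ℤ)ˣ := (isUnit_lagSeries A c).unit

theorem val_lagUnit (c : Fin N → ℤ) : (lagUnit A c : MvPowerSeries (Fin N) ℤ) = lagSeries A c := rfl

theorem lagUnit_mul (hA : A.IsSymm) (c d : Fin N → ℤ) :
    lagUnit A (c + d) * lagUnit A 0 = lagUnit A c * lagUnit A d :=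
  Units.ext (lagSeries_mul A hA c d)

/-- The power series solution `z` of the Nahm equations, as the monomial map `c ↦ z^c`. -/
def zPow (hA : A.IsSymm) : Multiplicative (Fin N → ℤ) →* (MvPowerSeries (Fin N) ℤ)ˣ :=
  MonoidHom.mk' (fun c => lagUnit A c.toAdd * (lagUnit A 0)⁻¹) fun c d => by
    rw [toAdd_mul, ← mul_inv_cancel_right (lagUnit A (_ + _)) (lagUnit A 0), lagUnit_mul A hA]
    simp only [mul_assoc, mul_left_comm, mul_comm]

/-- The power series solution `z` of the Nahm equations. -/
def zSeries (hA : A.IsSymm) (i : Fin N) : (MvPowerSeries (Fin N) ℤ)ˣ :=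
  zPow A hA (Multiplicative.ofAdd (Pi.single i 1))

theorem prod_zSeries (hA : A.IsSymm) (c : Fin N → ℤ) :
    ∏ i, zSeries A hA i ^ c i = zPow A hA (Multiplicative.ofAdd c) := by
  simp_rw [zSeries, ← map_zpow]
  rw [← map_prod]
  congr 1
  simp_rw [← ofAdd_zsmul]
  rw [← ofAdd_sum]
  congr 1
  ext i
  simp [Finset.sum_apply, Pi.single_apply]

theorem zPow_mul_lagSeries (hA : A.IsSymm) (c : Fin N → ℤ) :
    (zPow A hA (Multiplicative.ofAdd c) : MvPowerSeries (Fin N) ℤ) * lagSeries A 0 =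
      lagSeries A c := by
  rw [← val_lagUnit, ← val_lagUnit, ← Units.val_mul]
  congr 1
  exact inv_mul_cancel_right _ _

theorem algebraMap_X_series (i : Fin N) :
    algebraMap (MvPolynomial (Fin N) ℤ) (MvPowerSeries (Fin N) ℤ) (MvPolynomial.X i) =
      MvPowerSeries.X i := by
  exact MvPolynomial.coe_X i

/-- The contiguity relation at c = 0, divided by L_0, is the Nahm equation. -/
theorem rhs_zSeries (hA : A.IsSymm) (i : Fin N) :
    rhs A (zSeries A hA) i = 1 - (zSeries A hA i : MvPowerSeries (Fin N) ℤ) := by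
  rw [rhs, prod_zSeries, algebraMap_X_series]
  refine (isUnit_lagSeries A 0).mul_right_cancel ?_
  rw [mul_assoc, zPow_mul_lagSeries, sub_mul, zSeries, zPow_mul_lagSeries, one_mul]
  have h := lagSeries_sub A hA 0 i
  rw [zero_add, zero_add] at h
  rw [h]
  congr 1
  rw [MvPowerSeries.X_def, sgn, ← zsmul_eq_mul, ← map_zsmul, smul_eq_mul, mul_one]

/-! ### The Jacobian -/

/-- Multiplication by z_i⁻¹ lowers c_i by one. A factor z_i⁻¹ - 1 therefore turns slot i of the
coefficient into a difference and leaves the other slots alone. -/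
theorem coeff_prod_sub_mul_lagSeries (hA : A.IsSymm) (I : Finset (Fin N)) (c : Fin N → ℤ)
    (n : Fin N →₀ ℕ) :
    MvPowerSeries.coeff n ((∏ i ∈ I, ((((zSeries A hA i)⁻¹ : (MvPowerSeries (Fin N) ℤ)ˣ) :
        MvPowerSeries (Fin N) ℤ) - 1)) *
      lagSeries A c) = ∏ i, sgn A i ^ n i *
        if i ∈ I then bin (lin A n i + c i - 1) (n i) - bin (lin A n i + c i) (n i)
          else bin (lin A n i + c i) (n i) := by
  induction I using Finset.induction_on generalizing c with
  | empty => simp [coeff_lagSeries]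
  | insert i I hi ih =>
    have h1 : (((zSeries A hA i)⁻¹ : (MvPowerSeries (Fin N) ℤ)ˣ) : MvPowerSeries (Fin N) ℤ) *
        lagSeries A c = lagSeries A (c - Pi.single i 1) := by
      rw [← zPow_mul_lagSeries A hA c, ← zPow_mul_lagSeries A hA (c - _), ← mul_assoc,
        ← Units.val_mul, zSeries, ← map_inv, ← map_mul, ← ofAdd_neg, ← ofAdd_add, neg_add_eq_sub]
    rw [Finset.prod_insert hi, mul_comm (_ - 1), mul_assoc, sub_mul, h1, one_mul, mul_sub, map_sub,
        ih, ih]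
    refine (prod_sub_prod_eq_mul (a := 1) (i := i) (h := fun j => sgn A j ^ n j *
      if j ∈ insert i I then bin (lin A n j + c j - 1) (n j) - bin (lin A n j + c j) (n j)
        else bin (lin A n j + c j) (n j)) ?_ (fun j hj => ?_) fun j hj => ?_).trans (one_mul _)
    · rw [if_neg hi, if_neg hi, if_pos (Finset.mem_insert_self i I), Pi.sub_apply,
        Pi.single_eq_same, ← add_sub_assoc]
      ring
    · simp [Finset.mem_insert, hj]
    · simp [Finset.mem_insert, hj]

/-- Each factor involves one z_i only, so the coefficient is again a product over slots. This allows
a determinant whose i-th column depends on z_i alone to be evaluated coefficient by coefficient. -/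
theorem coeff_prod_add_mul_lagSeries (hA : A.IsSymm) (x y : Fin N → ℤ) (n : Fin N →₀ ℕ) :
    MvPowerSeries.coeff n ((∏ i, ((x i : MvPowerSeries (Fin N) ℤ) + y i *
      ((((zSeries A hA i)⁻¹ : (MvPowerSeries (Fin N) ℤ)ˣ) : MvPowerSeries (Fin N) ℤ) - 1))) *
        lagSeries A 0) = (∏ i, sgn A i ^ n i) * ∏ i, (x i * bin (lin A n i) (n i) +
          y i * (bin (lin A n i - 1) (n i) - bin (lin A n i) (n i))) := by
  simp only [add_comm (x _ : MvPowerSeries (Fin N) ℤ), add_comm (x _ * _)]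
  rw [Fintype.prod_add, Fintype.prod_add, Finset.sum_mul, map_sum, Finset.mul_sum]
  refine Finset.sum_congr rfl fun I _ => ?_
  have h (a b : ℤ) (u v : MvPowerSeries (Fin N) ℤ) :
      MvPowerSeries.coeff n ((a : MvPowerSeries (Fin N) ℤ) * u * (b : MvPowerSeries (Fin N) ℤ) * v)
          =
        a * b * MvPowerSeries.coeff n (u * v) := by
    rw [show (a : MvPowerSeries (Fin N) ℤ) * u * (b : MvPowerSeries (Fin N) ℤ) * v = (a * b : ℤ) •
        (u * v) by
      rw [zsmul_eq_mul, Int.cast_mul]; ring, map_zsmul, smul_eq_mul]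
  rw [Finset.prod_mul_distrib, ← Int.cast_prod, ← Int.cast_prod, h, coeff_prod_sub_mul_lagSeries]
  rw [Finset.prod_mul_distrib (s := Finset.univ), Finset.prod_ite, Finset.prod_mul_distrib,
    Finset.prod_mul_distrib]
  simp only [Pi.zero_apply, add_zero, Finset.filter_mem_eq_inter, Finset.univ_inter]
  have : Finset.univ.filter (· ∉ I) = Iᶜ := by ext; simp
  rw [this]
  ring

/-- The matrix `1 + A diag(z⁻¹ - 1)` of logarithmic derivatives of `t` with respect to `1 - z`. -/
def jacobian (hA : A.IsSymm) : Matrix (Fin N) (Fin N) (MvPowerSeries (Fin N) ℤ) :=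
  Matrix.of fun j i => (if j = i then 1 else 0) +
    (A j i : MvPowerSeries (Fin N) ℤ) *
      ((((zSeries A hA i)⁻¹ : (MvPowerSeries (Fin N) ℤ)ˣ) : MvPowerSeries (Fin N) ℤ) - 1)

/-- In the Leibniz expansion the coefficient at t^n is, up to sign, the determinant of an integer
matrix. For n ≠ 0 the vector n is in its left kernel: entry i of the product is exactly `mul_bin`
with s = (A n)_i. For n = 0 the matrix is the identity. -/
theorem det_jacobian_mul (hA : A.IsSymm) : (jacobian A hA).det * lagSeries A 0 = 1 := by
  have h1 (n : Fin N →₀ ℕ) : MvPowerSeries.coeff n ((jacobian A hA).det * lagSeries A 0) =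
      (∏ i, sgn A i ^ n i) * (Matrix.of fun j i => (if j = i then 1 else 0) * bin (lin A n i) (n i)
          +
        A j i * (bin (lin A n i - 1) (n i) - bin (lin A n i) (n i))).det := by
    rw [Matrix.det_apply, Matrix.det_apply, Finset.sum_mul, map_sum, Finset.mul_sum]
    refine Finset.sum_congr rfl fun τ _ => ?_
    rw [smul_mul_assoc, Units.smul_def, Units.smul_def, map_zsmul, mul_smul_comm]
    congr 1
    simp only [jacobian, Matrix.of_apply]
    have h2 := coeff_prod_add_mul_lagSeries A hA (fun i => if τ i = i then 1 else 0)
      (fun i => A (τ i) i) n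
    simp only [Int.cast_ite, Int.cast_one, Int.cast_zero] at h2
    exact h2
  ext n
  rw [h1]
  by_cases hn : n = 0
  · subst hn
    have : (Matrix.of fun j i : Fin N => (if j = i then (1 : ℤ) else 0) *
        bin (lin A 0 i) ((0 : Fin N →₀ ℕ) i) + A j i * (bin (lin A 0 i - 1) ((0 : Fin N →₀ ℕ) i) -
          bin (lin A 0 i) ((0 : Fin N →₀ ℕ) i))) = 1 := by
      ext j i
      simp [Matrix.one_apply]
    rw [this]
    simp
  · rw [MvPowerSeries.coeff_one, if_neg hn]
    refine mul_eq_zero_of_right _ (Matrix.exists_vecMul_eq_zero_iff.1 ⟨fun i => (n i : ℤ), ?_, ?_⟩)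
    · intro h
      refine hn (Finsupp.ext fun i => ?_)
      exact Int.natCast_eq_zero.1 (congrFun h i)
    · ext i
      have h2 : lin A n i = ∑ j, (n j : ℤ) * A j i := by
        simp_rw [lin, hA.apply]
        exact Finset.sum_congr rfl fun j _ => mul_comm _ _
      have h3 := mul_bin (lin A n i) (n i)
      simp only [Matrix.vecMul, dotProduct, Matrix.of_apply, mul_add, Finset.sum_add_distrib,
        Pi.zero_apply]
      simp only [← mul_assoc, ← Finset.sum_mul, ← h2]
      simpa using h3

/-! ### The embedding of the Nahm algebra in power series -/

/-- Since A is symmetric, the transpose of the linearised matrix is the Jacobian times diag(z). -/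
theorem det_linMat_mul_lagSeries (hA : A.IsSymm) :
    (linMat A (zSeries A hA)).det * lagSeries A 0 =
      (zPow A hA (Multiplicative.ofAdd 1) : MvPowerSeries (Fin N) ℤ) := by
  have h : (linMat A (zSeries A hA)).transpose = jacobian A hA *
      Matrix.diagonal (fun i => (zSeries A hA i : MvPowerSeries (Fin N) ℤ)) := by
    refine Matrix.ext fun j i => ?_
    rw [Matrix.transpose_apply, linMat, Matrix.add_apply, Matrix.diagonal_mul, Matrix.mul_diagonal,
      jacobian, Matrix.of_apply, Matrix.map_apply, rhs_zSeries, Matrix.diagonal_apply, hA.apply]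
    have h1 : (((zSeries A hA i)⁻¹ : (MvPowerSeries (Fin N) ℤ)ˣ) : MvPowerSeries (Fin N) ℤ) *
      zSeries A hA i = 1 := Units.inv_mul _
    by_cases hij : i = j
    · subst hij
      rw [if_pos rfl, if_pos rfl]
      linear_combination (-(A i i : MvPowerSeries (Fin N) ℤ)) * h1
    · rw [if_neg hij, if_neg (Ne.symm hij)]
      linear_combination (-(A j i : MvPowerSeries (Fin N) ℤ)) * h1
  rw [← Matrix.det_transpose, h, Matrix.det_mul, mul_right_comm, det_jacobian_mul, one_mul,
    Matrix.det_diagonal, ← Units.coe_prod, ← prod_zSeries]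
  simp

theorem exists_nahm_series (hA : A.IsSymm) :
    ∃ f : NahmRing A →ₐ[MvPolynomial (Fin N) ℤ] MvPowerSeries (Fin N) ℤ,
      ∀ i, f (zUnit A i) = zSeries A hA i := by
  refine exists_nahm_hom A _ (fun i => ?_) ?_
  · rw [evalL_nahmEq, rhs_zSeries, sub_self]
  · rw [evalL_delta]
    have h : (fun i => 1 - (zSeries A hA i : MvPowerSeries (Fin N) ℤ)) = rhs A (zSeries A hA) :=
      funext fun i => (rhs_zSeries A hA i).symm
    rw [h]
    refine IsUnit.of_mul_eq_one
      (lagSeries A 0 * ((zPow A hA (Multiplicative.ofAdd 1))⁻¹ : (MvPowerSeries (Fin N) ℤ)ˣ)) ?_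
    rw [← mul_assoc]
    exact (congrArg (· * _) (det_linMat_mul_lagSeries A hA)).trans (Units.mul_inv _)

/-- The embedding `R_A → ℤ⟦t⟧`. -/
def nahmSeries (hA : A.IsSymm) : NahmRing A →ₐ[MvPolynomial (Fin N) ℤ] MvPowerSeries (Fin N) ℤ :=
  (exists_nahm_series A hA).choose

theorem nahmSeries_zUnit (hA : A.IsSymm) (i : Fin N) :
    nahmSeries A hA (zUnit A i) = zSeries A hA i :=
  (exists_nahm_series A hA).choose_spec i

theorem map_zUnit (hA : A.IsSymm) :
    (fun i => Units.map (nahmSeries A hA).toMonoidHom (zUnit A i)) = zSeries A hA :=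
  funext fun i => Units.ext (nahmSeries_zUnit A hA i)

theorem isUnit_linMat_zUnit : IsUnit (linMat A (zUnit A)).det := by
  obtain ⟨h1, h2⟩ := nahm_hom_spec A (AlgHom.id _ _)
  have h : (fun i => Units.map (AlgHom.id (MvPolynomial (Fin N) ℤ) (NahmRing A)).toMonoidHom
    (zUnit A i)) = zUnit A := funext fun i => Units.ext rfl
  rw [h] at h1 h2
  exact isUnit_linMat A _ h1 h2

theorem rhs_zUnit (i : Fin N) : rhs A (zUnit A) i = 1 - (zUnit A i : NahmRing A) := by
  obtain ⟨h1, -⟩ := nahm_hom_spec A (AlgHom.id _ _)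
  have h : (fun i => Units.map (AlgHom.id (MvPolynomial (Fin N) ℤ) (NahmRing A)).toMonoidHom
    (zUnit A i)) = zUnit A := funext fun i => Units.ext rfl
  have h3 := h1 i
  rw [h, evalL_nahmEq] at h3
  linear_combination -h3

/-- L_c = z^c · ∏ z_i / det(`linMat`), and this determinant is already invertible in R_A because δ
is. -/
theorem lagSeries_mem_range (hA : A.IsSymm) (c : Fin N → ℤ) :
    ∃ r, nahmSeries A hA r = lagSeries A c := by
  have h1 : nahmSeries A hA (linMat A (zUnit A)).det = (linMat A (zSeries A hA)).det := by
    rw [map_linMat, map_zUnit]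
  obtain ⟨u, hu⟩ := isUnit_linMat_zUnit A
  have h2 (c : Fin N → ℤ) : nahmSeries A hA ((∏ i, zUnit A i ^ c i : (NahmRing A)ˣ) : NahmRing A) =
      (zPow A hA (Multiplicative.ofAdd c) : MvPowerSeries (Fin N) ℤ) := by
    rw [← prod_zSeries, ← map_zUnit]
    change ((Units.map (nahmSeries A hA).toMonoidHom _ : (MvPowerSeries (Fin N) ℤ)ˣ) :
      MvPowerSeries (Fin N) ℤ) = _
    rw [map_prod]
    simp_rw [map_zpow]
  refine ⟨(∏ i, zUnit A i ^ c i : (NahmRing A)ˣ) *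
    ((u⁻¹ : (NahmRing A)ˣ) * (∏ i, zUnit A i ^ (1 : Fin N → ℤ) i : (NahmRing A)ˣ)), ?_⟩
  rw [map_mul, h2, ← zPow_mul_lagSeries A hA c, map_mul, h2, ← det_linMat_mul_lagSeries, ←
      mul_assoc,
    ← h1, ← hu, ← mul_assoc, mul_assoc _ _ (nahmSeries A hA u), ← map_mul, Units.inv_mul, map_one,
    mul_one]

end Lagrange

/-! ### Divisibility in the Nahm algebra is detected by power series -/

/-- The monomial v^α starts at t^α with an invertible coefficient, so substituting v is triangular.
The coefficients of P are recovered modulo M by induction on the degree. -/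
theorem dvd_coeff_of_dvd_coeff_eval {σ : Type*} {v U : σ → MvPowerSeries σ ℤ}
    (hv : ∀ i, v i = MvPowerSeries.X i * U i)
    (hU : ∀ i, IsUnit (MvPowerSeries.constantCoeff (U i))) {M : ℤ} {P : MvPolynomial σ ℤ}
    (h : ∀ n, M ∣ MvPowerSeries.coeff n (MvPolynomial.eval₂Hom (Int.castRingHom _) v P))
    (n : σ →₀ ℕ) : M ∣ P.coeff n := by
  classical
  induction hd : n.degree using Nat.strong_induction_on generalizing n with
  | _ d ih =>
    have hmon (α : σ →₀ ℕ) : (α.prod fun i k => v i ^ k) =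
        MvPowerSeries.monomial α 1 * α.prod fun i k => U i ^ k := by
      simp_rw [hv, mul_pow]
      rw [Finsupp.prod_mul, ← MvPowerSeries.monomial_one_eq]
    have hc : MvPowerSeries.coeff n (MvPolynomial.eval₂Hom (Int.castRingHom _) v P) =
        ∑ α ∈ P.support, P.coeff α *
          if α ≤ n then MvPowerSeries.coeff (n - α) (α.prod fun i k => U i ^ k) else 0 := by
      rw [MvPolynomial.coe_eval₂Hom, MvPolynomial.eval₂_eq, map_sum]
      refine Finset.sum_congr rfl fun α _ => ?_
      have := hmon α
      rw [Finsupp.prod] at this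
      rw [this, eq_intCast, ← zsmul_eq_mul, map_zsmul, smul_eq_mul,
        MvPowerSeries.coeff_monomial_mul]
      simp
    by_cases hn : n ∈ P.support
    · have h1 := h n
      rw [hc, ← Finset.add_sum_erase _ _ hn, if_pos le_rfl, tsub_self] at h1
      have h2 : M ∣ ∑ α ∈ P.support.erase n, P.coeff α *
          if α ≤ n then MvPowerSeries.coeff (n - α) (α.prod fun i k => U i ^ k) else 0 := by
        refine Finset.dvd_sum fun α hα => ?_
        split_ifs with hle
        · refine Dvd.dvd.mul_right (ih _ ?_ α rfl) _
          obtain ⟨β, rfl⟩ := exists_add_of_le hle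
          have hβ : β ≠ 0 := by
            rintro rfl
            exact Finset.ne_of_mem_erase hα (add_zero α).symm
          rw [← hd, map_add]
          have : β.degree ≠ 0 := fun h => hβ ((Finsupp.degree_eq_zero_iff β).1 h)
          omega
        · simp
      have h3 := (Int.dvd_add_left h2).1 h1
      refine (IsUnit.dvd_mul_right ?_).1 h3
      rw [MvPowerSeries.coeff_zero_eq_constantCoeff_apply, Finsupp.prod, map_prod]
      refine Finset.prod_induction _ IsUnit (fun _ _ => IsUnit.mul) isUnit_one fun i _ => ?_
      rw [map_pow]
      exact (hU i).pow _
    · rw [MvPolynomial.notMem_support_iff.1 hn]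
      exact dvd_zero M

/-! ### Elements of R_A as fractions of polynomials in z. -/

section Lagrange

variable {N : ℕ} (A : Matrix (Fin N) (Fin N) ℤ)

/-- A subalgebra of `R_A` that contains `z` and is closed under inverses is everything. -/
theorem nahm_subalgebra_eq_top (S : Subalgebra (MvPolynomial (Fin N) ℤ) (NahmRing A))
    (hz : ∀ i, (zUnit A i : NahmRing A) ∈ S)
    (hinv : ∀ u : (NahmRing A)ˣ, (u : NahmRing A) ∈ S → ((u⁻¹ : (NahmRing A)ˣ) : NahmRing A) ∈ S) :
    S = ⊤ := by
  let w : Fin N → Sˣ := fun i =>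
    ⟨⟨_, hz i⟩, ⟨_, hinv _ (hz i)⟩, Subtype.ext (Units.mul_inv _), Subtype.ext (Units.inv_mul _)⟩
  have hw : (fun i => Units.map S.val.toMonoidHom (w i)) = zUnit A :=
    funext fun i => Units.ext rfl
  have hid : (fun i => Units.map (AlgHom.id (MvPolynomial (Fin N) ℤ) (NahmRing A)).toMonoidHom
    (zUnit A i)) = zUnit A := funext fun i => Units.ext rfl
  obtain ⟨h1, h2⟩ := nahm_hom_spec A (AlgHom.id _ _)
  rw [hid] at h1 h2
  have hval (x) : ((evalL w x : S) : NahmRing A) = evalL (zUnit A) x := by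
    have := DFunLike.congr_fun (comp_evalL S.val w) x
    rw [hw] at this
    exact this
  -- S contains a solution of the Nahm equations with δ invertible in S, so the universal property
  -- gives R_A → S. Composed with the inclusion it fixes z, hence it is the identity.
  obtain ⟨g, hg⟩ := exists_nahm_hom A w (fun i => Subtype.ext ((hval _).trans (h1 i))) (by
    obtain ⟨u, hu⟩ := h2
    have hu' : (u : NahmRing A) ∈ S := by rw [hu, ← hval]; exact Subtype.property _
    refine IsUnit.of_mul_eq_one (⟨_, hinv u hu'⟩ : S) (Subtype.ext ?_)
    change ((evalL w (delta A) : S) : NahmRing A) * _ = 1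
    rw [hval, ← hu, Units.mul_inv])
  have h3 : S.val.comp g = AlgHom.id _ _ := nahm_hom_ext A fun i => by
    rw [AlgHom.comp_apply, hg]
    rfl
  rw [eq_top_iff]
  intro x _
  have := DFunLike.congr_fun h3 x
  rw [AlgHom.comp_apply, AlgHom.id_apply] at this
  rw [← this]
  exact (g x).2

/-- Evaluation of integral polynomials at `1 - z`. -/
def evalW : MvPolynomial (Fin N) ℤ →+* NahmRing A :=
  MvPolynomial.eval₂Hom (Int.castRingHom _) fun i => 1 - (zUnit A i : NahmRing A)

/-- The elements of `R_A` that are fractions of polynomials in `z`. -/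
def fracSubring : Subring (NahmRing A) where
  carrier := {r | ∃ P Q, IsUnit (evalW A Q) ∧ evalW A Q * r = evalW A P}
  mul_mem' := by
    rintro a b ⟨P, Q, hQ, h⟩ ⟨P', Q', hQ', h'⟩
    refine ⟨P * P', Q * Q', by rw [map_mul]; exact hQ.mul hQ', ?_⟩
    rw [map_mul, map_mul, ← h, ← h']
    ring
  one_mem' := ⟨1, 1, by simp, by simp⟩
  add_mem' := by
    rintro a b ⟨P, Q, hQ, h⟩ ⟨P', Q', hQ', h'⟩
    refine ⟨P * Q' + P' * Q, Q * Q', by rw [map_mul]; exact hQ.mul hQ', ?_⟩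
    rw [map_add, map_mul, map_mul, map_mul, ← h, ← h']
    ring
  zero_mem' := ⟨0, 1, by simp, by simp⟩
  neg_mem' := by
    rintro a ⟨P, Q, hQ, h⟩
    exact ⟨-P, Q, hQ, by rw [map_neg, ← h]; ring⟩

theorem inv_mem_fracSubring {u : (NahmRing A)ˣ} (hu : (u : NahmRing A) ∈ fracSubring A) :
    ((u⁻¹ : (NahmRing A)ˣ) : NahmRing A) ∈ fracSubring A := by
  obtain ⟨P, Q, hQ, h⟩ := hu
  refine ⟨Q, P, ?_, ?_⟩
  · rw [← h]
    exact hQ.mul u.isUnit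
  · rw [← h, mul_assoc, Units.mul_inv, mul_one]

theorem zUnit_mem_fracSubring (i : Fin N) : (zUnit A i : NahmRing A) ∈ fracSubring A :=
  ⟨1 - MvPolynomial.X i, 1, by simp, by simp [evalW]⟩

theorem zpow_mem_fracSubring (i : Fin N) (k : ℤ) :
    ((zUnit A i ^ k : (NahmRing A)ˣ) : NahmRing A) ∈ fracSubring A := by
  cases k with
  | ofNat k => simpa using pow_mem (zUnit_mem_fracSubring A i) k
  | negSucc k =>
    rw [zpow_negSucc]
    apply inv_mem_fracSubring
    rw [Units.val_pow_eq_pow_val]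
    exact pow_mem (zUnit_mem_fracSubring A i) _

/-- The Nahm equation can be solved for t_i, namely t_i = ±(1 - z_i) z^{-A_i}. This eliminates t
from R_A. -/
theorem algebraMap_X_mem_fracSubring (i : Fin N) :
    algebraMap (MvPolynomial (Fin N) ℤ) (NahmRing A) (MvPolynomial.X i) ∈ fracSubring A := by
  have h := rhs_zUnit A i
  have hs : ((sgn A i : ℤ) : NahmRing A) * ((sgn A i : ℤ) : NahmRing A) = 1 := by
    rw [← Int.cast_mul, sgn_mul_self, Int.cast_one]
  have h2 : algebraMap (MvPolynomial (Fin N) ℤ) (NahmRing A) (MvPolynomial.X i) =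
      ((sgn A i : ℤ) : NahmRing A) * (1 - (zUnit A i : NahmRing A)) *
        (((∏ j, zUnit A j ^ A i j)⁻¹ : (NahmRing A)ˣ) : NahmRing A) := by
    rw [← h, rhs, ← sgn, ← mul_assoc, mul_assoc _ _ (((∏ j, zUnit A j ^ A i j)⁻¹ :
      (NahmRing A)ˣ) : NahmRing A), Units.mul_inv, mul_one, ← mul_assoc, hs, one_mul]
  rw [h2]
  refine mul_mem (mul_mem (intCast_mem _ _) (sub_mem (one_mem _) (zUnit_mem_fracSubring A i))) ?_
  apply inv_mem_fracSubring
  rw [Units.coe_prod]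
  exact prod_mem fun j _ => zpow_mem_fracSubring A j _

theorem mem_fracSubring (r : NahmRing A) : r ∈ fracSubring A := by
  let S : Subalgebra (MvPolynomial (Fin N) ℤ) (NahmRing A) :=
    { fracSubring A with
      algebraMap_mem' := fun p => by
        induction p using MvPolynomial.induction_on with
        | C a =>
          have : algebraMap (MvPolynomial (Fin N) ℤ) (NahmRing A) (MvPolynomial.C a) = a := by
            rw [eq_intCast MvPolynomial.C, map_intCast]
          rw [this]
          exact intCast_mem (fracSubring A) a
        | add p q hp hq => rw [map_add]; exact (fracSubring A).add_mem hp hq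
        | mul_X p i hp =>
          rw [map_mul]
          exact (fracSubring A).mul_mem hp (algebraMap_X_mem_fracSubring A i) }
  have hS : S = ⊤ := nahm_subalgebra_eq_top A S (zUnit_mem_fracSubring A)
    fun u hu => inv_mem_fracSubring A hu
  have : r ∈ S := hS ▸ Algebra.mem_top
  exact this

theorem constantCoeff_zPow (hA : A.IsSymm) (c : Multiplicative (Fin N → ℤ)) :
    MvPowerSeries.constantCoeff (zPow A hA c : MvPowerSeries (Fin N) ℤ) = 1 := by
  have := congrArg MvPowerSeries.constantCoeff (zPow_mul_lagSeries A hA c.toAdd)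
  rwa [map_mul, constantCoeff_lagSeries, constantCoeff_lagSeries, mul_one] at this

/-- An integer divides an element of `R_A` if it divides its power series. -/
theorem nahm_dvd_of_dvd_coeff (hA : A.IsSymm) (M : ℤ) (r : NahmRing A)
    (h : ∀ n, M ∣ MvPowerSeries.coeff n (nahmSeries A hA r)) : (M : NahmRing A) ∣ r := by
  -- With r = P(w)/Q(w) and w = 1 - z, divisibility of r reduces to that of P(w). The Nahm equation
  -- writes w_i as t_i times a unit series, so M divides the polynomial P itself.
  obtain ⟨P, Q, hQ, hr⟩ := mem_fracSubring A r
  refine (hQ.dvd_mul_left).1 ?_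
  rw [hr]
  have hP : (nahmSeries A hA).toRingHom.comp (evalW A) =
      MvPolynomial.eval₂Hom (Int.castRingHom _) fun i =>
        MvPowerSeries.X i * ((sgn A i : MvPowerSeries (Fin N) ℤ) *
          (zPow A hA (Multiplicative.ofAdd fun j => A i j) : MvPowerSeries (Fin N) ℤ)) := by
    refine polyInt_hom_ext fun i => ?_
    have h1 := rhs_zSeries A hA i
    rw [rhs, prod_zSeries, algebraMap_X_series, ← sgn] at h1
    rw [RingHom.comp_apply, evalW, MvPolynomial.eval₂Hom_X', MvPolynomial.eval₂Hom_X']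
    change nahmSeries A hA (1 - zUnit A i) = _
    rw [map_sub, map_one, nahmSeries_zUnit, ← h1]
    ring
  have hc := dvd_coeff_of_dvd_coeff_eval (M := M) (P := P)
    (v := fun i => MvPowerSeries.X i * ((sgn A i : MvPowerSeries (Fin N) ℤ) *
          (zPow A hA (Multiplicative.ofAdd fun j => A i j) : MvPowerSeries (Fin N) ℤ)))
    (fun i => rfl) (fun i => by
      rw [map_mul, constantCoeff_zPow, mul_one, map_intCast, Int.cast_id]
      exact IsUnit.of_mul_eq_one _ (sgn_mul_self A i)) (fun n => by
      rw [← hP, RingHom.comp_apply, ← hr]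
      change M ∣ MvPowerSeries.coeff n (nahmSeries A hA _)
      rw [map_mul, MvPowerSeries.coeff_mul]
      exact Finset.dvd_sum fun x _ => (h x.2).mul_left _)
  have hd : MvPolynomial.C M ∣ P := MvPolynomial.C_dvd_iff_dvd_coeff M P |>.2 hc
  have := map_dvd (evalW A) hd
  rwa [eq_intCast MvPolynomial.C, map_intCast] at this

/-- Only 0 is divisible by 0, so this is the divisibility criterion with M = 0. -/
theorem nahmSeries_injective (hA : A.IsSymm) : Function.Injective (nahmSeries A hA) := by
  rw [injective_iff_map_eq_zero]
  intro r hr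
  have := nahm_dvd_of_dvd_coeff A hA 0 r fun n => by simp [hr]
  simpa using this

end Lagrange

/-! ### Euler derivations -/

/-- The logarithmic derivative. -/
def logDer {R B : Type*} [CommRing R] [CommRing B] [Algebra R B] (D : Derivation R B B) :
    Bˣ →* Multiplicative B where
  toFun u := Multiplicative.ofAdd (((u⁻¹ : Bˣ) : B) * D u)
  map_one' := by simp
  map_mul' u v := by
    rw [← ofAdd_add, Units.val_mul, D.leibniz, smul_eq_mul, smul_eq_mul, mul_inv, Units.val_mul]
    congr 1
    have h1 : ((u⁻¹ : Bˣ) : B) * u = 1 := u.inv_mul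
    have h2 : ((v⁻¹ : Bˣ) : B) * v = 1 := v.inv_mul
    linear_combination (((v⁻¹ : Bˣ) : B) * D v) * h1 + (((u⁻¹ : Bˣ) : B) * D u) * h2

theorem der_unit {R B : Type*} [CommRing R] [CommRing B] [Algebra R B] (D : Derivation R B B)
    (u : Bˣ) : D u = u * (logDer D u).toAdd := by
  simp [logDer]

theorem logDer_prod_zpow {R B ι : Type*} [CommRing R] [CommRing B] [Algebra R B] [Fintype ι]
    (D : Derivation R B B) (w : ι → Bˣ) (a : ι → ℤ) :
    (logDer D (∏ j, w j ^ a j)).toAdd = ∑ j, (a j : B) * (logDer D (w j)).toAdd := by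
  rw [map_prod, toAdd_prod]
  refine Finset.sum_congr rfl fun j _ => ?_
  rw [map_zpow, toAdd_zpow, zsmul_eq_mul]

/-- The derivation `t_i ∂/∂t_i` of `R⟦t⟧`. -/
def euler {σ R : Type*} [CommRing R] (i : σ) :
    Derivation R (MvPowerSeries σ R) (MvPowerSeries σ R) :=
  (MvPowerSeries.X i : MvPowerSeries σ R) • MvPowerSeries.pderiv R i

theorem euler_apply {σ R : Type*} [CommRing R] (i : σ) (f : MvPowerSeries σ R) :
    euler i f = MvPowerSeries.X i * MvPowerSeries.pderiv R i f := rfl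

theorem coeff_euler {σ R : Type*} [CommRing R] (i : σ) (f : MvPowerSeries σ R) (n : σ →₀ ℕ) :
    MvPowerSeries.coeff n (euler i f) = n i * MvPowerSeries.coeff n f := by
  classical
  rw [euler_apply, MvPowerSeries.X, MvPowerSeries.coeff_monomial_mul]
  split_ifs with h
  · rw [MvPowerSeries.coeff_pderiv, tsub_add_cancel_of_le h, one_mul, mul_comm]
    congr 1
    have := Finsupp.single_le_iff.1 h
    rw [Finsupp.tsub_apply, Finsupp.single_eq_same]
    push_cast [this]
    ring
  · have h0 : n i = 0 := by
      by_contra h0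
      exact h (Finsupp.single_le_iff.2 (Nat.one_le_iff_ne_zero.2 h0))
    simp [h0]

/-- Multiplication of the coefficients by a polynomial in the exponents. -/
def hadamard {σ R : Type*} [CommRing R] (g : MvPolynomial σ R) (f : MvPowerSeries σ R) :
    MvPowerSeries σ R :=
  fun n => MvPolynomial.eval (fun i => (n i : R)) g * MvPowerSeries.coeff n f

theorem coeff_hadamard {σ R : Type*} [CommRing R] (g : MvPolynomial σ R) (f : MvPowerSeries σ R)
    (n : σ →₀ ℕ) : MvPowerSeries.coeff n (hadamard g f) =
      MvPolynomial.eval (fun i => (n i : R)) g * MvPowerSeries.coeff n f := rfl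

section Lagrange

variable {N : ℕ} (A : Matrix (Fin N) (Fin N) ℤ)

/-- Apply t_i ∂/∂t_i to the Nahm equations. The matrix acting on the logarithmic derivatives of z is
the linearised one, and the inhomogeneous term comes from the explicit t_i in equation i. -/
theorem linMat_mulVec_logDer (hA : A.IsSymm) (i : Fin N) :
    (linMat A (zSeries A hA)).mulVec (fun j => (logDer (euler i) (zSeries A hA j)).toAdd) =
      fun j => if j = i then (zSeries A hA j : MvPowerSeries (Fin N) ℤ) - 1 else 0 := by
  funext j
  have h := congrArg (euler i) (rhs_zSeries A hA j)
  rw [map_sub, Derivation.map_one_eq_zero, zero_sub, rhs, algebraMap_X_series, Derivation.leibniz,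
    Derivation.leibniz, Derivation.map_intCast, smul_zero, add_zero, der_unit, der_unit,
    logDer_prod_zpow] at h
  simp only [smul_eq_mul] at h
  have h2 := rhs_zSeries A hA j
  rw [rhs, algebraMap_X_series] at h2
  rw [linMat, Matrix.add_mulVec, ← Matrix.mulVec_mulVec, Pi.add_apply, Matrix.mulVec_diagonal,
    Matrix.mulVec_diagonal]
  have h3 : (A.map (fun a : ℤ => (a : MvPowerSeries (Fin N) ℤ))).mulVec
      (fun j => (logDer (euler i) (zSeries A hA j)).toAdd) j =
        ∑ k, (A j k : MvPowerSeries (Fin N) ℤ) * (logDer (euler i) (zSeries A hA k)).toAdd := rfl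
  have hX : euler i (MvPowerSeries.X j : MvPowerSeries (Fin N) ℤ) =
      if j = i then MvPowerSeries.X j else 0 := by
    rw [euler_apply, MvPowerSeries.pderiv_X]
    by_cases hij : j = i
    · subst hij; simp
    · simp [hij]
  rw [h3, rhs, algebraMap_X_series]
  rw [hX] at h
  split_ifs at h ⊢ with hij
  · linear_combination h - h2
  · linear_combination h

theorem map_linMat_zUnit (hA : A.IsSymm) :
    (linMat A (zUnit A)).map (nahmSeries A hA) = linMat A (zSeries A hA) := by
  have h (i : Fin N) : nahmSeries A hA (rhs A (zUnit A) i) = rhs A (zSeries A hA) i := by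
    rw [rhs_zUnit, rhs_zSeries, map_sub, map_one, nahmSeries_zUnit]
  rw [linMat, linMat, Matrix.map_add _ (map_add _), Matrix.map_mul,
    Matrix.diagonal_map (map_zero _), Matrix.diagonal_map (map_zero _), Matrix.map_map]
  congr! 3
  · simp [h]
  · exact Matrix.ext fun i j => by simp
  · simp [nahmSeries_zUnit]

/-- The linear system for the logarithmic derivatives has coefficients in R_A and an invertible
matrix there. It is solved in R_A, and uniqueness over ℤ⟦t⟧ identifies the solution. -/
theorem exists_euler_zSeries (hA : A.IsSymm) (i j : Fin N) :
    ∃ r, nahmSeries A hA r = euler i (zSeries A hA j) := by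
  let v : Fin N → NahmRing A := fun j => if j = i then (zUnit A j : NahmRing A) - 1 else 0
  let u := (linMat A (zUnit A))⁻¹.mulVec v
  have hu : (linMat A (zUnit A)).mulVec u = v := by
    rw [Matrix.mulVec_mulVec, Matrix.mul_nonsing_inv _ (isUnit_linMat_zUnit A), Matrix.one_mulVec]
  have hM : IsUnit (linMat A (zSeries A hA)).det := by
    rw [← map_zUnit, ← map_linMat]
    exact (isUnit_linMat_zUnit A).map _
  have h1 : (linMat A (zSeries A hA)).mulVec (fun j => nahmSeries A hA (u j)) =
      fun j => if j = i then (zSeries A hA j : MvPowerSeries (Fin N) ℤ) - 1 else 0 := by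
    have h2 : (fun j => nahmSeries A hA (u j)) = nahmSeries A hA ∘ u := rfl
    rw [← map_linMat_zUnit, h2]
    funext j
    have := RingHom.map_mulVec (nahmSeries A hA).toRingHom (linMat A (zUnit A)) u j
    rw [hu] at this
    refine this.symm.trans ?_
    change nahmSeries A hA (if j = i then (zUnit A j : NahmRing A) - 1 else 0) = _
    split_ifs
    · rw [map_sub, map_one, nahmSeries_zUnit]
    · exact map_zero _
  have h2 := Matrix.mulVec_injective_of_isUnit ((Matrix.isUnit_iff_isUnit_det _).2 hM)
    (h1.trans (linMat_mulVec_logDer A hA i).symm)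
  refine ⟨zUnit A j * u j, ?_⟩
  rw [map_mul, nahmSeries_zUnit, der_unit]
  exact congrArg _ (congrFun h2 j)

/-- The elements whose Euler derivative stays in the image form a subalgebra that contains z and is
closed under inverses of units. -/
theorem exists_euler_nahmSeries (hA : A.IsSymm) (i : Fin N) (r : NahmRing A) :
    ∃ r', nahmSeries A hA r' = euler i (nahmSeries A hA r) := by
  let S : Subalgebra (MvPolynomial (Fin N) ℤ) (NahmRing A) :=
    { carrier := {r | ∃ r', nahmSeries A hA r' = euler i (nahmSeries A hA r)}
      mul_mem' := by
        rintro a b ⟨a', ha⟩ ⟨b', hb⟩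
        exact ⟨a * b' + b * a', by simp [ha, hb, Derivation.leibniz]⟩
      add_mem' := by
        rintro a b ⟨a', ha⟩ ⟨b', hb⟩
        exact ⟨a' + b', by simp [ha, hb]⟩
      algebraMap_mem' := fun p => by
        refine ⟨algebraMap _ _ (MvPolynomial.X i * MvPolynomial.pderiv i p), ?_⟩
        rw [AlgHom.commutes, AlgHom.commutes]
        have h (q : MvPolynomial (Fin N) ℤ) : algebraMap (MvPolynomial (Fin N) ℤ)
          (MvPowerSeries (Fin N) ℤ) q = (q : MvPowerSeries (Fin N) ℤ) := rfl
        rw [h, h, euler_apply, MvPowerSeries.pderiv_coe, MvPolynomial.coe_mul,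
          MvPolynomial.coe_X] }
  have hS : S = ⊤ := by
    refine nahm_subalgebra_eq_top A S (fun j => ?_) fun u hu => ?_
    · obtain ⟨r, hr⟩ := exists_euler_zSeries A hA i j
      exact ⟨r, by rw [hr, nahmSeries_zUnit]⟩
    · obtain ⟨a, ha⟩ := hu
      refine ⟨-((u⁻¹ : (NahmRing A)ˣ) : NahmRing A) ^ 2 * a, ?_⟩
      rw [Derivation.leibniz_of_mul_eq_one (euler i)
        (b := nahmSeries A hA u) (by rw [← map_mul, Units.inv_mul, map_one]), ← ha]
      simp
  have : r ∈ S := hS ▸ Algebra.mem_top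
  exact this

/-- The `K`-span of `R_A` in `K⟦t⟧` is closed under multiplying the coefficients by a polynomial
in the exponents. -/
theorem hadamard_mem_span (hA : A.IsSymm) {K : Type*} [CommRing K] (g : MvPolynomial (Fin N) K)
    (r : NahmRing A) :
    hadamard g (MvPowerSeries.map (Int.castRingHom K) (nahmSeries A hA r)) ∈
      Submodule.span K (Set.range fun r =>
        MvPowerSeries.map (Int.castRingHom K) (nahmSeries A hA r)) := by
  induction g using MvPolynomial.induction_on generalizing r with
  | C a =>
    have h : hadamard (MvPolynomial.C a)
        (MvPowerSeries.map (Int.castRingHom K) (nahmSeries A hA r)) =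
        a • MvPowerSeries.map (Int.castRingHom K) (nahmSeries A hA r) := by
      ext n
      rw [coeff_hadamard, MvPowerSeries.coeff_smul, MvPolynomial.eval_C]
    rw [h]
    exact Submodule.smul_mem _ _ (Submodule.subset_span ⟨r, rfl⟩)
  | add p q hp hq =>
    have h (f : MvPowerSeries (Fin N) K) : hadamard (p + q) f = hadamard p f + hadamard q f := by
      ext n
      simp only [coeff_hadamard, map_add, add_mul]
    rw [h]
    exact Submodule.add_mem _ (hp r) (hq r)
  | mul_X p i hp =>
    obtain ⟨r', hr'⟩ := exists_euler_nahmSeries A hA i r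
    have h : hadamard (p * MvPolynomial.X i)
        (MvPowerSeries.map (Int.castRingHom K) (nahmSeries A hA r)) =
          hadamard p (MvPowerSeries.map (Int.castRingHom K) (nahmSeries A hA r')) := by
      ext n
      rw [coeff_hadamard, coeff_hadamard, hr', MvPowerSeries.coeff_map, MvPowerSeries.coeff_map,
        coeff_euler, map_mul, MvPolynomial.eval_X, mul_assoc, map_mul, map_natCast]
    rw [h]
    exact hp r'

end Lagrange

/-! ### Divisibility in `R_m` is detected by power series -/

section Residue

variable {σ : Type*} [Fintype σ] {m : ℕ}

/-- A tuple of residues as an exponent. -/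
def resExp (ρ : σ → Fin m) : σ →₀ ℕ := Finsupp.equivFunOnFinite.symm fun i => (ρ i : ℕ)

@[simp] theorem resExp_apply (ρ : σ → Fin m) (i : σ) : resExp ρ i = ρ i := rfl

theorem exists_eq_smul_add_resExp (hm : m ≠ 0) (n : σ →₀ ℕ) :
    ∃ (n' : σ →₀ ℕ) (ρ : σ → Fin m), n = m • n' + resExp ρ := by
  refine ⟨Finsupp.equivFunOnFinite.symm fun i => n i / m,
    fun i => ⟨n i % m, Nat.mod_lt _ (Nat.pos_of_ne_zero hm)⟩, Finsupp.ext fun i => ?_⟩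
  exact (Nat.div_add_mod (n i) m).symm

/-- Residue classes of exponents modulo m do not interact, so a sum over ρ of such series can be
read off class by class. -/
theorem coeff_monomial_mul_expand {C : Type*} [CommRing C] (hm : m ≠ 0) (ρ ρ' : σ → Fin m)
    (n : σ →₀ ℕ) (c : C) (f : MvPowerSeries σ C) :
    MvPowerSeries.coeff (m • n + resExp ρ) (MvPowerSeries.monomial (resExp ρ') c *
      MvPowerSeries.expand m hm f) = if ρ' = ρ then c * MvPowerSeries.coeff n f else 0 := by
  rw [MvPowerSeries.coeff_monomial_mul]
  by_cases h : ρ' = ρ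
  · subst h
    rw [if_pos (le_add_self), add_tsub_cancel_right, if_pos rfl, MvPowerSeries.coeff_expand_smul]
  · rw [if_neg h]
    split_ifs with hle
    · obtain ⟨i, hi⟩ := Function.ne_iff.1 h
      rw [MvPowerSeries.coeff_expand_of_not_dvd m hm f (i := i), mul_zero]
      intro hd
      have h1 := hle i
      simp only [Finsupp.coe_tsub, Finsupp.coe_add, Finsupp.coe_smul, Pi.sub_apply, Pi.add_apply,
        Pi.smul_apply, smul_eq_mul, resExp_apply] at hd h1
      obtain ⟨k, hk⟩ := hd
      have h2 : m * n i + ρ i = m * k + ρ' i := by omega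
      have h3 := congrArg (· % m) h2
      simp only [Nat.mul_add_mod, Nat.mod_eq_of_lt (ρ i).2, Nat.mod_eq_of_lt (ρ' i).2] at h3
      exact hi (Fin.ext h3.symm)
    · rfl

end Residue

theorem cycInt_finite (ζ : CompatibleRoots) (m : ℕ+) : Module.Finite ℤ (CycInt ζ m) := by
  have h : IsIntegral ℤ (ζ.root m) := (ζ.primitive m).isIntegral m.pos
  exact Module.Finite.of_fg h.fg_adjoin_singleton

theorem cycInt_free (ζ : CompatibleRoots) (m : ℕ+) : Module.Free ℤ (CycInt ζ m) := by
  have := cycInt_finite ζ m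
  infer_instance

section RootRing

variable {σ : Type*} {R : Type*} [CommRing R] [Algebra (MvPolynomial σ ℤ) R]
  (ζ : CompatibleRoots) (m : ℕ+)

/-- Exponents are divided by m with remainder: the quotient is absorbed in R through λ_i =
(λ_i^{1/m})^m, the remainder gives ρ, and constants are expanded in the basis b. Spanning suffices
here, since independence is later seen on power series. -/
theorem exists_eq_sum_residues [Fintype σ] [DecidableEq σ] {J : Type*} [Fintype J] (b :
    Module.Basis J ℤ (CycInt ζ m))
    (u : RootRing σ R ζ m) : ∃ r : (σ → Fin m) → J → R, u = ∑ ρ, ∑ j,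
      RootRing.ofBase σ R ζ m (r ρ j) * (RootRing.ofCyc σ R ζ m (b j) *
        ∏ i, RootRing.lam σ R ζ m i ^ (ρ i : ℕ)) := by
  have hadd {u v : RootRing σ R ζ m}
      (hu : ∃ r : (σ → Fin m) → J → R, u = ∑ ρ, ∑ j, RootRing.ofBase σ R ζ m (r ρ j) *
        (RootRing.ofCyc σ R ζ m (b j) * ∏ i, RootRing.lam σ R ζ m i ^ (ρ i : ℕ)))
      (hv : ∃ r : (σ → Fin m) → J → R, v = ∑ ρ, ∑ j, RootRing.ofBase σ R ζ m (r ρ j) *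
        (RootRing.ofCyc σ R ζ m (b j) * ∏ i, RootRing.lam σ R ζ m i ^ (ρ i : ℕ))) :
      ∃ r : (σ → Fin m) → J → R, u + v = ∑ ρ, ∑ j, RootRing.ofBase σ R ζ m (r ρ j) *
        (RootRing.ofCyc σ R ζ m (b j) * ∏ i, RootRing.lam σ R ζ m i ^ (ρ i : ℕ)) := by
    obtain ⟨r, rfl⟩ := hu
    obtain ⟨s, rfl⟩ := hv
    refine ⟨fun ρ j => r ρ j + s ρ j, ?_⟩
    simp only [map_add, add_mul, Finset.sum_add_distrib]
  induction u using TensorProduct.induction_on with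
  | zero => exact ⟨0, by simp⟩
  | add u v hu hv => exact hadd hu hv
  | tmul a p =>
    have e : a ⊗ₜ[MvPolynomial σ ℤ] p = RootRing.ofBase σ R ζ m a * RootRing.ofPoly σ R ζ m p := by
      simp [RootRing.ofBase, RootRing.ofPoly]
    rw [e]
    change ∃ r : (σ → Fin m) → J → R, RootRing.ofBase σ R ζ m a * RootRing.ofPoly σ R ζ m
      (show MvPolynomial σ (CycInt ζ m) from p) = _
    induction (show MvPolynomial σ (CycInt ζ m) from p) using MvPolynomial.induction_on' with
    | add p q hp hq =>
      have : RootRing.ofBase σ R ζ m a * RootRing.ofPoly σ R ζ m (p + q) =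
        RootRing.ofBase σ R ζ m a * RootRing.ofPoly σ R ζ m p +
          RootRing.ofBase σ R ζ m a * RootRing.ofPoly σ R ζ m q := by
        rw [← mul_add]
        congr 1
        exact map_add (RootRing.ofPoly σ R ζ m) _ _
      rw [this]
      exact hadd hp hq
    | monomial n c =>
      obtain ⟨n', ρ₀, hn⟩ := exists_eq_smul_add_resExp m.ne_zero n
      refine ⟨fun ρ j => if ρ = ρ₀ then a * ((b.repr c j : ℤ) : R) *
        ∏ i, algebraMap (MvPolynomial σ ℤ) R (MvPolynomial.X i) ^ n' i else 0, ?_⟩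
      rw [Finset.sum_eq_single ρ₀ (fun ρ _ hρ => by simp [hρ]) (by simp)]
      have h1 : RootRing.ofPoly σ R ζ m (MvPolynomial.monomial n c) =
          RootRing.ofCyc σ R ζ m c * ∏ i, RootRing.lam σ R ζ m i ^ n i := by
        have h2 : (MvPolynomial.monomial n c : MvPolynomial σ (CycInt ζ m)) =
            MvPolynomial.C c * ∏ i, MvPolynomial.X i ^ n i := by
          rw [MvPolynomial.monomial_eq, Finsupp.prod_fintype _ _ (by simp)]
        rw [h2]
        refine (map_mul (RootRing.ofPoly σ R ζ m) _ _).trans ?_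
        congr 1
        refine (map_prod (RootRing.ofPoly σ R ζ m) _ _).trans ?_
        exact Finset.prod_congr rfl fun i _ => map_pow (RootRing.ofPoly σ R ζ m) _ _
      have h3 : c = ∑ j, (b.repr c j : CycInt ζ m) * b j := by
        conv_lhs => rw [← b.sum_repr c]
        simp_rw [zsmul_eq_mul]
      have h4 : ∏ i, RootRing.lam σ R ζ m i ^ n i =
          (∏ i, RootRing.lam σ R ζ m i ^ (ρ₀ i : ℕ)) * RootRing.ofBase σ R ζ m
            (∏ i, algebraMap (MvPolynomial σ ℤ) R (MvPolynomial.X i) ^ n' i) := by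
        rw [map_prod, ← Finset.prod_mul_distrib]
        refine Finset.prod_congr rfl fun i _ => ?_
        rw [map_pow, RootRing.ofBase_X, ← pow_mul, ← pow_add, hn, Finsupp.add_apply,
          Finsupp.smul_apply, smul_eq_mul, resExp_apply, add_comm]
      rw [h1, h4]
      conv_lhs => rw [h3]
      simp only [if_true, map_sum, map_mul, map_intCast, Finset.sum_mul, Finset.mul_sum]
      refine Finset.sum_congr rfl fun j _ => ?_
      ring

theorem rootSeries_ofBase (ι : R →ₐ[MvPolynomial σ ℤ] MvPowerSeries σ ℤ) (r : R) :
    rootSeries ζ ι m (RootRing.ofBase σ R ζ m r) = MvPowerSeries.expand (m : ℕ) m.ne_zero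
      (MvPowerSeries.map (Int.castRingHom (CycInt ζ m)) (ι r)) := by
  have e : RootRing.ofBase σ R ζ m r = r ⊗ₜ[MvPolynomial σ ℤ] (1 : RootPoly σ ζ m) := rfl
  rw [e, rootSeries, tensorLift_tmul, map_one, mul_one]
  rfl

theorem rootSeries_ofCyc (ι : R →ₐ[MvPolynomial σ ℤ] MvPowerSeries σ ℤ) (c : CycInt ζ m) :
    rootSeries ζ ι m (RootRing.ofCyc σ R ζ m c) = MvPowerSeries.C c := by
  have e : RootRing.ofCyc σ R ζ m c = (1 : R) ⊗ₜ[MvPolynomial σ ℤ] RootPoly.C c := rfl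
  rw [e, rootSeries, tensorLift_tmul, map_one, one_mul, RootPoly.evalHom_C]

theorem rootSeries_lam (ι : R →ₐ[MvPolynomial σ ℤ] MvPowerSeries σ ℤ) (i : σ) :
    rootSeries ζ ι m (RootRing.lam σ R ζ m i) = MvPowerSeries.X i := by
  have e : RootRing.lam σ R ζ m i = (1 : R) ⊗ₜ[MvPolynomial σ ℤ] RootPoly.X i := rfl
  rw [e, rootSeries, tensorLift_tmul, map_one, one_mul, RootPoly.evalHom_X]

theorem prod_X_pow_eq_monomial [Fintype σ] {C : Type*} [CommRing C] (n : σ →₀ ℕ) :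
    ∏ i, (MvPowerSeries.X i : MvPowerSeries σ C) ^ n i = MvPowerSeries.monomial n 1 := by
  rw [MvPowerSeries.monomial_one_eq, Finsupp.prod_fintype _ _ (by simp)]

theorem rootSeries_residue [Fintype σ] (ι : R →ₐ[MvPolynomial σ ℤ] MvPowerSeries σ ℤ) (r : R) (c :
    CycInt ζ m)
    (ρ : σ → Fin m) :
    rootSeries ζ ι m (RootRing.ofBase σ R ζ m r * (RootRing.ofCyc σ R ζ m c *
      ∏ i, RootRing.lam σ R ζ m i ^ (ρ i : ℕ))) = MvPowerSeries.monomial (resExp ρ) c *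
        MvPowerSeries.expand (m : ℕ) m.ne_zero
          (MvPowerSeries.map (Int.castRingHom (CycInt ζ m)) (ι r)) := by
  rw [map_mul, map_mul, map_prod, rootSeries_ofBase, rootSeries_ofCyc, mul_comm]
  congr 1
  simp_rw [map_pow, rootSeries_lam]
  have := prod_X_pow_eq_monomial (C := CycInt ζ m) (resExp ρ)
  simp_rw [resExp_apply] at this
  rw [this, ← MvPowerSeries.monomial_zero_eq_C_apply, MvPowerSeries.monomial_mul_monomial,
    zero_add, mul_one]

/-- If divisibility by integers in `R` is detected by power series, then so it is in `R_m`. -/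
theorem dvd_of_dvd_coeff_rootSeries [Fintype σ] (ι : R →ₐ[MvPolynomial σ ℤ] MvPowerSeries σ ℤ)
    (hι : ∀ (M : ℤ) r, (∀ n, M ∣ MvPowerSeries.coeff n (ι r)) → (M : R) ∣ r) (M : ℤ)
    (u : RootRing σ R ζ m)
    (hu : ∀ n, (M : CycInt ζ m) ∣ MvPowerSeries.coeff n (rootSeries ζ ι m u)) :
    (M : RootRing σ R ζ m) ∣ u := by
  classical
  have := cycInt_finite ζ m
  have := cycInt_free ζ m
  let b := Module.Free.chooseBasis ℤ (CycInt ζ m)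
  obtain ⟨r, rfl⟩ := exists_eq_sum_residues ζ m b u
  refine Finset.dvd_sum fun ρ _ => Finset.dvd_sum fun j _ => Dvd.dvd.mul_right ?_ _
  rw [← map_intCast (RootRing.ofBase σ R ζ m)]
  refine map_dvd _ (hι M _ fun n => ?_)
  -- The coefficient at m n + ρ only sees the terms of residue ρ, and its j-th coordinate in the
  -- basis b is the n-th coefficient of the series of r ρ j.
  have h1 := hu ((m : ℕ) • n + resExp ρ)
  simp only [map_sum, rootSeries_residue, coeff_monomial_mul_expand, MvPowerSeries.coeff_map] at h1
  rw [Finset.sum_eq_single ρ (fun ρ' _ hρ' => by simp [hρ']) (by simp)] at h1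
  simp only [if_true] at h1
  obtain ⟨c, hc⟩ := h1
  have h2 := congrArg (fun x => b.repr x j) hc
  have h3 : ∀ j', b j' * (Int.castRingHom (CycInt ζ m)) (MvPowerSeries.coeff n (ι (r ρ j'))) =
      (MvPowerSeries.coeff n (ι (r ρ j')) : ℤ) • b j' := fun j' => by
    rw [zsmul_eq_mul, mul_comm]; rfl
  simp only [h3] at h2
  rw [← zsmul_eq_mul, map_zsmul, Module.Basis.repr_sum_self] at h2
  exact ⟨_, h2⟩

end RootRing

/-! ### Gaussian binomials near a root of unity -/

/-- Faulhaber's formula; the Bernoulli numbers are the reason for a ℚ-algebra. -/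
theorem exists_eval_eq_sum_range {D : Type*} [CommRing D] [Algebra ℚ D] (p : Polynomial D) :
    ∃ P : Polynomial D, ∀ n : ℕ, ∑ b ∈ Finset.range n, p.eval (b : D) = P.eval (n : D) := by
  induction p using Polynomial.induction_on' with
  | add p q hp hq =>
    obtain ⟨P, hP⟩ := hp
    obtain ⟨Q, hQ⟩ := hq
    exact ⟨P + Q, fun n => by simp [Finset.sum_add_distrib, hP, hQ]⟩
  | monomial k a =>
    refine ⟨Polynomial.C a * ∑ i ∈ Finset.range (k + 1), Polynomial.C (algebraMap ℚ D
      (bernoulli i * ((k + 1).choose i) / (k + 1))) * Polynomial.X ^ (k + 1 - i), fun n => ?_⟩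
    have h := congrArg (algebraMap ℚ D) (sum_range_pow n k)
    simp only [map_sum, map_pow, map_natCast] at h
    simp only [Polynomial.eval_monomial, ← Finset.mul_sum, h, Polynomial.eval_mul,
      Polynomial.eval_C, Polynomial.eval_finsetSum, Polynomial.eval_pow, Polynomial.eval_X]
    congr 1
    refine Finset.sum_congr rfl fun i _ => ?_
    rw [← map_natCast (algebraMap ℚ D) n, ← map_pow, ← map_mul, div_mul_eq_mul_div]

/-- Products `∏_{b < n} W(b)` of series with constant coefficient `1` whose coefficients are
polynomials in `b` have polynomials in `n` as coefficients. -/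
theorem exists_map_eval_eq_prod_range {D : Type*} [CommRing D] [Algebra ℚ D]
    (W : PowerSeries (Polynomial D)) (hW : PowerSeries.constantCoeff W = 1) :
    ∃ Ψ : PowerSeries (Polynomial D), ∀ n : ℕ,
      ∏ b ∈ Finset.range n, PowerSeries.map (Polynomial.evalRingHom (b : D)) W =
        PowerSeries.map (Polynomial.evalRingHom (n : D)) Ψ := by
  set G : ℕ → PowerSeries D := fun n =>
    ∏ b ∈ Finset.range n, PowerSeries.map (Polynomial.evalRingHom (b : D)) W with hG
  have key : ∀ k, ∃ P : Polynomial D, ∀ n : ℕ, PowerSeries.coeff k (G n) = P.eval (n : D) := by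
    intro k
    induction k using Nat.strong_induction_on with
    | _ k ih =>
      choose! P hP using ih
      -- Because W has constant term 1, the increment from n to n + 1 of the k-th coefficient
      -- involves only coefficients of index below k. These are polynomials in n by induction, and
      -- summing the increments gives a polynomial again.
      obtain ⟨Q, hQ⟩ := exists_eval_eq_sum_range (∑ x ∈ Finset.HasAntidiagonal.antidiagonal k,
        if x.1 < k then P x.1 * PowerSeries.coeff x.2 W else 0)
      refine ⟨Polynomial.C (PowerSeries.coeff k 1) + Q, fun n => ?_⟩
      rw [Polynomial.eval_add, Polynomial.eval_C, ← hQ]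
      induction n with
      | zero => simp [hG]
      | succ n ihn =>
        rw [Finset.sum_range_succ, ← add_assoc, ← ihn]
        have h1 : G (n + 1) = G n * PowerSeries.map (Polynomial.evalRingHom (n : D)) W := by
          simp [hG, Finset.prod_range_succ]
        rw [h1, PowerSeries.coeff_mul, Polynomial.eval_finsetSum]
        have hmem : ((k, 0) : ℕ × ℕ) ∈ Finset.HasAntidiagonal.antidiagonal k := by simp
        rw [← Finset.add_sum_erase _ _ hmem, ← Finset.add_sum_erase
            (Finset.HasAntidiagonal.antidiagonal k)
          (fun x => Polynomial.eval (n : D) (if x.1 < k then P x.1 * _ else 0)) hmem]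
        simp only [lt_self_iff_false, if_false, Polynomial.eval_zero, zero_add,
          PowerSeries.coeff_map, PowerSeries.coeff_zero_eq_constantCoeff_apply, hW, map_one,
          mul_one]
        congr 1
        refine Finset.sum_congr rfl fun x hx => ?_
        have h2 : x.1 < k := by
          obtain ⟨hx1, hx2⟩ := Finset.mem_erase.1 hx
          rw [Finset.HasAntidiagonal.mem_antidiagonal] at hx2
          refine lt_of_le_of_ne (by omega) fun h => hx1 (Prod.ext h ?_)
          change x.2 = 0
          omega
        rw [if_pos h2, hP _ h2, Polynomial.eval_mul]
        rfl
  choose P hP using key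
  refine ⟨PowerSeries.mk P, fun n => PowerSeries.ext fun k => ?_⟩
  rw [PowerSeries.coeff_map, PowerSeries.coeff_mk]
  exact hP k n

/-! ### Binomial series, which interpolate the powers of q = ζ + x. -/

section BinomialPower

variable {D E : Type*} [CommRing D] [BinomialRing D] [CommRing E] [BinomialRing E]

/-- The series `(1 + a x)^β`. -/
def binPow (a β : D) : PowerSeries D :=
  PowerSeries.rescale a (PowerSeries.binomialSeries D β)

theorem coeff_binPow (a β : D) (k : ℕ) :
    PowerSeries.coeff k (binPow a β) = a ^ k * Ring.choose β k := by
  rw [binPow, PowerSeries.coeff_rescale, PowerSeries.binomialSeries_coeff, smul_eq_mul, mul_one]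

theorem binPow_add (a β γ : D) : binPow a (β + γ) = binPow a β * binPow a γ := by
  rw [binPow, PowerSeries.binomialSeries_add, map_mul]
  rfl

@[simp] theorem constantCoeff_binPow (a β : D) :
    PowerSeries.constantCoeff (binPow a β) = 1 := by
  rw [← PowerSeries.coeff_zero_eq_constantCoeff_apply, coeff_binPow]
  simp

theorem map_binPow (f : D →+* E) (a β : D) :
    PowerSeries.map f (binPow a β) = binPow (f a) (f β) := by
  ext k
  rw [PowerSeries.coeff_map, coeff_binPow, coeff_binPow, map_mul, map_pow, Ring.map_choose]

theorem binPow_natCast (a : D) (n : ℕ) : binPow a (n : D) = (1 + PowerSeries.C a * PowerSeries.X) ^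
    n := by
  rw [binPow, PowerSeries.binomialSeries_nat, map_pow, map_add, map_one, PowerSeries.rescale_X]

theorem binPow_intCast (a : D) (v : (PowerSeries D)ˣ)
    (hv : (v : PowerSeries D) = 1 + PowerSeries.C a * PowerSeries.X) (n : ℤ) :
    binPow a (n : D) = ((v ^ n : (PowerSeries D)ˣ) : PowerSeries D) := by
  cases n with
  | ofNat n =>
    simp only [Int.ofNat_eq_natCast, Int.cast_natCast, zpow_natCast, Units.val_pow_eq_pow_val, hv]
    exact binPow_natCast a n
  | negSucc n =>
    rw [zpow_negSucc, ← one_mul ((((v ^ (n + 1))⁻¹ : (PowerSeries D)ˣ)) : PowerSeries D),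
      Units.eq_mul_inv_iff_mul_eq, Units.val_pow_eq_pow_val, hv, ← binPow_natCast, ← binPow_add]
    have : ((Int.negSucc n : ℤ) : D) + ((n + 1 : ℕ) : D) = 0 := by
      rw [Int.cast_negSucc, neg_add_cancel]
    rw [this, binPow, PowerSeries.binomialSeries_zero, map_one]

end BinomialPower

section DividedPower

variable {D E : Type*} [CommRing D] [Algebra ℚ D] [CommRing E] [Algebra ℚ E]

/-- The series `((1 + a x)^β - 1) / (β x)`. -/
def binQuot [BinomialRing D] (a β : D) : PowerSeries D :=
  PowerSeries.mk fun k => a ^ (k + 1) * (algebraMap ℚ D (1 / (k + 1)) * Ring.choose (β - 1) k)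

/-- Splits off the zero of (1 + a x)^β - 1 without dividing by β, using (k+1) binom(β, k+1) = β
binom(β-1, k). The cofactor has constant term a, so it remains invertible when β is an indeterminate
and a is a unit. -/
theorem binPow_sub_one [BinomialRing D] (a β : D) :
    binPow a β - 1 = PowerSeries.C β * PowerSeries.X * binQuot a β := by
  ext k
  cases k with
  | zero =>
    simp [mul_assoc]
  | succ k =>
    have h2 := Ring.choose_smul_choose β (Nat.le_add_left 1 k)
    simp only [Nat.choose_one_right, Ring.choose_one_right, Nat.add_sub_cancel, nsmul_eq_mul,
      Nat.cast_one] at h2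
    have h3 : algebraMap ℚ D (1 / (k + 1)) * ((k + 1 : ℕ) : D) = 1 := by
      rw [← map_natCast (algebraMap ℚ D), ← map_mul, ← map_one (algebraMap ℚ D)]
      congr 1
      push_cast
      exact one_div_mul_cancel (by positivity)
    rw [map_sub, coeff_binPow, PowerSeries.coeff_one, if_neg (Nat.succ_ne_zero k), sub_zero,
      mul_assoc, PowerSeries.coeff_C_mul, PowerSeries.coeff_succ_X_mul, binQuot,
      PowerSeries.coeff_mk]
    linear_combination (-a ^ (k + 1) * Ring.choose β (k + 1)) * h3 +
      (a ^ (k + 1) * algebraMap ℚ D (1 / (k + 1))) * h2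

theorem constantCoeff_binQuot [BinomialRing D] (a β : D) :
    PowerSeries.constantCoeff (binQuot a β) = a := by
  rw [← PowerSeries.coeff_zero_eq_constantCoeff_apply, binQuot, PowerSeries.coeff_mk]
  simp

end DividedPower

section GaussRoot

variable {K : Type*} [Field K]

/-- Pulling ζ^{c₀+1} out of every factor leaves 1 - ζ^d with d running over the nonzero residues,
and the extracted powers multiply to (ζ^{c₀+1})^{m+1} = 1. It normalises the constant term of a
block in `exists_gauss_interp`. -/
theorem prod_root_sub_root {ζ : K} {m : ℕ} (hζ : ζ ^ (m + 1) = 1) {c₀ : ℕ} (hc : c₀ < m + 1) :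
    ζ ^ (c₀ + 1) * ∏ c ∈ Finset.range (m + 1), (if c = c₀ then 1 else ζ ^ (c₀ + 1) - ζ ^ (c + 1)) =
      ∏ c ∈ Finset.range m, (1 - ζ ^ (c + 1)) := by
  obtain ⟨d, rfl⟩ : ∃ d, m = d + c₀ := ⟨m - c₀, by omega⟩
  rw [show d + c₀ + 1 = c₀ + 1 + d by ring] at hζ
  rw [show d + c₀ + 1 = c₀ + 1 + d by ring, Finset.prod_range_add, Finset.prod_range_succ,
    Finset.prod_range_add, if_pos rfl, mul_one]
  have h1 : ∏ c ∈ Finset.range c₀, (if c = c₀ then 1 else ζ ^ (c₀ + 1) - ζ ^ (c + 1)) =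
      (ζ ^ (c₀ + 1)) ^ c₀ * ∏ c ∈ Finset.range c₀, (1 - ζ ^ (d + c + 1)) := by
    rw [show (ζ ^ (c₀ + 1)) ^ c₀ = ∏ _c ∈ Finset.range c₀, ζ ^ (c₀ + 1) by simp,
      ← Finset.prod_mul_distrib]
    refine Finset.prod_congr rfl fun c hc => ?_
    rw [if_neg (Finset.mem_range.1 hc).ne]
    linear_combination (ζ ^ (c + 1)) * hζ
  have h2 : ∏ j ∈ Finset.range d, (if c₀ + 1 + j = c₀ then 1 else
      ζ ^ (c₀ + 1) - ζ ^ (c₀ + 1 + j + 1)) =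
      (ζ ^ (c₀ + 1)) ^ d * ∏ c ∈ Finset.range d, (1 - ζ ^ (c + 1)) := by
    rw [show (ζ ^ (c₀ + 1)) ^ d = ∏ _c ∈ Finset.range d, ζ ^ (c₀ + 1) by simp,
      ← Finset.prod_mul_distrib]
    refine Finset.prod_congr rfl fun c hc => ?_
    rw [if_neg (by omega)]
    ring
  have h3 : ζ ^ (c₀ + 1) * (ζ ^ (c₀ + 1)) ^ c₀ * (ζ ^ (c₀ + 1)) ^ d = 1 := by
    rw [← pow_succ', ← pow_add, pow_right_comm, hζ, one_pow]
  rw [h1, h2]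
  linear_combination (∏ c ∈ Finset.range c₀, (1 - ζ ^ (d + c + 1))) *
    (∏ c ∈ Finset.range d, (1 - ζ ^ (c + 1))) * h3

/-- `q = ζ + x`, a unit of `K⟦x⟧`. -/
def qLoc (ζ : Kˣ) : (PowerSeries K)ˣ :=
  IsUnit.unit (a := PowerSeries.C (ζ : K) + PowerSeries.X) (by
    rw [PowerSeries.isUnit_iff_constantCoeff]
    simp)

/-- The series `ζ^c (1 + x/ζ)^β` over a `K`-algebra, which interpolates the powers of
`q = ζ + x`. -/
def qInterp {D : Type*} [CommRing D] [Algebra K D] [BinomialRing D] (ζ : Kˣ) (c : ℤ) (β : D) :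
    PowerSeries D :=
  PowerSeries.C (algebraMap K D (ζ ^ c : Kˣ)) * binPow (algebraMap K D (ζ⁻¹ : Kˣ)) β

theorem map_qInterp {D E : Type*} [CommRing D] [Algebra K D] [BinomialRing D]
    [CommRing E] [Algebra K E] [BinomialRing E] (f : D →ₐ[K] E) (ζ : Kˣ) (c : ℤ) (β : D) :
    PowerSeries.map (f : D →+* E) (qInterp ζ c β) = qInterp ζ c (f β) := by
  rw [qInterp, qInterp, map_mul, map_binPow, PowerSeries.map_C]
  simp

/-- In q^n = ζ^n (1 + x/ζ)^n the first factor depends only on n modulo the order of ζ, and the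
second has coefficients polynomial in n. Fixing ζ^c thus interpolates q^n on a residue class. -/
theorem qInterp_intCast [CharZero K] (ζ : Kˣ) (c n : ℤ) (h : ζ ^ c = ζ ^ n) :
    qInterp ζ c (n : K) = ((qLoc ζ ^ n : (PowerSeries K)ˣ) : PowerSeries K) := by
  let u : (PowerSeries K)ˣ := Units.map PowerSeries.C.toMonoidHom ζ
  have hu : ((u⁻¹ * qLoc ζ : (PowerSeries K)ˣ) : PowerSeries K) =
      1 + PowerSeries.C ((ζ⁻¹ : Kˣ) : K) * PowerSeries.X := by
    rw [Units.val_mul]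
    change PowerSeries.C ((ζ⁻¹ : Kˣ) : K) * (PowerSeries.C (ζ : K) + PowerSeries.X) = _
    rw [mul_add, ← map_mul, Units.inv_mul, map_one]
  rw [qInterp, h]
  change PowerSeries.C ((ζ ^ n : Kˣ) : K) * binPow ((ζ⁻¹ : Kˣ) : K) (n : K) = _
  rw [binPow_intCast _ _ hu]
  change ((Units.map PowerSeries.C.toMonoidHom (ζ ^ n) : (PowerSeries K)ˣ) : PowerSeries K) * _ = _
  rw [map_zpow, ← Units.val_mul, ← mul_zpow, mul_inv_cancel_left]

theorem constantCoeff_qInterp {D : Type*} [CommRing D] [Algebra K D] [BinomialRing D] (ζ : Kˣ)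
    (c : ℤ) (β : D) :
    PowerSeries.constantCoeff (qInterp ζ c β) = algebraMap K D (ζ ^ c : Kˣ) := by
  simp [qInterp]

/-- Near `q = ζ` a primitive root of unity of order `m + 1`, the `q`-binomial
`∏_{j=1}^n (q^s - q^j) / (1 - q^j)` equals `[w^{n'}](1 - w)^{s'}` times a power series whose
coefficients are polynomials in `s', n'`, where `n = (m+1) n' + ρ` and `s = (m+1) s' + c₀ + 1`. -/
theorem exists_gauss_interp [CharZero K] {ζ : Kˣ} {m : ℕ} (hζ : IsPrimitiveRoot (ζ : K) (m + 1))
    {c₀ ρ : ℕ}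
    (hc : c₀ < m + 1) (hρ : ρ < m + 1) :
    ∃ Θ : PowerSeries (Polynomial (Polynomial K)), ∀ (s : ℤ) (n : ℕ),
      ∏ j ∈ Finset.range ((m + 1) * n + ρ),
        (((qLoc ζ ^ ((m + 1) * s + c₀ + 1) : (PowerSeries K)ˣ) : PowerSeries K) -
          (qLoc ζ : PowerSeries K) ^ (j + 1)) =
      PowerSeries.C (bin s n : K) * PowerSeries.map (Polynomial.evalEvalRingHom (s : K) (n : K)) Θ *
        ∏ j ∈ Finset.range ((m + 1) * n + ρ), (1 - (qLoc ζ : PowerSeries K) ^ (j + 1)) := by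
  -- D = K[S][B], where S stands for s and B for the index b of a block of m + 1 consecutive
  -- factors.
  let D := Polynomial (Polynomial K)
  let S : D := Polynomial.C Polynomial.X
  let B : D := Polynomial.X
  let M : D := (m : D) + 1
  let ev (s b : K) : D →ₐ[K] K :=
    { Polynomial.evalEvalRingHom s b with
      commutes' := fun r => by
        change Polynomial.evalEvalRingHom s b (Polynomial.C (Polynomial.C r)) = r
        simp }
  have hevS (s b : K) : ev s b S = s := by
    change Polynomial.evalEvalRingHom s b (Polynomial.C Polynomial.X) = s
    simp
  have hevB (s b : K) : ev s b B = b := by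
    change Polynomial.evalEvalRingHom s b Polynomial.X = b
    simp
  have hevN (s b : K) (k : ℕ) : ev s b (k : D) = k := map_natCast (ev s b) k
  have hev1 (s b : K) : ev s b 1 = 1 := map_one (ev s b)
  -- In block b the exponents are (m+1) b + c + 1 with 0 ≤ c ≤ m. At x = 0 the numerator vanishes
  -- only for c = c₀ and the denominator only for c = m.
  let num (c : ℕ) : PowerSeries D :=
    qInterp ζ (c₀ + 1) (M * S + c₀ + 1) - qInterp ζ (c + 1) (M * B + c + 1)
  let den (c : ℕ) : PowerSeries D := 1 - qInterp ζ (c + 1) (M * B + c + 1)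
  have hζz : ζ ^ ((m + 1 : ℕ) : ℤ) = 1 := by
    rw [zpow_natCast]
    exact Units.ext (by simpa using hζ.pow_eq_one)
  have hper (c n : ℤ) : ζ ^ c = ζ ^ ((m + 1) * n + c) := by
    rw [zpow_add, zpow_mul, show ((m : ℤ) + 1) = ((m + 1 : ℕ) : ℤ) by simp, hζz, one_zpow, one_mul]
  have hnum (s : ℤ) (b c : ℕ) : PowerSeries.map (ev s b : D →+* K) (num c) =
      ((qLoc ζ ^ ((m + 1) * s + c₀ + 1) : (PowerSeries K)ˣ) : PowerSeries K) -
          (qLoc ζ : PowerSeries K) ^ ((m + 1) * b + c + 1) := by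
    rw [map_sub, map_qInterp, map_qInterp, ← qInterp_intCast ζ (c₀ + 1), ← Units.val_pow_eq_pow_val,
      ← zpow_natCast, ← qInterp_intCast ζ (c + 1)]
    · simp only [map_add, map_mul, hevS, hevB, M, hevN, hev1]
      push_cast
      rfl
    · rw [hper _ b]; push_cast; ring_nf
    · rw [hper _ s]; ring_nf
  have hden (s : ℤ) (b c : ℕ) : PowerSeries.map (ev s b : D →+* K) (den c) =
      1 - (qLoc ζ : PowerSeries K) ^ ((m + 1) * b + c + 1) := by
    rw [map_sub, map_one, map_qInterp, ← Units.val_pow_eq_pow_val, ← zpow_natCast,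
      ← qInterp_intCast ζ (c + 1)]
    · simp only [map_add, map_mul, hevB, M, hevN, hev1]
      push_cast
      rfl
    · rw [hper _ b]; push_cast; ring_nf
  have hpow (c : ℕ) : ((ζ ^ ((c : ℤ) + 1) : Kˣ) : K) = (ζ : K) ^ (c + 1) := by
    rw [← Nat.cast_succ, zpow_natCast, Units.val_pow_eq_pow_val]
  have hden0 (c : ℕ) : PowerSeries.constantCoeff (den c) =
      algebraMap K D (1 - (ζ : K) ^ (c + 1)) := by
    rw [map_sub, map_one, constantCoeff_qInterp, hpow, map_sub, map_one]
  have hdenU (c : ℕ) (hc : c < m) : IsUnit (den c) := by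
    rw [PowerSeries.isUnit_iff_constantCoeff, hden0]
    refine IsUnit.map _ (IsUnit.mk0 _ ?_)
    rw [sub_ne_zero]
    exact (hζ.pow_ne_one_of_pos_of_lt (Nat.succ_ne_zero c) (by omega)).symm
  let a : D := algebraMap K D (ζ⁻¹ : Kˣ)
  have ha : IsUnit a := (ζ⁻¹).isUnit.map _
  let κ₁ := binQuot a (M * (S - B))
  let κ₂ := binQuot a (M * (B + 1))
  have hκ₂ : IsUnit κ₂ := by
    rw [PowerSeries.isUnit_iff_constantCoeff, constantCoeff_binQuot]
    exact ha
  let Q := qInterp ζ (c₀ + 1) (M * B + c₀ + 1)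
  let P := ∏ c ∈ Finset.range (m + 1), if c = c₀ then 1 else num c
  obtain ⟨V, hV⟩ : ∃ V, κ₂ * (∏ c ∈ Finset.range m, den c) * V = 1 :=
    (hκ₂.mul (Finset.prod_induction _ IsUnit (fun _ _ => IsUnit.mul) isUnit_one
      fun c hc => hdenU c (Finset.mem_range.1 hc))).exists_right_inv
  have hnumc : num c₀ = Q * (PowerSeries.C (M * (S - B)) * PowerSeries.X * κ₁) := by
    rw [← binPow_sub_one]
    simp only [num, Q, qInterp]
    rw [mul_sub, mul_assoc, ← binPow_add, mul_one, ← mul_sub, ← mul_sub]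
    congr 3
    ring
  have hdenm : den m = -(PowerSeries.C (M * (B + 1)) * PowerSeries.X * κ₂) := by
    rw [← binPow_sub_one]
    simp only [den, qInterp]
    rw [← Nat.cast_succ, hζz, Units.val_one, map_one, map_one, one_mul, neg_sub]
    congr 2
    simp only [M]
    ring
  -- After cancelling the two simple zeros in x, a block of the quotient is -(S - B)/(B + 1) · W.
  -- The scalars multiply over b < n to `bin s n`, and W has constant term 1 by
  -- `prod_root_sub_root`, so products of W are interpolated in n.
  let W := Q * κ₁ * P * V
  have hW : PowerSeries.constantCoeff W = 1 := by
    have h1 := congrArg PowerSeries.constantCoeff hV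
    have h2 := congrArg (algebraMap K D) (prod_root_sub_root hζ.pow_eq_one hc)
    rw [map_mul, map_mul, constantCoeff_binQuot, map_prod, map_one] at h1
    simp only [hden0] at h1
    rw [map_mul, map_prod, map_prod] at h2
    rw [map_mul, map_mul, map_mul, constantCoeff_binQuot, constantCoeff_qInterp, map_prod, hpow]
    have h3 : ∏ c ∈ Finset.range (m + 1), PowerSeries.constantCoeff (if c = c₀ then 1 else num c) =
        ∏ c ∈ Finset.range (m + 1),
          algebraMap K D (if c = c₀ then 1 else (ζ : K) ^ (c₀ + 1) - (ζ : K) ^ (c + 1)) := by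
      refine Finset.prod_congr rfl fun c _ => ?_
      split_ifs
      · simp
      · rw [map_sub, constantCoeff_qInterp, constantCoeff_qInterp, hpow, hpow, map_sub]
    rw [h3]
    linear_combination h1 + a * PowerSeries.constantCoeff V * h2
  have hblock : PowerSeries.C (M * (B + 1)) * ∏ c ∈ Finset.range (m + 1), num c =
      -PowerSeries.C (M * (S - B)) * W * ∏ c ∈ Finset.range (m + 1), den c := by
    have h1 : ∏ c ∈ Finset.range (m + 1), num c = num c₀ * P := by
      rw [← Finset.mul_prod_erase _ num (Finset.mem_range.2 hc)]
      simp only [P]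
      rw [← Finset.mul_prod_erase _ (fun c => if c = c₀ then 1 else num c) (Finset.mem_range.2 hc),
        if_pos rfl, one_mul]
      congr 1
      exact Finset.prod_congr rfl fun c hc => (if_neg (Finset.ne_of_mem_erase hc)).symm
    rw [h1, Finset.prod_range_succ, hnumc, hdenm]
    linear_combination (-PowerSeries.C (M * (B + 1)) * Q * PowerSeries.C (M * (S - B)) *
      PowerSeries.X * κ₁ * P) * hV
  obtain ⟨Ψ, hΨ⟩ := exists_map_eval_eq_prod_range W hW
  -- The incomplete last block only has indices c < ρ ≤ m, so it avoids the vanishing denominator.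
  obtain ⟨V', hV'⟩ : ∃ V', (∏ c ∈ Finset.range ρ, den c) * V' = 1 :=
    (Finset.prod_induction _ IsUnit (fun _ _ => IsUnit.mul) isUnit_one
      fun c hc => hdenU c (by have := Finset.mem_range.1 hc; omega)).exists_right_inv
  refine ⟨Ψ * (∏ c ∈ Finset.range ρ, num c) * V', fun s n => ?_⟩
  have hprod (b : ℕ) : PowerSeries.C (((m + 1) * (b + 1) : ℕ) : K) *
      ∏ c ∈ Finset.range (m + 1),
        (((qLoc ζ ^ ((m + 1) * s + c₀ + 1) : (PowerSeries K)ˣ) : PowerSeries K) -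
          (qLoc ζ : PowerSeries K) ^ ((m + 1) * b + c + 1)) =
      -PowerSeries.C (((m + 1 : ℕ) : K) * ((s : K) - b)) * PowerSeries.map (ev s b : D →+* K) W *
        ∏ c ∈ Finset.range (m + 1), (1 - (qLoc ζ : PowerSeries K) ^ ((m + 1) * b + c + 1)) := by
    have := congrArg (PowerSeries.map (ev s b : D →+* K)) hblock
    simp only [map_mul, map_neg, map_prod, hnum, hden, PowerSeries.map_C] at this
    simp only [M, RingHom.coe_coe, map_add, map_sub, hev1, hevN, hevS, hevB] at this
    simp only [map_mul, Nat.cast_mul, map_natCast, map_sub, map_add, Nat.cast_add, Nat.cast_one,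
      map_one] at this ⊢
    exact this
  have hbin (n : ℕ) : (bin s (n + 1) : K) * (n + 1) = -(bin s n * (s - n)) := by
    have h := Ring.choose_smul_choose s (Nat.le_succ n)
    rw [Nat.succ_sub (le_refl n), Nat.sub_self, Ring.choose_one_right, Nat.choose_succ_self_right,
      nsmul_eq_mul] at h
    have h' : bin s (n + 1) * (n + 1) = -(bin s n * (s - n)) := by
      rw [bin, bin, pow_succ]
      push_cast at h
      linear_combination (-(-1) ^ n) * h
    exact_mod_cast congrArg (Int.cast : ℤ → K) h'
  have hmain (n : ℕ) : ∏ j ∈ Finset.range ((m + 1) * n),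
        (((qLoc ζ ^ ((m + 1) * s + c₀ + 1) : (PowerSeries K)ˣ) : PowerSeries K) -
          (qLoc ζ : PowerSeries K) ^ (j + 1)) =
      PowerSeries.C (bin s n : K) *
        (∏ b ∈ Finset.range n, PowerSeries.map (ev s b : D →+* K) W) *
          ∏ j ∈ Finset.range ((m + 1) * n), (1 - (qLoc ζ : PowerSeries K) ^ (j + 1)) := by
    induction n with
    | zero => simp
    | succ n ih =>
      have hne : PowerSeries.C (((m + 1) * (n + 1) : ℕ) : K) ≠ 0 := by
        rw [Ne, map_eq_zero_iff _ PowerSeries.C_injective]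
        exact Nat.cast_ne_zero.2 (by positivity)
      have h1 := congrArg PowerSeries.C (hbin n)
      simp only [map_mul, map_neg, map_sub, map_add, map_natCast, map_one, map_intCast] at h1
      refine mul_left_cancel₀ hne ?_
      have h2 := hprod n
      rw [show Finset.range ((m + 1) * (n + 1)) = Finset.range ((m + 1) * n + (m + 1)) from rfl,
        Finset.prod_range_add _ ((m + 1) * n) (m + 1), Finset.prod_range_add _ ((m + 1) * n) (m +
            1),
        ih, Finset.prod_range_succ _ n, mul_left_comm, h2]
      simp only [map_mul, map_natCast, map_sub, map_intCast, Nat.cast_mul, Nat.cast_add,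
        Nat.cast_one, map_add, map_one]
      linear_combination (-(m + 1 : PowerSeries K) * (∏ b ∈ Finset.range n, PowerSeries.map (ev s b
          : D →+* K) W) *
        PowerSeries.map (ev s n : D →+* K) W *
        (∏ j ∈ Finset.range ((m + 1) * n), (1 - (qLoc ζ : PowerSeries K) ^ (j + 1))) *
        (∏ c ∈ Finset.range (m + 1), (1 - (qLoc ζ : PowerSeries K) ^ ((m + 1) * n + c + 1)))) * h1
  have hev (b : ℕ) (x : PowerSeries D) : PowerSeries.map (ev s b : D →+* K) x =
      PowerSeries.map (Polynomial.evalRingHom (s : K))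
        (PowerSeries.map (Polynomial.evalRingHom (b : Polynomial K)) x) := by
    ext k
    rw [PowerSeries.coeff_map, PowerSeries.coeff_map, PowerSeries.coeff_map,
      ← Polynomial.C_eq_natCast]
    rfl
  have hW' : ∏ b ∈ Finset.range n, PowerSeries.map (ev s b : D →+* K) W =
      PowerSeries.map (ev s n : D →+* K) Ψ := by
    rw [hev, ← hΨ, map_prod]
    exact Finset.prod_congr rfl fun b _ => hev b W
  have htail := congrArg (PowerSeries.map (ev s n : D →+* K)) hV'
  simp only [map_mul, map_prod, hden, map_one] at htail
  change _ = _ * PowerSeries.map (ev s n : D →+* K) _ * _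
  rw [Finset.prod_range_add, Finset.prod_range_add, hmain, hW']
  simp only [map_mul, map_prod, hnum]
  linear_combination (-PowerSeries.C (bin s n : K) * PowerSeries.map (ev s n : D →+* K) Ψ *
    (∏ j ∈ Finset.range ((m + 1) * n), (1 - (qLoc ζ : PowerSeries K) ^ (j + 1))) *
    (∏ c ∈ Finset.range ρ, (((qLoc ζ ^ ((m + 1) * s + c₀ + 1) : (PowerSeries K)ˣ) : PowerSeries K) -
          (qLoc ζ : PowerSeries K) ^ ((m + 1) * n + c + 1)))) * htail

end GaussRoot

/-! ### The symmetrised Nahm sum -/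

/-- Integrality of the q-binomial for arbitrary integer s. The q-Pascal rule expresses s + 1 through
s and a smaller n, and it can be run in both directions because q is a unit. -/
theorem exists_gauss {B : Type*} [CommRing B] (q : Bˣ) (n : ℕ) (s : ℤ) :
    ∃ b : B, (∏ j ∈ Finset.range n, (1 - (q : B) ^ (j + 1))) * b =
      ∏ j ∈ Finset.range n, (((q ^ s : Bˣ) : B) - (q : B) ^ (j + 1)) := by
  induction n generalizing s with
  | zero => exact ⟨1, by simp⟩
  | succ n ih =>
    have pascal (s : ℤ) : ∏ j ∈ Finset.range (n + 1), (((q ^ (s + 1) : Bˣ) : B) - (q : B) ^ (j +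
        1)) =
        (q : B) ^ (n + 1) * (∏ j ∈ Finset.range (n + 1), (((q ^ s : Bˣ) : B) - (q : B) ^ (j + 1)) -
          (1 - (q : B) ^ (n + 1)) * ∏ j ∈ Finset.range n, (((q ^ s : Bˣ) : B) - (q : B) ^ (j + 1)))
              := by
      have h1 : ∏ j ∈ Finset.range (n + 1), (((q ^ (s + 1) : Bˣ) : B) - (q : B) ^ (j + 1)) =
          (q : B) ^ (n + 1) * ∏ j ∈ Finset.range (n + 1), (((q ^ s : Bˣ) : B) - (q : B) ^ j) := by
        rw [show (q : B) ^ (n + 1) = ∏ _j ∈ Finset.range (n + 1), (q : B) by simp,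
          ← Finset.prod_mul_distrib]
        refine Finset.prod_congr rfl fun j _ => ?_
        rw [zpow_add, zpow_one, Units.val_mul]
        ring
      rw [h1, Finset.prod_range_succ', Finset.prod_range_succ _ n]
      ring
    -- The induction starts at s = 1, where the factor j = 0 of the numerator is q - q = 0.
    induction s using Int.inductionOn' (b := 1) with
    | zero => exact ⟨0, by rw [mul_zero, Finset.prod_range_succ']; simp⟩
    | succ s _ hs =>
      obtain ⟨b, hb⟩ := hs
      obtain ⟨b', hb'⟩ := ih s
      refine ⟨(q : B) ^ (n + 1) * (b - b'), ?_⟩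
      rw [pascal, ← hb, ← hb', Finset.prod_range_succ _ n]
      ring
    | pred s _ hs =>
      obtain ⟨b, hb⟩ := hs
      obtain ⟨b', hb'⟩ := ih (s - 1)
      have h := pascal (s - 1)
      rw [sub_add_cancel, ← hb, ← hb'] at h
      refine ⟨((q⁻¹ : Bˣ) : B) ^ (n + 1) * b + b', ?_⟩
      have h2 : ((q⁻¹ : Bˣ) : B) ^ (n + 1) * (q : B) ^ (n + 1) = 1 := by
        rw [← mul_pow, Units.inv_mul, one_pow]
      have h3 := Finset.prod_range_succ (fun j => 1 - (q : B) ^ (j + 1)) n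
      rw [mul_add, mul_left_comm, h]
      linear_combination (∏ j ∈ Finset.range (n + 1), (((q ^ (s - 1) : Bˣ) : B) - (q : B) ^ (j +
          1)) -
          (1 - (q : B) ^ (n + 1)) * ((∏ j ∈ Finset.range n, (1 - (q : B) ^ (j + 1))) * b')) * h2 +
            b' * h3

/-- The unit `q` of `ℤ[q^{±1}]`. -/
def qLaurent : (LaurentPolynomial ℤ)ˣ where
  val := LaurentPolynomial.T 1
  inv := LaurentPolynomial.T (-1)
  val_inv := by rw [← LaurentPolynomial.T_add]; simp
  inv_val := by rw [← LaurentPolynomial.T_add]; simp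

/-- The Laurent polynomial `∏_{j=1}^n (q^s - q^j) / (1 - q^j)`. -/
def gauss (n : ℕ) (s : ℤ) : LaurentPolynomial ℤ := (exists_gauss qLaurent n s).choose

theorem prod_mul_map_gauss {B : Type*} [CommRing B] (φ : LaurentPolynomial ℤ →+* B) (q : Bˣ)
    (hq : Units.map φ.toMonoidHom qLaurent = q) (n : ℕ) (s : ℤ) :
    (∏ j ∈ Finset.range n, (1 - (q : B) ^ (j + 1))) * φ (gauss n s) =
      ∏ j ∈ Finset.range n, (((q ^ s : Bˣ) : B) - (q : B) ^ (j + 1)) := by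
  have h1 : (∏ j ∈ Finset.range n, (1 - (qLaurent : LaurentPolynomial ℤ) ^ (j + 1))) * gauss n s =
      ∏ j ∈ Finset.range n, (((qLaurent ^ s : (LaurentPolynomial ℤ)ˣ) : LaurentPolynomial ℤ) -
        (qLaurent : LaurentPolynomial ℤ) ^ (j + 1)) := (exists_gauss qLaurent n s).choose_spec
  have h := congrArg φ h1
  have hq1 : φ (qLaurent : LaurentPolynomial ℤ) = q := congrArg Units.val hq
  have hq2 : φ ((qLaurent ^ s : (LaurentPolynomial ℤ)ˣ) : LaurentPolynomial ℤ) = (q ^ s : Bˣ) := by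
    rw [← hq, ← map_zpow]
    rfl
  simpa only [map_mul, map_prod, map_sub, map_one, map_pow, hq1, hq2] using h

/-- A form of the q-binomial theorem. For k + l = n + 1, 1 - q^{n+1} = (1 - q^k) - q^{n+1}(1 -
q^{-l}), and each difference cancels a factor of a denominator. Hence (1 - q^{n+1}) S_{n+1} = (y -
q^{n+1}) S_n. -/
theorem sum_antidiagonal_gauss {K : Type*} [Field K] {q : K} (hq0 : q ≠ 0)
    (hq : ∀ k : ℕ, 1 - q ^ (k + 1) ≠ 0) (y : K) (n : ℕ) :
    ∑ x ∈ Finset.HasAntidiagonal.antidiagonal n, y ^ x.1 / ((∏ j ∈ Finset.range x.1, (1 - q ^ (j +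
        1))) *
      ∏ j ∈ Finset.range x.2, (1 - q⁻¹ ^ (j + 1))) =
        (∏ j ∈ Finset.range n, (y - q ^ (j + 1))) / ∏ j ∈ Finset.range n, (1 - q ^ (j + 1)) := by
  have hq' (k : ℕ) : 1 - q⁻¹ ^ (k + 1) ≠ 0 := by
    have h := hq k
    rw [sub_ne_zero] at h ⊢
    rw [inv_pow]
    exact fun h' => h (inv_eq_one.1 h'.symm).symm
  induction n with
  | zero => simp
  | succ n ih =>
    have h1 : (1 - q ^ (n + 1)) * ∑ x ∈ Finset.HasAntidiagonal.antidiagonal (n + 1),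
        y ^ x.1 / ((∏ j ∈ Finset.range x.1, (1 - q ^ (j + 1))) *
          ∏ j ∈ Finset.range x.2, (1 - q⁻¹ ^ (j + 1))) =
        (∑ x ∈ Finset.HasAntidiagonal.antidiagonal (n + 1), (1 - q ^ x.1) *
          (y ^ x.1 / ((∏ j ∈ Finset.range x.1, (1 - q ^ (j + 1))) *
          ∏ j ∈ Finset.range x.2, (1 - q⁻¹ ^ (j + 1))))) -
        ∑ x ∈ Finset.HasAntidiagonal.antidiagonal (n + 1), q ^ (n + 1) * (1 - q⁻¹ ^ x.2) *
          (y ^ x.1 / ((∏ j ∈ Finset.range x.1, (1 - q ^ (j + 1))) *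
          ∏ j ∈ Finset.range x.2, (1 - q⁻¹ ^ (j + 1)))) := by
      rw [Finset.mul_sum, ← Finset.sum_sub_distrib]
      refine Finset.sum_congr rfl fun x hx => ?_
      rw [Finset.HasAntidiagonal.mem_antidiagonal] at hx
      rw [← hx, ← sub_mul]
      congr 1
      rw [pow_add, inv_pow]
      field_simp
      ring
    have h2 : ∑ x ∈ Finset.HasAntidiagonal.antidiagonal (n + 1), (1 - q ^ x.1) *
          (y ^ x.1 / ((∏ j ∈ Finset.range x.1, (1 - q ^ (j + 1))) *
          ∏ j ∈ Finset.range x.2, (1 - q⁻¹ ^ (j + 1)))) =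
        y * ∑ x ∈ Finset.HasAntidiagonal.antidiagonal n,
          y ^ x.1 / ((∏ j ∈ Finset.range x.1, (1 - q ^ (j + 1))) *
          ∏ j ∈ Finset.range x.2, (1 - q⁻¹ ^ (j + 1))) := by
      rw [Finset.Nat.sum_antidiagonal_succ, pow_zero, sub_self, zero_mul, zero_add, Finset.mul_sum]
      refine Finset.sum_congr rfl fun x _ => ?_
      rw [Finset.prod_range_succ _ x.1, pow_succ y, mul_comm _ (1 - q ^ (x.1 + 1)), mul_assoc,
        ← mul_div_assoc, mul_div_mul_left _ _ (hq _), mul_comm (y ^ x.1), mul_div_assoc]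
    have h3 : ∑ x ∈ Finset.HasAntidiagonal.antidiagonal (n + 1), q ^ (n + 1) * (1 - q⁻¹ ^ x.2) *
          (y ^ x.1 / ((∏ j ∈ Finset.range x.1, (1 - q ^ (j + 1))) *
          ∏ j ∈ Finset.range x.2, (1 - q⁻¹ ^ (j + 1)))) =
        q ^ (n + 1) * ∑ x ∈ Finset.HasAntidiagonal.antidiagonal n,
          y ^ x.1 / ((∏ j ∈ Finset.range x.1, (1 - q ^ (j + 1))) *
          ∏ j ∈ Finset.range x.2, (1 - q⁻¹ ^ (j + 1))) := by
      rw [Finset.Nat.sum_antidiagonal_succ', pow_zero, sub_self, mul_zero, zero_mul, zero_add,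
        Finset.mul_sum]
      refine Finset.sum_congr rfl fun x _ => ?_
      rw [Finset.prod_range_succ _ x.2, ← mul_assoc, mul_comm _ (1 - q⁻¹ ^ (x.2 + 1)), mul_assoc,
        ← mul_div_assoc, ← mul_div_assoc, mul_comm _ (1 - q⁻¹ ^ (x.2 + 1)), mul_div_mul_left _ _
            (hq' _),
        mul_div_assoc]
    rw [h2, h3, ← sub_mul, ih] at h1
    rw [Finset.prod_range_succ _ n, Finset.prod_range_succ _ n]
    refine mul_left_cancel₀ (hq n) (h1.trans ?_)
    have := hq n
    have h4 : ∏ j ∈ Finset.range n, (1 - q ^ (j + 1)) ≠ 0 := Finset.prod_ne_zero_iff.2 fun j _ =>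
        hq j
    field_simp

theorem sum_antidiagonal_prod {ι K : Type*} [Fintype ι] [DecidableEq ι] [CommRing K] (n : ι →₀ ℕ)
    (g : ι → ℕ → ℕ → K) : ∑ x ∈ Finset.HasAntidiagonal.antidiagonal n, ∏ i, g i (x.1 i) (x.2 i) =
      ∏ i, ∑ x ∈ Finset.HasAntidiagonal.antidiagonal (n i), g i x.1 x.2 := by
  rw [Finset.prod_univ_sum]
  refine Finset.sum_bij' (fun x _ i => (x.1 i, x.2 i))
    (fun p _ => (Finsupp.equivFunOnFinite.symm fun i => (p i).1,
      Finsupp.equivFunOnFinite.symm fun i => (p i).2)) ?_ ?_ ?_ ?_ ?_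
  · intro x hx
    rw [Finset.HasAntidiagonal.mem_antidiagonal] at hx
    rw [Fintype.mem_piFinset]
    intro i
    rw [Finset.HasAntidiagonal.mem_antidiagonal, ← hx, Finsupp.add_apply]
  · intro p hp
    rw [Fintype.mem_piFinset] at hp
    rw [Finset.HasAntidiagonal.mem_antidiagonal]
    ext i
    exact Finset.HasAntidiagonal.mem_antidiagonal.1 (hp i)
  · intro x _
    exact Prod.ext (Finsupp.ext fun _ => rfl) (Finsupp.ext fun _ => rfl)
  · intro p _
    rfl
  · intro x _
    rfl

section Lagrange

variable {N : ℕ} (A : Matrix (Fin N) (Fin N) ℤ)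

/-- The exponent `(nᵗ A n + diag(A) · n) / 2`. -/
def nahmExp (n : Fin N →₀ ℕ) : ℤ :=
  (∑ i, ∑ j, (n i : ℤ) * A i j * (n j : ℤ) + ∑ i, A i i * (n i : ℤ)) / 2

theorem sum_eq_lin (n : Fin N →₀ ℕ) :
    ∑ i, ∑ j, (n i : ℤ) * A i j * (n j : ℤ) + ∑ i, A i i * (n i : ℤ) =
      ∑ i, (n i : ℤ) * (lin A n i + A i i) := by
  rw [← Finset.sum_add_distrib]
  refine Finset.sum_congr rfl fun i _ => ?_
  rw [lin, mul_add, Finset.mul_sum, mul_comm (A i i)]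
  simp only [mul_assoc]

theorem sum_mul_lin_comm (hA : A.IsSymm) (k l : Fin N →₀ ℕ) :
    ∑ i, (k i : ℤ) * lin A l i = ∑ i, (l i : ℤ) * lin A k i := by
  simp only [lin, Finset.mul_sum]
  rw [Finset.sum_comm]
  refine Finset.sum_congr rfl fun i _ => Finset.sum_congr rfl fun j _ => ?_
  rw [hA.apply]
  ring

/-- The halving is exact: by symmetry the cross terms of the quadratic form occur twice, and on k
e_i the sum is A_ii k (k + 1). -/
theorem two_mul_nahmExp (hA : A.IsSymm) (n : Fin N →₀ ℕ) :
    2 * nahmExp A n = ∑ i, (n i : ℤ) * (lin A n i + A i i) := by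
  rw [nahmExp, sum_eq_lin]
  refine Int.mul_ediv_cancel' ?_
  induction n using Finsupp.induction_linear with
  | zero => simp
  | add k l hk hl =>
    have h : ∑ i, (((k + l) i : ℕ) : ℤ) * (lin A (k + l) i + A i i) =
        ∑ i, (k i : ℤ) * (lin A k i + A i i) + ∑ i, (l i : ℤ) * (lin A l i + A i i) +
          2 * ∑ i, (k i : ℤ) * lin A l i := by
      rw [two_mul]
      nth_rw 2 [sum_mul_lin_comm A hA]
      simp only [← Finset.sum_add_distrib]
      refine Finset.sum_congr rfl fun i _ => ?_
      rw [lin_add, Finsupp.add_apply, Nat.cast_add]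
      ring
    rw [h]
    exact dvd_add (dvd_add hk hl) (dvd_mul_right _ _)
  | single i k =>
    rw [Finset.sum_eq_single i]
    · have h : lin A (Finsupp.single i k) i = A i i * k := by
        rw [lin, Finset.sum_eq_single i]
        · simp
        · intro j _ hj; simp [Finsupp.single_eq_of_ne hj]
        · simp
      rw [h, Finsupp.single_eq_same, ← mul_add_one, mul_left_comm]
      exact Dvd.dvd.mul_left (Int.even_mul_succ_self k).two_dvd _
    · intro j _ hj; simp [Finsupp.single_eq_of_ne hj]
    · simp

/-- For fixed k + l the right-hand side is affine in k. This is where the symmetrisation becomes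
tractable, since it decouples the coordinates. -/
theorem nahmExp_sub (hA : A.IsSymm) (k l : Fin N →₀ ℕ) :
    nahmExp A k - nahmExp A l =
      ∑ i, (k i : ℤ) * (lin A (k + l) i + A i i) - nahmExp A (k + l) := by
  refine mul_left_cancel₀ (two_ne_zero (α := ℤ)) ?_
  rw [mul_sub, mul_sub, two_mul_nahmExp A hA, two_mul_nahmExp A hA, two_mul_nahmExp A hA, two_mul]
  have h := sum_mul_lin_comm A hA k l
  simp only [lin_add, Finsupp.add_apply, Nat.cast_add, mul_add, add_mul, Finset.sum_add_distrib]
  linear_combination -h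

/-- The symmetrised Nahm sum, as a series over `ℤ[q^{±1}]`. -/
def nahmLaurent : MvPowerSeries (Fin N) (LaurentPolynomial ℤ) := fun n =>
  ((∏ i, sgn A i ^ n i : ℤ) : LaurentPolynomial ℤ) *
    ((qLaurent ^ (-nahmExp A n) : (LaurentPolynomial ℤ)ˣ) : LaurentPolynomial ℤ) *
      ∏ i, gauss (n i) (lin A n i + A i i)

theorem coeff_nahmLaurent (n : Fin N →₀ ℕ) : MvPowerSeries.coeff n (nahmLaurent A) =
  ((∏ i, sgn A i ^ n i : ℤ) : LaurentPolynomial ℤ) *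
    ((qLaurent ^ (-nahmExp A n) : (LaurentPolynomial ℤ)ˣ) : LaurentPolynomial ℤ) *
      ∏ i, gauss (n i) (lin A n i + A i i) := rfl

theorem zpow_sum_eq_prod {ι K : Type*} [Field K] {q : K} (hq : q ≠ 0) (s : Finset ι) (f : ι → ℤ) :
    q ^ (∑ i ∈ s, f i) = ∏ i ∈ s, q ^ f i := by
  classical
  induction s using Finset.induction_on with
  | empty => simp
  | insert i s hi ih => rw [Finset.sum_insert hi, Finset.prod_insert hi, zpow_add₀ hq, ih]

theorem intCast_sgn {K : Type*} [Field K] (i : Fin N) : (sgn A i : K) = (-1) ^ A i i := by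
  rw [sgn]
  rcases Int.even_or_odd (A i i) with h | h
  · rw [h.neg_one_zpow, h.neg_one_zpow]
    simp
  · rw [h.neg_one_zpow, h.neg_one_zpow]
    simp

theorem neg_one_zpow_eq_prod {K : Type*} [Field K] (n : Fin N →₀ ℕ) :
    (-1 : K) ^ (∑ i, A i i * (n i : ℤ)) = ((∏ i, sgn A i ^ n i : ℤ) : K) := by
  rw [zpow_sum_eq_prod (neg_ne_zero.2 one_ne_zero), Int.cast_prod]
  refine Finset.prod_congr rfl fun i _ => ?_
  rw [Int.cast_pow, intCast_sgn, zpow_mul, zpow_natCast]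

theorem nahmSum_coeff {K : Type*} [Field K] (q : K) (n : Fin N →₀ ℕ) :
    MvPowerSeries.coeff n (nahmSum A q) = (-1) ^ (∑ i, A i i * (n i : ℤ)) * q ^ nahmExp A n /
      ∏ i, ∏ k ∈ Finset.range (n i), (1 - q ^ (k + 1)) := rfl

/-- By `nahmExp_sub` the sum over k + l = n is a product over i of sums as in
`sum_antidiagonal_gauss`, with y = q^{(A n)_i + A_ii}. -/
theorem coeff_nahmSum_mul (hA : A.IsSymm) {K : Type*} [Field K] {q : K} (hq0 : q ≠ 0)
    (hq : ∀ k : ℕ, 1 - q ^ (k + 1) ≠ 0) (n : Fin N →₀ ℕ) :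
    MvPowerSeries.coeff n (nahmSum A q * nahmSum A q⁻¹) =
      ((∏ i, sgn A i ^ n i : ℤ) : K) * q ^ (-nahmExp A n) *
        ∏ i, ((∏ j ∈ Finset.range (n i), (q ^ (lin A n i + A i i) - q ^ (j + 1))) /
          ∏ j ∈ Finset.range (n i), (1 - q ^ (j + 1))) := by
  simp_rw [← sum_antidiagonal_gauss hq0 hq]
  rw [← sum_antidiagonal_prod n fun i k l => (q ^ (lin A n i + A i i)) ^ k /
    ((∏ j ∈ Finset.range k, (1 - q ^ (j + 1))) * ∏ j ∈ Finset.range l, (1 - q⁻¹ ^ (j + 1))),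
    MvPowerSeries.coeff_mul, Finset.mul_sum]
  refine Finset.sum_congr rfl fun x hx => ?_
  rw [Finset.HasAntidiagonal.mem_antidiagonal] at hx
  rw [nahmSum_coeff, nahmSum_coeff, inv_zpow', div_mul_div_comm, Finset.prod_div_distrib,
    Finset.prod_mul_distrib, ← mul_div_assoc]
  congr 1
  have h1 : (-1 : K) ^ (∑ i, A i i * (x.1 i : ℤ)) * (-1) ^ (∑ i, A i i * (x.2 i : ℤ)) =
      ((∏ i, sgn A i ^ n i : ℤ) : K) := by
    rw [← zpow_add₀ (neg_ne_zero.2 one_ne_zero), ← Finset.sum_add_distrib, ← neg_one_zpow_eq_prod]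
    congr 1
    refine Finset.sum_congr rfl fun i _ => ?_
    rw [← hx, Finsupp.add_apply, Nat.cast_add, mul_add]
  have h2 : ∏ i, (q ^ (lin A n i + A i i)) ^ x.1 i =
      q ^ (∑ i, (x.1 i : ℤ) * (lin A n i + A i i)) := by
    rw [zpow_sum_eq_prod hq0]
    refine Finset.prod_congr rfl fun i _ => ?_
    rw [mul_comm, zpow_mul, zpow_natCast]
  have h3 : q ^ nahmExp A x.1 * q ^ (-nahmExp A x.2) =
      q ^ (-nahmExp A n) * q ^ (∑ i, (x.1 i : ℤ) * (lin A n i + A i i)) := by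
    rw [← zpow_add₀ hq0, ← zpow_add₀ hq0, ← sub_eq_add_neg, nahmExp_sub A hA, hx]
    congr 1
    ring
  rw [h2, ← h1]
  linear_combination ((-1 : K) ^ (∑ i, A i i * (x.1 i : ℤ)) * (-1) ^ (∑ i, A i i * (x.2 i : ℤ))) *
      h3

theorem map_nahmLaurent (hA : A.IsSymm) :
    MvPowerSeries.map laurentToRatFunc (nahmLaurent A) = nahmSym A := by
  have hX : ∀ k : ℕ, 1 - (RatFunc.X : RatFunc ℚ) ^ (k + 1) ≠ 0 := by
    intro k h
    rw [sub_eq_zero, ← RatFunc.algebraMap_X, ← map_pow, ← map_one (algebraMap (Polynomial ℚ)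
        (RatFunc ℚ))] at h
    have h1 := congrArg Polynomial.natDegree (RatFunc.algebraMap_injective ℚ h)
    simp at h1
  have hq : Units.map laurentToRatFunc.toMonoidHom qLaurent =
      Units.mk0 (RatFunc.X : RatFunc ℚ) RatFunc.X_ne_zero := by
    apply Units.ext
    change laurentToRatFunc (LaurentPolynomial.T 1) = _
    rw [laurentToRatFunc, LaurentPolynomial.eval₂_T, zpow_one]
  ext n
  rw [MvPowerSeries.coeff_map, nahmSym, coeff_nahmSum_mul A hA RatFunc.X_ne_zero hX,
    coeff_nahmLaurent, map_mul, map_mul, map_prod, map_intCast]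
  congr 1
  · congr 1
    have h : laurentToRatFunc ((qLaurent ^ (-nahmExp A n) : (LaurentPolynomial ℤ)ˣ) :
        LaurentPolynomial ℤ) =
      ((Units.map laurentToRatFunc.toMonoidHom (qLaurent ^ (-nahmExp A n)) : (RatFunc ℚ)ˣ) :
        RatFunc ℚ) := rfl
    rw [h, map_zpow, hq, Units.val_zpow_eq_zpow_val, Units.val_mk0]
  · refine Finset.prod_congr rfl fun i _ => ?_
    have h := prod_mul_map_gauss laurentToRatFunc _ hq (n i) (lin A n i + A i i)
    rw [Units.val_zpow_eq_zpow_val, Units.val_mk0] at h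
    rw [← h, mul_div_cancel_left₀]
    exact Finset.prod_ne_zero_iff.2 fun j _ => hX j

end Lagrange

/-! ### Coefficients of the symmetrised Nahm sum near a root of unity -/

theorem lin_smul {N : ℕ} (A : Matrix (Fin N) (Fin N) ℤ) (m : ℕ) (n : Fin N →₀ ℕ) (i : Fin N) :
    lin A (m • n) i = m * lin A n i := by
  simp only [lin, Finset.mul_sum, Finsupp.smul_apply, smul_eq_mul, Nat.cast_mul]
  exact Finset.sum_congr rfl fun j _ => by ring

theorem nahmExp_smul_add {N : ℕ} (A : Matrix (Fin N) (Fin N) ℤ) (hA : A.IsSymm) (m t : ℕ)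
    (ht : 2 * t = (m + 1) * m) (n l : Fin N →₀ ℕ) : nahmExp A ((m + 1) • n + l) =
      nahmExp A l + (m + 1 : ℕ) * (∑ i, (n i : ℤ) * lin A l i + nahmExp A n) +
        t * (2 * nahmExp A n - ∑ i, A i i * (n i : ℤ)) := by
  refine mul_left_cancel₀ (two_ne_zero (α := ℤ)) ?_
  have h1 := two_mul_nahmExp A hA n
  have h2 := two_mul_nahmExp A hA l
  have h3 := sum_mul_lin_comm A hA n l
  have h4 : 2 * (t : ℤ) = (m + 1) * m := by exact_mod_cast ht
  have h5 : ∑ i, A i i * (n i : ℤ) = ∑ i, (n i : ℤ) * A i i :=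
    Finset.sum_congr rfl fun i _ => mul_comm _ _
  rw [two_mul_nahmExp A hA]
  simp only [lin_add, lin_smul, Finsupp.add_apply, Finsupp.smul_apply, smul_eq_mul, Nat.cast_add,
    Nat.cast_mul, mul_add, add_mul, Finset.sum_add_distrib, Nat.cast_one, one_mul] at h1 h2 ⊢
  have h6 : ∑ i, (m : ℤ) * (n i : ℤ) * (m * lin A n i) = m * m * ∑ i, (n i : ℤ) * lin A n i := by
    rw [Finset.mul_sum]
    exact Finset.sum_congr rfl fun i _ => by ring
  have h7 : ∑ i, (n i : ℤ) * (m * lin A n i) = m * ∑ i, (n i : ℤ) * lin A n i := by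
    rw [Finset.mul_sum]
    exact Finset.sum_congr rfl fun i _ => by ring
  have h8 : ∑ i, (m : ℤ) * (n i : ℤ) * lin A n i = m * ∑ i, (n i : ℤ) * lin A n i := by
    rw [Finset.mul_sum]
    exact Finset.sum_congr rfl fun i _ => by ring
  have h9 : ∑ i, (m : ℤ) * (n i : ℤ) * lin A l i = m * ∑ i, (n i : ℤ) * lin A l i := by
    rw [Finset.mul_sum]
    exact Finset.sum_congr rfl fun i _ => by ring
  have h10 : ∑ i, (m : ℤ) * (n i : ℤ) * A i i = m * ∑ i, (n i : ℤ) * A i i := by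
    rw [Finset.mul_sum]
    exact Finset.sum_congr rfl fun i _ => by ring
  have h11 : ∑ i, (l i : ℤ) * (m * lin A n i) = m * ∑ i, (l i : ℤ) * lin A n i := by
    rw [Finset.mul_sum]
    exact Finset.sum_congr rfl fun i _ => by ring
  rw [h6, h7, h8, h9, h10, h11, h5, ← h3]
  linear_combination -h2 - ((m : ℤ) + 1) * (m + 1) * h1 -
    (2 * nahmExp A n - ∑ i, (n i : ℤ) * A i i) * h4

section Field

variable {K : Type*} [Field K]

theorem pow_half_eq {ζ : K} {m t : ℕ} (hζ : IsPrimitiveRoot ζ (m + 1)) (ht : 2 * t = (m + 1) * m) :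
    ζ ^ t = (-1) ^ m := by
  rcases Nat.even_or_odd' m with ⟨k, rfl | rfl⟩
  · have h : t = (2 * k + 1) * k := by
      refine Nat.eq_of_mul_eq_mul_left two_pos (ht.trans ?_)
      ring
    rw [h, pow_mul, hζ.pow_eq_one, one_pow, pow_mul, neg_one_sq, one_pow]
  · have h : t = (k + 1) * (2 * k + 1) := by
      refine Nat.eq_of_mul_eq_mul_left two_pos (ht.trans ?_)
      ring
    have h1 : (ζ ^ (k + 1)) ^ 2 = 1 := by
      rw [← pow_mul, show (k + 1) * 2 = 2 * k + 1 + 1 by ring, hζ.pow_eq_one]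
    have h2 : ζ ^ (k + 1) ≠ 1 := hζ.pow_ne_one_of_pos_of_lt (by omega) (by omega)
    rw [h, pow_mul, (mul_self_eq_one_iff.1 (by rwa [← pow_two])).resolve_left h2]

variable {N : ℕ} (A : Matrix (Fin N) (Fin N) ℤ)

/-- With t = m(m+1)/2 one has ζ^t = (-1)^m, so the power of ζ contributes (-1)^{m d} for d = ∑ A_ii
n_i, while the sign contributes (-1)^{(m+1) d}. Together they leave (-1)^d, the sign in `lagSeries`.
-/
theorem sgn_mul_zpow_nahmExp (hA : A.IsSymm) {ζ : Kˣ} {m : ℕ}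
    (hζ : IsPrimitiveRoot (ζ : K) (m + 1)) (n l : Fin N →₀ ℕ) :
    ((∏ i, sgn A i ^ ((m + 1) • n + l) i : ℤ) : K) * (ζ ^ (-nahmExp A ((m + 1) • n + l)) : Kˣ) =
      ((∏ i, sgn A i ^ l i : ℤ) : K) * (ζ ^ (-nahmExp A l) : Kˣ) *
        ((∏ i, sgn A i ^ n i : ℤ) : K) := by
  obtain ⟨t, ht⟩ : ∃ t, 2 * t = (m + 1) * m := by
    obtain ⟨t, ht⟩ := (Nat.even_mul_succ_self m).two_dvd
    exact ⟨t, by rw [← ht, mul_comm]⟩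
  have h0 : (-1 : K) ≠ 0 := neg_ne_zero.2 one_ne_zero
  have hζ0 : (ζ : K) ≠ 0 := ζ.ne_zero
  have h1 : (ζ : K) ^ (((m + 1 : ℕ) : ℤ) * (∑ i, (n i : ℤ) * lin A l i + nahmExp A n)) = 1 := by
    rw [zpow_mul, zpow_natCast, hζ.pow_eq_one, one_zpow]
  have h2 : (ζ : K) ^ ((t : ℤ) * (2 * nahmExp A n - ∑ i, A i i * (n i : ℤ))) =
      ((-1 : K) ^ (∑ i, A i i * (n i : ℤ))) ^ m := by
    rw [zpow_mul, zpow_natCast, pow_half_eq hζ ht, ← zpow_natCast, ← zpow_natCast, ← zpow_mul,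
      ← zpow_mul, mul_comm _ (m : ℤ), zpow_mul, zpow_mul]
    rcases Nat.even_or_odd m with h | h
    · simp [h.neg_one_pow]
    · rw [zpow_natCast, h.neg_one_pow, zpow_sub₀ h0, zpow_mul]
      simp [← inv_zpow]
  have h3 : ∑ i, A i i * ((((m + 1) • n + l) i : ℕ) : ℤ) =
      (m + 1 : ℕ) * ∑ i, A i i * (n i : ℤ) + ∑ i, A i i * (l i : ℤ) := by
    rw [Finset.mul_sum, ← Finset.sum_add_distrib]
    refine Finset.sum_congr rfl fun i _ => ?_
    rw [Finsupp.add_apply, Finsupp.smul_apply, smul_eq_mul]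
    push_cast
    ring
  rw [← neg_one_zpow_eq_prod, ← neg_one_zpow_eq_prod, ← neg_one_zpow_eq_prod,
    Units.val_zpow_eq_zpow_val, Units.val_zpow_eq_zpow_val, zpow_neg, zpow_neg,
    nahmExp_smul_add A hA m t ht, zpow_add₀ hζ0, zpow_add₀ hζ0, h1, h2, h3, zpow_add₀ h0,
    mul_comm ((m + 1 : ℕ) : ℤ), zpow_mul, zpow_natCast]
  have h4 : ((-1 : K) ^ (∑ i, A i i * (n i : ℤ))) ≠ 0 := zpow_ne_zero _ h0
  field_simp
  ring

theorem one_sub_qLoc_pow_ne_zero [CharZero K] (ζ : Kˣ) (k : ℕ) :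
    1 - (qLoc ζ : PowerSeries K) ^ (k + 1) ≠ 0 := by
  intro h
  have h1 : ((1 - (Polynomial.C (ζ : K) + Polynomial.X) ^ (k + 1) : Polynomial K) : PowerSeries K) =
      ((0 : Polynomial K) : PowerSeries K) := by
    rw [Polynomial.coe_zero, ← h]
    simp [qLoc]
  have h2 := Polynomial.coe_injective K h1
  have h3 := congrArg Polynomial.natDegree (sub_eq_zero.1 h2)
  rw [add_comm, Polynomial.natDegree_pow_X_add_C] at h3
  simp at h3

variable [CharZero K]

/-- The coefficients of the symmetrised Nahm sum at `q = ζ + x`, for exponents in a residue class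
modulo the order of `ζ`, are those of a Lagrange series times series whose coefficients are
polynomials in the exponents. -/
theorem exists_map_coeff_nahmLaurent (hA : A.IsSymm) {ζ : Kˣ} {m : ℕ}
    (hζ : IsPrimitiveRoot (ζ : K) (m + 1)) (φ : LaurentPolynomial ℤ →+* PowerSeries K)
    (hφ : Units.map φ.toMonoidHom qLaurent = qLoc ζ) (ρ : Fin N → Fin (m + 1)) :
    ∃ (c : Fin N → ℤ) (G : PowerSeries (MvPolynomial (Fin N) K)), ∀ n : Fin N →₀ ℕ,
      φ (MvPowerSeries.coeff ((m + 1) • n + resExp ρ) (nahmLaurent A)) =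
        PowerSeries.C ((MvPowerSeries.coeff n (lagSeries A c) : ℤ) : K) *
          PowerSeries.map (MvPolynomial.eval fun i => (n i : K)) G := by
  -- The subtraction of 1 matches `exists_gauss_interp`, where the residue of s is written c₀ + 1
  -- with 0 ≤ c₀ ≤ m.
  let e (i : Fin N) : ℤ := lin A (resExp ρ) i + A i i - 1
  let c (i : Fin N) : ℤ := e i / (m + 1 : ℕ)
  let c₀ (i : Fin N) : ℕ := (e i % (m + 1 : ℕ)).toNat
  have hm : ((m + 1 : ℕ) : ℤ) ≠ 0 := by positivity
  have hc₀ (i : Fin N) : (c₀ i : ℤ) = e i % (m + 1 : ℕ) := Int.toNat_of_nonneg (Int.emod_nonneg _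
      hm)
  have hc (i : Fin N) : c₀ i < m + 1 := by
    have := Int.emod_lt_of_pos (e i) (by positivity : (0 : ℤ) < (m + 1 : ℕ))
    rw [← hc₀] at this
    exact_mod_cast this
  have hs (n : Fin N →₀ ℕ) (i : Fin N) : lin A ((m + 1) • n + resExp ρ) i + A i i =
      (m + 1) * (lin A n i + c i) + c₀ i + 1 := by
    have h1 := Int.mul_ediv_add_emod (e i) (m + 1 : ℕ)
    rw [← hc₀] at h1
    rw [lin_add, lin_smul]
    change ((m + 1 : ℕ) : ℤ) * c i + c₀ i = lin A (resExp ρ) i + A i i - 1 at h1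
    push_cast at h1 ⊢
    linear_combination -h1
  choose Θ hΘ using fun i => exists_gauss_interp hζ (hc i) (ρ i).2
  let S (i : Fin N) : MvPolynomial (Fin N) K :=
    ∑ j, MvPolynomial.C (A i j : K) * MvPolynomial.X j + MvPolynomial.C (c i : K)
  let T (i : Fin N) : Polynomial (Polynomial K) →+* MvPolynomial (Fin N) K :=
    Polynomial.eval₂RingHom (Polynomial.eval₂RingHom MvPolynomial.C (S i)) (MvPolynomial.X i)
  have hT (n : Fin N →₀ ℕ) (i : Fin N) : (MvPolynomial.eval fun i => (n i : K)).comp (T i) =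
      Polynomial.evalEvalRingHom ((lin A n i + c i : ℤ) : K) (n i : K) := by
    refine Polynomial.ringHom_ext' (Polynomial.ringHom_ext' (RingHom.ext fun a => ?_) ?_) ?_
    · simp [T]
    · simp [T, S, lin]
    · simp [T]
  -- The exponent of q as a polynomial in n on the residue class; the half is available since K has
  -- characteristic 0.
  let β : MvPolynomial (Fin N) K := MvPolynomial.C (-(1 / 2 : K)) *
    ∑ i, (MvPolynomial.C ((m + 1 : ℕ) : K) * MvPolynomial.X i + MvPolynomial.C ((ρ i : ℕ) : K)) *
      (∑ j, MvPolynomial.C (A i j : K) * (MvPolynomial.C ((m + 1 : ℕ) : K) * MvPolynomial.X j +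
        MvPolynomial.C ((ρ j : ℕ) : K)) +
        MvPolynomial.C (A i i : K))
  have hβ (n : Fin N →₀ ℕ) : MvPolynomial.eval (fun i => (n i : K)) β =
      ((-nahmExp A ((m + 1) • n + resExp ρ) : ℤ) : K) := by
    have h1 := congrArg (Int.cast (R := K)) (two_mul_nahmExp A hA ((m + 1) • n + resExp ρ))
    rw [Int.cast_neg, show (nahmExp A ((m + 1) • n + resExp ρ) : K) =
      (1 / 2) * ((2 * nahmExp A ((m + 1) • n + resExp ρ) : ℤ) : K) by push_cast; ring, h1]
    simp [β, lin]
  let κ : K := ((∏ i, sgn A i ^ resExp ρ i : ℤ) : K) * (ζ ^ (-nahmExp A (resExp ρ)) : Kˣ)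
  refine ⟨c, PowerSeries.C (MvPolynomial.C κ) * binPow (MvPolynomial.C ((ζ⁻¹ : Kˣ) : K)) β *
    ∏ i, PowerSeries.map (T i) (Θ i), fun n => ?_⟩
  have hgauss (i : Fin N) : φ (gauss (((m + 1) • n + resExp ρ) i)
      (lin A ((m + 1) • n + resExp ρ) i + A i i)) = PowerSeries.C (bin (lin A n i + c i) (n i) : K)
          *
        PowerSeries.map (MvPolynomial.eval fun i => (n i : K)) (PowerSeries.map (T i) (Θ i)) := by
    have h1 := prod_mul_map_gauss φ _ hφ (((m + 1) • n + resExp ρ) i)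
      (lin A ((m + 1) • n + resExp ρ) i + A i i)
    have h2 := hΘ i (lin A n i + c i) (n i)
    rw [← hs n i] at h2
    rw [← RingHom.comp_apply, ← PowerSeries.map_comp, hT]
    refine mul_left_cancel₀ (Finset.prod_ne_zero_iff.2 fun j _ => one_sub_qLoc_pow_ne_zero ζ j)
      (h1.trans (h2.trans (mul_comm _ _)))
  have hq : φ ((qLaurent ^ (-nahmExp A ((m + 1) • n + resExp ρ)) : (LaurentPolynomial ℤ)ˣ) :
      LaurentPolynomial ℤ) = PowerSeries.C ((ζ ^ (-nahmExp A ((m + 1) • n + resExp ρ)) : Kˣ) : K) *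
        PowerSeries.map (MvPolynomial.eval fun i => (n i : K))
          (binPow (MvPolynomial.C ((ζ⁻¹ : Kˣ) : K)) β) := by
    rw [map_binPow, MvPolynomial.eval_C, hβ]
    have h1 := qInterp_intCast ζ _ (-nahmExp A ((m + 1) • n + resExp ρ)) rfl
    rw [← hφ, ← map_zpow] at h1
    exact h1.symm
  rw [coeff_nahmLaurent, map_mul, map_mul, map_prod, hq, Finset.prod_congr rfl fun i _ => hgauss i,
    Finset.prod_mul_distrib, coeff_lagSeries, map_intCast, map_mul, map_mul, map_prod,
    PowerSeries.map_C, MvPolynomial.eval_C, Finset.prod_mul_distrib, Int.cast_mul,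
    Int.cast_prod (fun i => bin _ _), map_mul, map_prod, ← mul_assoc, ← mul_assoc]
  have h := congrArg PowerSeries.C (sgn_mul_zpow_nahmExp A hA hζ n (resExp ρ))
  simp only [map_mul, map_intCast] at h ⊢
  simp only [κ, map_mul, map_intCast]
  linear_combination (PowerSeries.map (MvPolynomial.eval fun i => (n i : K))
      (binPow (MvPolynomial.C ((ζ⁻¹ : Kˣ) : K)) β)) *
    (∏ i, ((bin (lin A n i + c i) (n i) : ℤ) : PowerSeries K)) * (∏ i, PowerSeries.map
        (MvPolynomial.eval fun i => (n i : K))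
      (PowerSeries.map (T i) (Θ i))) * h

end Field

/-! ### Clearing denominators from the fraction field of ℤ[ζ_m]. -/

section Descent

variable {σ R : Type*} [CommRing R] [Algebra (MvPolynomial σ ℤ) R] (ζ : CompatibleRoots) (m : ℕ+)

/-- ℤ[ζ_m] is integral over ℤ, so denominators may be taken to be integers, as the divisibility
criteria require. -/
theorem exists_intCast_mul_eq_algebraMap {K : Type*} [Field K] [Algebra (CycInt ζ m) K]
    [IsFractionRing (CycInt ζ m) K] (k : K) :
    ∃ (M : ℤ) (c : CycInt ζ m), M ≠ 0 ∧ (M : K) * k = algebraMap (CycInt ζ m) K c := by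
  have := cycInt_finite ζ m
  obtain ⟨a, b, hb, rfl⟩ := IsFractionRing.div_surjective (A := CycInt ζ m) k
  have hb0 : b ≠ 0 := nonZeroDivisors.ne_zero hb
  obtain ⟨M, hM, c, hc⟩ := (Algebra.IsIntegral.isIntegral (R := ℤ) b).isAlgebraic.exists_nonzero_dvd
    hb
  refine ⟨M, c * a, hM, ?_⟩
  have h1 : (M : K) = algebraMap (CycInt ζ m) K (b * c) := by
    rw [← hc]
    simp
  have h2 : algebraMap (CycInt ζ m) K b ≠ 0 :=
    (map_ne_zero_iff _ (IsFractionRing.injective (CycInt ζ m) K)).2 hb0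
  rw [h1, map_mul, map_mul]
  field_simp

/-- The image of `R_m` in `K⟦λ^{1/m}⟧`. -/
def rootSeriesMap (ι : R →ₐ[MvPolynomial σ ℤ] MvPowerSeries σ ℤ) (K : Type*) [CommRing K]
    [Algebra (CycInt ζ m) K] : RootRing σ R ζ m →+* MvPowerSeries σ K :=
  (MvPowerSeries.map (algebraMap (CycInt ζ m) K)).comp (rootSeries ζ ι m)

theorem exists_intCast_mul_eq_rootSeriesMap (ι : R →ₐ[MvPolynomial σ ℤ] MvPowerSeries σ ℤ)
    {K : Type*} [Field K] [Algebra (CycInt ζ m) K] [IsFractionRing (CycInt ζ m) K]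
    (x : MvPowerSeries σ K)
    (hx : x ∈ Submodule.span K (Set.range (rootSeriesMap ζ m ι K))) :
    ∃ (M : ℤ) (u : RootRing σ R ζ m), M ≠ 0 ∧ (M : MvPowerSeries σ K) * x =
      rootSeriesMap ζ m ι K u := by
  induction hx using Submodule.span_induction with
  | mem x hx =>
    obtain ⟨u, rfl⟩ := hx
    exact ⟨1, u, one_ne_zero, by simp⟩
  | zero => exact ⟨1, 0, one_ne_zero, by simp⟩
  | add x y _ _ hx hy =>
    obtain ⟨M, u, hM, hu⟩ := hx
    obtain ⟨M', u', hM', hu'⟩ := hy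
    refine ⟨M * M', M' * u + M * u', mul_ne_zero hM hM', ?_⟩
    rw [map_add, map_mul, map_mul, ← hu, ← hu', map_intCast, map_intCast, Int.cast_mul]
    ring
  | smul k x _ hx =>
    obtain ⟨M, u, hM, hu⟩ := hx
    obtain ⟨M', c, hM', hc⟩ := exists_intCast_mul_eq_algebraMap ζ m k
    refine ⟨M' * M, RootRing.ofCyc σ R ζ m c * u, mul_ne_zero hM' hM, ?_⟩
    rw [map_mul, ← hu, rootSeriesMap, RingHom.comp_apply, rootSeries_ofCyc, MvPowerSeries.map_C,
      ← hc, MvPowerSeries.smul_eq_C_mul, Int.cast_mul, map_mul, map_intCast]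
    ring

theorem monomial_mul_expand_mem_span [Fintype σ] (ι : R →ₐ[MvPolynomial σ ℤ] MvPowerSeries σ ℤ)
    {K : Type*} [CommRing K] [Algebra (CycInt ζ m) K] (ρ : σ → Fin m) (x : MvPowerSeries σ K)
    (hx : x ∈ Submodule.span K (Set.range fun r => MvPowerSeries.map (Int.castRingHom K) (ι r))) :
    MvPowerSeries.monomial (resExp ρ) 1 * MvPowerSeries.expand (m : ℕ) m.ne_zero x ∈
      Submodule.span K (Set.range (rootSeriesMap ζ m ι K)) := by
  induction hx using Submodule.span_induction with
  | mem x hx =>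
    obtain ⟨r, rfl⟩ := hx
    refine Submodule.subset_span ⟨_, (congrArg (MvPowerSeries.map (algebraMap (CycInt ζ m) K))
      (rootSeries_residue ζ m ι r 1 ρ)).trans ?_⟩
    rw [map_mul, MvPowerSeries.map_monomial, map_one, MvPowerSeries.map_expand,
      ← RingHom.comp_apply, ← MvPowerSeries.map_comp]
    congr 5
    exact RingHom.ext_int _ _
  | zero => simp
  | add x y _ _ hx hy =>
    rw [map_add, mul_add]
    exact Submodule.add_mem _ hx hy
  | smul k x _ hx =>
    rw [map_smul, mul_smul_comm]
    exact Submodule.smul_mem _ _ hx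

end Descent

variable {N : ℕ} (A : Matrix (Fin N) (Fin N) ℤ)

theorem exists_map_coeff_nahmLaurent_of_ne_zero (hA : A.IsSymm) {K : Type*} [Field K] [CharZero K]
    {ζ : Kˣ}
    {m : ℕ} (hm : m ≠ 0) (hζ : IsPrimitiveRoot (ζ : K) m)
    (φ : LaurentPolynomial ℤ →+* PowerSeries K)
    (hφ : Units.map φ.toMonoidHom qLaurent = qLoc ζ) (ρ : Fin N → Fin m) :
    ∃ (c : Fin N → ℤ) (G : PowerSeries (MvPolynomial (Fin N) K)), ∀ n : Fin N →₀ ℕ,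
      φ (MvPowerSeries.coeff (m • n + resExp ρ) (nahmLaurent A)) =
        PowerSeries.C ((MvPowerSeries.coeff n (lagSeries A c) : ℤ) : K) *
          PowerSeries.map (MvPolynomial.eval fun i => (n i : K)) G := by
  cases m with
  | zero => exact absurd rfl hm
  | succ m => exact exists_map_coeff_nahmLaurent A hA hζ φ hφ ρ

/-- The coefficients of the expansion of the symmetrised Nahm sum at `q = ζ_m` lie in
`(R_A)_m`. -/
theorem exists_coeff_rootSeries_eq (hA : A.IsSymm) (ζ : CompatibleRoots) (m : ℕ+) (k : ℕ) :
    ∃ u : RootRing (Fin N) (NahmRing A) ζ m, ∀ n,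
      MvPowerSeries.coeff n (rootSeries ζ (nahmSeries A hA) m u) =
        PowerSeries.coeff k (expandAt ζ m (MvPowerSeries.coeff n (nahmLaurent A))) := by
  classical
  let C := CycInt ζ m
  let K := FractionRing C
  have hinj : Function.Injective (algebraMap C K) := IsFractionRing.injective C K
  have : CharZero K := charZero_of_injective_algebraMap hinj
  have hprim : IsPrimitiveRoot (zeta ζ m) m :=
    IsPrimitiveRoot.of_map_of_injective (f := C.val) (ζ.primitive m) Subtype.val_injective
  have hprimK := hprim.map_of_injective hinj
  let z : Kˣ := Units.mk0 (algebraMap C K (zeta ζ m)) (hprimK.ne_zero m.ne_zero)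
  let φ : LaurentPolynomial ℤ →+* PowerSeries K :=
    (PowerSeries.map (algebraMap C K)).comp (expandAt ζ m)
  have hφ : Units.map φ.toMonoidHom qLaurent = qLoc z := by
    apply Units.ext
    change PowerSeries.map (algebraMap C K) (expandAt ζ m (LaurentPolynomial.T 1)) =
      PowerSeries.C (algebraMap C K (zeta ζ m)) + PowerSeries.X
    rw [expandAt, LaurentPolynomial.eval₂_T, zpow_one, qUnit, IsUnit.unit_spec, map_add,
      PowerSeries.map_C, PowerSeries.map_X]
  choose c G hG using exists_map_coeff_nahmLaurent_of_ne_zero A hA (ζ := z) m.ne_zero hprimK φ hφ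
  let E : MvPowerSeries (Fin N) C := fun n =>
    PowerSeries.coeff k (expandAt ζ m (MvPowerSeries.coeff n (nahmLaurent A)))
  -- E is cut into residue classes of exponents modulo m; on each class it is a Lagrange series with
  -- coefficients multiplied by a polynomial in the exponents.
  have hE : MvPowerSeries.map (algebraMap C K) E = ∑ ρ, MvPowerSeries.monomial (resExp ρ) 1 *
      MvPowerSeries.expand (m : ℕ) m.ne_zero (hadamard (PowerSeries.coeff k (G ρ))
        (MvPowerSeries.map (Int.castRingHom K) (lagSeries A (c ρ)))) := by
    ext n
    obtain ⟨n, ρ, rfl⟩ := exists_eq_smul_add_resExp m.ne_zero n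
    simp only [map_sum, coeff_monomial_mul_expand]
    rw [Finset.sum_eq_single ρ (fun ρ' _ h => if_neg h) (by simp), if_pos rfl, one_mul,
      coeff_hadamard, MvPowerSeries.coeff_map, MvPowerSeries.coeff_map]
    have h := congrArg (PowerSeries.coeff k) (hG ρ n)
    rw [PowerSeries.coeff_C_mul, PowerSeries.coeff_map, mul_comm] at h
    exact h
  have hmem : MvPowerSeries.map (algebraMap C K) E ∈
      Submodule.span K (Set.range (rootSeriesMap ζ m (nahmSeries A hA) K)) := by
    rw [hE]
    refine Submodule.sum_mem _ fun ρ _ => monomial_mul_expand_mem_span ζ m (nahmSeries A hA) ρ _ ?_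
    obtain ⟨r, hr⟩ := lagSeries_mem_range A hA (c ρ)
    rw [← hr]
    exact hadamard_mem_span A hA _ r
  obtain ⟨M, u, hM, hu⟩ := exists_intCast_mul_eq_rootSeriesMap ζ m _ _ hmem
  have hu' : rootSeries ζ (nahmSeries A hA) m u = (M : MvPowerSeries (Fin N) C) * E := by
    have h : MvPowerSeries.map (algebraMap C K) (rootSeries ζ (nahmSeries A hA) m u) =
        MvPowerSeries.map (algebraMap C K) ((M : MvPowerSeries (Fin N) C) * E) := by
      rw [map_mul, map_intCast, hu]
      rfl
    exact MvPowerSeries.ext fun n => hinj (by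
      simpa only [MvPowerSeries.coeff_map] using congrArg (MvPowerSeries.coeff n) h)
  have hco (n) : MvPowerSeries.coeff n (rootSeries ζ (nahmSeries A hA) m u) =
      (M : C) * MvPowerSeries.coeff n E := by
    rw [hu', ← map_intCast (MvPowerSeries.C (σ := Fin N) (R := C)), MvPowerSeries.coeff_C_mul]
  -- The series of u is M E with E integral over ℤ[ζ_m], so M divides u in R_m and can be cancelled.
  obtain ⟨u', rfl⟩ := dvd_of_dvd_coeff_rootSeries ζ m (nahmSeries A hA)
    (nahm_dvd_of_dvd_coeff A hA) M u fun n => ⟨_, hco n⟩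
  refine ⟨u', fun n => ?_⟩
  have hM' : (M : C) ≠ 0 := Int.cast_ne_zero.2 hM
  refine mul_left_cancel₀ hM' ((hco n).symm.trans ?_).symm
  rw [map_mul, map_intCast, ← map_intCast (MvPowerSeries.C (σ := Fin N) (R := C)),
    MvPowerSeries.coeff_C_mul]

/-! ### Gluing of expansions of series over `ℤ[q^{±1}]` -/

theorem dvd_of_dvd_coeff {σ B : Type*} [CommRing B] (b : B) (f : MvPowerSeries σ B)
    (h : ∀ n, b ∣ MvPowerSeries.coeff n f) : MvPowerSeries.C b ∣ f := by
  choose g hg using h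
  let G : MvPowerSeries σ B := g
  refine ⟨G, MvPowerSeries.ext fun n => ?_⟩
  rw [MvPowerSeries.coeff_C_mul]
  exact hg n

theorem laurent_hom_ext {S : Type*} [CommRing S] {f g : LaurentPolynomial ℤ →+* S}
    (h : f (LaurentPolynomial.T 1) = g (LaurentPolynomial.T 1)) : f = g := by
  have h' : f (LaurentPolynomial.T (-1)) = g (LaurentPolynomial.T (-1)) := by
    refine left_inv_eq_right_inv (a := f (LaurentPolynomial.T 1)) ?_ ?_
    · rw [← map_mul, ← LaurentPolynomial.T_add, neg_add_cancel, LaurentPolynomial.T_zero, map_one]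
    · rw [h, ← map_mul, ← LaurentPolynomial.T_add, add_neg_cancel, LaurentPolynomial.T_zero,
        map_one]
  refine RingHom.ext fun x => ?_
  induction x using LaurentPolynomial.induction_on with
  | h_C a => rw [eq_intCast, map_intCast, map_intCast]
  | h_add hp hq => rw [map_add, map_add, hp, hq]
  | h_C_mul_T n a ih => rw [LaurentPolynomial.T_add, ← mul_assoc, map_mul, ih, h, ← map_mul]
  | h_C_mul_T_Z n a ih =>
    rw [sub_eq_add_neg, LaurentPolynomial.T_add, ← mul_assoc, map_mul, ih, h', ← map_mul]

/-- As p is nilpotent in T, maps that agree modulo p and on ℤ[λ] agree by unramifiedness. -/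
theorem hom_ext_of_dvd_sub {σ R T : Type*} [CommRing R] [Algebra (MvPolynomial σ ℤ) R]
    [Algebra.FormallyUnramified (MvPolynomial σ ℤ) R] [CommRing T] {p n : ℕ} (hp : (p : T) ^ n = 0)
    {f g : R →+* T}
    (hX : ∀ i, f (algebraMap (MvPolynomial σ ℤ) R (MvPolynomial.X i)) =
      g (algebraMap (MvPolynomial σ ℤ) R (MvPolynomial.X i)))
    (h : ∀ r, (p : T) ∣ f r - g r) : f = g := by
  let _ : Algebra (MvPolynomial σ ℤ) T := (g.comp (algebraMap (MvPolynomial σ ℤ) R)).toAlgebra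
  let f' : R →ₐ[MvPolynomial σ ℤ] T :=
    { f with
      commutes' := RingHom.congr_fun (polyInt_hom_ext
        (f := f.comp (algebraMap (MvPolynomial σ ℤ) R))
        (g := g.comp (algebraMap (MvPolynomial σ ℤ) R)) hX) }
  let g' : R →ₐ[MvPolynomial σ ℤ] T := { g with commutes' := fun _ => rfl }
  have hI : IsNilpotent (Ideal.span {(p : T)}) := by
    refine ⟨n, ?_⟩
    rw [Ideal.span_singleton_pow, Ideal.zero_eq_bot, Ideal.span_singleton_eq_bot, hp]
  have h1 : f' = g' := Algebra.FormallyUnramified.ext (R := MvPolynomial σ ℤ) _ hI fun r => by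
    rw [Ideal.Quotient.eq, Ideal.mem_span_singleton]
    exact h r
  exact RingHom.ext fun r => DFunLike.congr_fun h1 r

/-- On coefficients in 𝔽_p the Frobenius is trivial, so F^p and F(λ^p) have the same reduction. -/
theorem dvd_expand_sub_pow {σ : Type*} {p : ℕ} (hp : p.Prime) (F : MvPowerSeries σ ℤ) :
    (p : MvPowerSeries σ ℤ) ∣ MvPowerSeries.expand p hp.ne_zero F - F ^ p := by
  have : Fact p.Prime := ⟨hp⟩
  rw [← map_natCast (MvPowerSeries.C (σ := σ) (R := ℤ))]
  refine dvd_of_dvd_coeff _ _ fun n => ?_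
  rw [← ZMod.intCast_zmod_eq_zero_iff_dvd, ← eq_intCast (Int.castRingHom (ZMod p)),
    ← MvPowerSeries.coeff_map, map_sub, map_pow, MvPowerSeries.map_expand,
    ← MvPowerSeries.map_frobenius_expand p hp.ne_zero, ZMod.frobenius_zmod]
  simp

theorem expand_comm {σ B : Type*} [CommRing B] {a b : ℕ} (ha : a ≠ 0) (hb : b ≠ 0)
    (f : MvPowerSeries σ B) : MvPowerSeries.expand a ha (MvPowerSeries.expand b hb f) =
      MvPowerSeries.expand b hb (MvPowerSeries.expand a ha f) := by
  rw [← MvPowerSeries.expand_mul, ← MvPowerSeries.expand_mul]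
  congr 2
  exact mul_comm a b

theorem dvd_expand_expand_sub_pow {σ C : Type*} [CommRing C] {p k : ℕ} (hp : p.Prime) (hk : k ≠ 0)
    (F : MvPowerSeries σ ℤ) : (p : MvPowerSeries σ C) ∣
      MvPowerSeries.expand p hp.ne_zero (MvPowerSeries.expand k hk
        (MvPowerSeries.map (Int.castRingHom C) F)) -
      MvPowerSeries.expand k hk (MvPowerSeries.map (Int.castRingHom C) F) ^ p := by
  have h := map_dvd ((MvPowerSeries.expand k hk).toRingHom.comp
    (MvPowerSeries.map (Int.castRingHom C))) (dvd_expand_sub_pow hp F)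
  rw [map_natCast, map_sub, map_pow] at h
  rw [expand_comm, ← MvPowerSeries.map_expand]
  exact h

section Glue

variable {σ R : Type*} [CommRing R] [Algebra (MvPolynomial σ ℤ) R] (ζ : CompatibleRoots)
  (ι : R →ₐ[MvPolynomial σ ℤ] MvPowerSeries σ ℤ)

/-- Since λ^{1/m} = (λ^{1/(pm)})^p, the inclusion multiplies exponents by p. -/
theorem rootSeries_incl (p m : ℕ+) (x : RootRing σ R ζ m) :
    rootSeries ζ ι (p * m) (RootRing.incl σ R ζ p m x) = MvPowerSeries.expand (p : ℕ) p.ne_zero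
      (MvPowerSeries.map (cycIncl ζ p m) (rootSeries ζ ι m x)) := by
  refine RingHom.congr_fun (f := (rootSeries ζ ι (p * m)).comp (RootRing.incl σ R ζ p m))
    (g := ((MvPowerSeries.expand (p : ℕ) p.ne_zero).toRingHom.comp
      (MvPowerSeries.map (cycIncl ζ p m))).comp (rootSeries ζ ι m))
    (RootRing.hom_ext σ R ζ (fun r => ?_) (fun a => ?_) (fun i => ?_)) x
  · have e : RootRing.incl σ R ζ p m (RootRing.ofBase σ R ζ m r) =
        RootRing.ofBase σ R ζ (p * m) r := by
      have e1 : RootRing.ofBase σ R ζ m r = r ⊗ₜ[MvPolynomial σ ℤ] (1 : RootPoly σ ζ m) := rfl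
      rw [e1, RootRing.incl, tensorLift_tmul, map_one, mul_one]
    simp only [RingHom.comp_apply, e, rootSeries_ofBase, AlgHom.toRingHom_eq_coe, RingHom.coe_coe]
    rw [MvPowerSeries.map_expand, ← MvPowerSeries.expand_mul, ← RingHom.comp_apply,
      ← MvPowerSeries.map_comp]
    congr 3
  · have e : RootRing.incl σ R ζ p m (RootRing.ofCyc σ R ζ m a) =
        RootRing.ofCyc σ R ζ (p * m) (cycIncl ζ p m a) := by
      have e1 : RootRing.ofCyc σ R ζ m a = (1 : R) ⊗ₜ[MvPolynomial σ ℤ] RootPoly.C a := rfl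
      rw [e1, RootRing.incl, tensorLift_tmul, map_one, one_mul, RingHom.comp_apply, RootPoly.incl,
        RootPoly.evalHom_C]
      rfl
    simp only [RingHom.comp_apply, e, rootSeries_ofCyc, AlgHom.toRingHom_eq_coe, RingHom.coe_coe,
      MvPowerSeries.map_C, MvPowerSeries.expand_C]
  · have e : RootRing.incl σ R ζ p m (RootRing.lam σ R ζ m i) =
        RootRing.lam σ R ζ (p * m) i ^ (p : ℕ) := by
      have e1 : RootRing.lam σ R ζ m i = (1 : R) ⊗ₜ[MvPolynomial σ ℤ] RootPoly.X i := rfl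
      rw [e1, RootRing.incl, tensorLift_tmul, map_one, one_mul, RingHom.comp_apply, RootPoly.incl,
        RootPoly.evalHom_X, map_pow]
      rfl
    simp only [RingHom.comp_apply, e, rootSeries_lam, map_pow, AlgHom.toRingHom_eq_coe,
      RingHom.coe_coe, MvPowerSeries.map_X, MvPowerSeries.expand_X]

variable (m : ℕ+) (p n : ℕ)

/-- The quotient `ℤ[ζ_m] / (p^n)`. -/
abbrev CycMod : Type := CycInt ζ m ⧸ Ideal.span {(p : CycInt ζ m) ^ n}

theorem natCast_pow_cycMod : (p : MvPowerSeries σ (CycMod ζ m p n)) ^ n = 0 := by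
  rw [← map_natCast (MvPowerSeries.C (σ := σ) (R := CycMod ζ m p n)), ← map_pow,
    ← map_natCast (Ideal.Quotient.mk _), ← map_pow,
    Ideal.Quotient.eq_zero_iff_mem.2 (Ideal.mem_span_singleton_self _), map_zero]

/-- The map `R_m / (p^n) → (ℤ[ζ_m] / (p^n))⟦λ^{1/m}⟧`. -/
def modSeries : RootRing.Mod σ R ζ m p n →+* MvPowerSeries σ (CycMod ζ m p n) :=
  Ideal.Quotient.lift _ ((MvPowerSeries.map (Ideal.Quotient.mk _)).comp (rootSeries ζ ι m)) (by
    intro x hx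
    obtain ⟨y, rfl⟩ := Ideal.mem_span_singleton.1 hx
    rw [map_mul, map_pow, map_natCast, natCast_pow_cycMod, zero_mul])

theorem modSeries_toMod (x : RootRing σ R ζ m) :
    modSeries ζ ι m p n (RootRing.toMod σ R ζ m p n x) =
      MvPowerSeries.map (Ideal.Quotient.mk _) (rootSeries ζ ι m x) := rfl

theorem modSeries_injective [Fintype σ]
    (hι : ∀ (M : ℤ) r, (∀ n, M ∣ MvPowerSeries.coeff n (ι r)) → (M : R) ∣ r) :
    Function.Injective (modSeries ζ ι m p n) := by
  refine (injective_iff_map_eq_zero _).2 fun x hx => ?_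
  obtain ⟨x, rfl⟩ := Ideal.Quotient.mk_surjective x
  refine Ideal.Quotient.eq_zero_iff_mem.2 (Ideal.mem_span_singleton.2 ?_)
  have h := dvd_of_dvd_coeff_rootSeries ζ m ι hι ((p : ℤ) ^ n) x fun k => by
    have h1 := congrArg (MvPowerSeries.coeff k) hx
    rw [modSeries_toMod, MvPowerSeries.coeff_map, map_zero, Ideal.Quotient.eq_zero_iff_mem,
      Ideal.mem_span_singleton] at h1
    simpa using h1
  simpa using h

/-- Both sides fix ζ_m and raise λ^{1/m} to the p-th power. On R both lift the p-th power map modulo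
p, so they agree by `hom_ext_of_dvd_sub`. -/
theorem modSeries_frobeniusMod [Algebra.Etale (MvPolynomial σ ℤ) R] {p : ℕ} (hp : p.Prime)
    (x : RootRing σ R ζ m) : modSeries ζ ι m p n (frobeniusMod σ R ζ m hp n x) =
      MvPowerSeries.expand p hp.ne_zero
        (MvPowerSeries.map (Ideal.Quotient.mk _) (rootSeries ζ ι m x)) := by
  have hφ : IsFrobeniusMod σ R ζ m p n (frobeniusMod σ R ζ m hp n) :=
    (existsUnique_frobeniusMod σ R ζ m hp n).choose_spec.1
  let f : RootRing σ R ζ m →+* MvPowerSeries σ (CycMod ζ m p n) :=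
    (modSeries ζ ι m p n).comp (frobeniusMod σ R ζ m hp n)
  let g : RootRing σ R ζ m →+* MvPowerSeries σ (CycMod ζ m p n) :=
    (MvPowerSeries.expand p hp.ne_zero).toRingHom.comp
      ((MvPowerSeries.map (Ideal.Quotient.mk _)).comp (rootSeries ζ ι m))
  have hf (x) : f x = modSeries ζ ι m p n (frobeniusMod σ R ζ m hp n x) := rfl
  have hg (x) : g x = MvPowerSeries.expand p hp.ne_zero
    (MvPowerSeries.map (Ideal.Quotient.mk _) (rootSeries ζ ι m x)) := rfl
  clear_value f g
  have hlam (i : σ) : f (RootRing.lam σ R ζ m i) = g (RootRing.lam σ R ζ m i) := by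
    rw [hf, hg, hφ.lam, modSeries_toMod, map_pow, map_pow, rootSeries_lam, MvPowerSeries.map_X,
      MvPowerSeries.expand_X]
  have hbase : f.comp (RootRing.ofBase σ R ζ m) = g.comp (RootRing.ofBase σ R ζ m) := by
    refine hom_ext_of_dvd_sub (σ := σ) (natCast_pow_cycMod ζ m p n) (fun i => ?_) fun r => ?_
    · rw [RingHom.comp_apply, RingHom.comp_apply, RootRing.ofBase_X, map_pow, map_pow, hlam]
    · rw [RingHom.comp_apply, RingHom.comp_apply, hf, hg]
      have h1 := map_dvd (modSeries ζ ι m p n) (hφ.base r)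
      have h2 := map_dvd (MvPowerSeries.map (Ideal.Quotient.mk (Ideal.span {(p : CycInt ζ m) ^ n})))
        (dvd_expand_expand_sub_pow (C := CycInt ζ m) hp m.ne_zero (ι r))
      rw [map_natCast, map_sub, modSeries_toMod, map_pow, map_pow] at h1
      rw [map_natCast, map_sub, map_pow, ← rootSeries_ofBase, MvPowerSeries.map_expand] at h2
      have h3 := dvd_sub h1 h2
      rw [sub_sub_sub_cancel_right] at h3
      exact h3
  have hfg : f = g := by
    refine RootRing.hom_ext σ R ζ (RingHom.congr_fun hbase) (fun a => ?_) hlam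
    rw [hf, hg, hφ.cyc, modSeries_toMod, rootSeries_ofCyc, MvPowerSeries.map_C,
      MvPowerSeries.expand_C]
  rw [← hf, ← hg, hfg]

theorem coeff_X_add_C_pow {C S : Type*} [CommRing C] [CommRing S] (τ : C →+* S) (a : C) (d k : ℕ) :
    PowerSeries.coeff k ((PowerSeries.X + PowerSeries.C (τ a)) ^ d) =
      τ (PowerSeries.coeff k ((PowerSeries.X + PowerSeries.C a) ^ d)) := by
  have h : (PowerSeries.X + PowerSeries.C (τ a)) ^ d =
      PowerSeries.map τ ((PowerSeries.X + PowerSeries.C a) ^ d) := by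
    rw [map_pow, map_add, PowerSeries.map_X, PowerSeries.map_C]
  rw [h, PowerSeries.coeff_map]

/-- A coefficient of the shifted series is a finite combination of the original ones with
multipliers from C. It therefore commutes with any additive map compatible with C, such as taking
one λ-coefficient. -/
theorem map_coeff_subst_shift {B C W : Type*} [CommRing B] [CommRing C] [CommRing W] (τ : C →+* B)
    (π : C →+* W) (L : B →+ W) (hL : ∀ x c, L (x * τ c) = L x * π c) (a : C)
    (hB : PowerSeries.HasSubst (PowerSeries.X + PowerSeries.C (τ a)))
    (hW : PowerSeries.HasSubst (PowerSeries.X + PowerSeries.C (π a))) (f : PowerSeries B) (k : ℕ) :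
    L (PowerSeries.coeff k (PowerSeries.subst (PowerSeries.X + PowerSeries.C (τ a)) f)) =
      PowerSeries.coeff k (PowerSeries.subst (PowerSeries.X + PowerSeries.C (π a))
        (PowerSeries.mk fun d => L (PowerSeries.coeff d f))) := by
  rw [PowerSeries.coeff_subst' hB, PowerSeries.coeff_subst' hW,
    AddMonoidHom.map_finsum L (PowerSeries.coeff_subst_finite' hB f k)]
  refine finsum_congr fun d => ?_
  rw [coeff_X_add_C_pow, coeff_X_add_C_pow, smul_eq_mul, smul_eq_mul, hL, PowerSeries.coeff_mk]

variable {p : ℕ+}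

/-- Both sides are ring homomorphisms on ℤ[q^{±1}] that send q to ζ_{pm} + X. -/
theorem expandAt_shift
    (hW : PowerSeries.HasSubst (PowerSeries.X + PowerSeries.C
      (Ideal.Quotient.mk (Ideal.span {((p : ℕ) : CycInt ζ (p * m)) ^ n}) (zetaDiff ζ p m))))
    (F : LaurentPolynomial ℤ) :
    PowerSeries.subst (PowerSeries.X + PowerSeries.C
      (Ideal.Quotient.mk (Ideal.span {((p : ℕ) : CycInt ζ (p * m)) ^ n}) (zetaDiff ζ p m)))
        (PowerSeries.map ((Ideal.Quotient.mk (Ideal.span {((p : ℕ) : CycInt ζ (p * m)) ^ n})).comp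
          (cycIncl ζ p m)) (expandAt ζ m F)) =
      PowerSeries.map (Ideal.Quotient.mk (Ideal.span {((p : ℕ) : CycInt ζ (p * m)) ^ n}))
        (expandAt ζ (p * m) F) := by
  set π := Ideal.Quotient.mk (Ideal.span {((p : ℕ) : CycInt ζ (p * m)) ^ n})
  have hT (k : ℕ+) : expandAt ζ k (LaurentPolynomial.T 1) =
      PowerSeries.C (zeta ζ k) + PowerSeries.X := by
    rw [expandAt, LaurentPolynomial.eval₂_T, zpow_one, qUnit, IsUnit.unit_spec]
  rw [← PowerSeries.coe_substAlgHom hW]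
  refine RingHom.congr_fun (f := (PowerSeries.substAlgHom hW).toRingHom.comp
    ((PowerSeries.map (π.comp (cycIncl ζ p m))).comp (expandAt ζ m)))
    (g := (PowerSeries.map π).comp (expandAt ζ (p * m))) (laurent_hom_ext ?_) F
  change PowerSeries.substAlgHom hW (PowerSeries.map (π.comp (cycIncl ζ p m))
    (expandAt ζ m (LaurentPolynomial.T 1))) =
      PowerSeries.map π (expandAt ζ (p * m) (LaurentPolynomial.T 1))
  rw [hT, hT, map_add, map_add, map_add, PowerSeries.map_C, PowerSeries.map_C, PowerSeries.map_X,
    PowerSeries.map_X, PowerSeries.coe_substAlgHom, PowerSeries.subst_X hW]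
  have hC (c : CycMod ζ (p * m) p n) : PowerSeries.subst (PowerSeries.X + PowerSeries.C
      (π (zetaDiff ζ p m))) (PowerSeries.C c) = PowerSeries.C c := PowerSeries.subst_C c
  rw [hC, zetaDiff, map_sub, map_sub, RingHom.comp_apply]
  ring

/-- If the coefficients of the expansions of a series over `ℤ[q^{±1}]` lie in the rings `R_m`, then
these expansions form an element of the Habiro ring. -/
theorem mem_habiroRing_of_isExpansion [Fintype σ] [Algebra.Etale (MvPolynomial σ ℤ) R]
    (hι : ∀ (M : ℤ) r, (∀ n, M ∣ MvPowerSeries.coeff n (ι r)) → (M : R) ∣ r)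
    (F : MvPowerSeries σ (LaurentPolynomial ℤ)) (f : ∀ m : ℕ+, PowerSeries (RootRing σ R ζ m))
    (hf : IsExpansion ζ ι F f) : f ∈ habiroRing σ R ζ := by
  simp only [habiroRing, Subring.mem_iInf]
  intro m p hp n
  change reexpand σ R ζ hp m n (f m) =
    PowerSeries.map (frobeniusMod σ R ζ (p * m) hp n) (f (p * m))
  refine PowerSeries.ext fun k => modSeries_injective ζ ι (p * m) p n hι (MvPowerSeries.ext fun e
      => ?_)
  let π := Ideal.Quotient.mk (Ideal.span {((p : ℕ) : CycInt ζ (p * m)) ^ n})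
  let τ : CycInt ζ (p * m) →+* RootRing.Mod σ R ζ (p * m) p n :=
    (RootRing.toMod σ R ζ (p * m) p n).comp (RootRing.ofCyc σ R ζ (p * m))
  let L : RootRing.Mod σ R ζ (p * m) p n →+ CycMod ζ (p * m) p n :=
    ((MvPowerSeries.coeff e).toAddMonoidHom).comp (modSeries ζ ι (p * m) p n).toAddMonoidHom
  have hL (x : RootRing.Mod σ R ζ (p * m) p n) (c : CycInt ζ (p * m)) :
      L (x * τ c) = L x * π c := by
    change MvPowerSeries.coeff e (modSeries ζ ι (p * m) p n (x * RootRing.toMod σ R ζ (p * m) p n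
      (RootRing.ofCyc σ R ζ (p * m) c))) = MvPowerSeries.coeff e (modSeries ζ ι (p * m) p n x) * π c
    rw [map_mul, modSeries_toMod, rootSeries_ofCyc, MvPowerSeries.map_C, MvPowerSeries.coeff_mul_C]
  have hW : PowerSeries.HasSubst (PowerSeries.X + PowerSeries.C (π (zetaDiff ζ p m))) := by
    obtain ⟨k, c, hc⟩ := exists_dvd_zetaDiff_pow ζ hp m
    have h : IsNilpotent (π (zetaDiff ζ p m)) := by
      refine ⟨k * n, ?_⟩
      rw [← map_pow, pow_mul, hc, mul_pow, map_mul,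
        Ideal.Quotient.eq_zero_iff_mem.2 (Ideal.mem_span_singleton_self _), zero_mul]
    change IsNilpotent (PowerSeries.constantCoeff _)
    simpa using h
  have h1 : MvPowerSeries.coeff e (modSeries ζ ι (p * m) p n
      (PowerSeries.coeff k (reexpand σ R ζ hp m n (f m)))) =
      PowerSeries.coeff k (PowerSeries.subst (PowerSeries.X + PowerSeries.C (π (zetaDiff ζ p m)))
        (PowerSeries.mk fun d => MvPowerSeries.coeff e (MvPowerSeries.expand (p : ℕ) p.ne_zero
          (MvPowerSeries.map (π.comp (cycIncl ζ p m))
            (rootSeries ζ ι m (PowerSeries.coeff d (f m))))))) := by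
    have h2 := map_coeff_subst_shift τ π L hL (zetaDiff ζ p m) (hasSubst_shift σ R ζ hp m n) hW
      (PowerSeries.map ((RootRing.toMod σ R ζ (p * m) p n).comp (RootRing.incl σ R ζ p m)) (f m)) k
    have h3 : reexpand σ R ζ hp m n (f m) = PowerSeries.subst
        (PowerSeries.X + PowerSeries.C (τ (zetaDiff ζ p m))) (PowerSeries.map
          ((RootRing.toMod σ R ζ (p * m) p n).comp (RootRing.incl σ R ζ p m)) (f m)) :=
      congrFun (PowerSeries.coe_substAlgHom (hasSubst_shift σ R ζ hp m n)) _
    rw [h3]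
    refine h2.trans ?_
    congr 3
    funext d
    rw [PowerSeries.coeff_map]
    change MvPowerSeries.coeff e (MvPowerSeries.map π (rootSeries ζ ι (p * m)
      (RootRing.incl σ R ζ p m _))) = _
    rw [rootSeries_incl, MvPowerSeries.map_expand, ← RingHom.comp_apply (MvPowerSeries.map π),
      ← MvPowerSeries.map_comp]
  rw [h1, PowerSeries.coeff_map, modSeries_frobeniusMod]
  -- Both the inclusion and the Frobenius multiply exponents by p. At e = p e' the two sides expand
  -- the same coefficient of F at ζ_{pm}, and at all other exponents both vanish.
  by_cases he : ∃ e', e = (p : ℕ) • e'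
  · obtain ⟨e', rfl⟩ := he
    simp only [MvPowerSeries.coeff_expand_smul, MvPowerSeries.coeff_map]
    rw [hf, ← PowerSeries.coeff_map, ← expandAt_shift ζ m n hW]
    congr 2
    ext d
    rw [PowerSeries.coeff_mk, hf, PowerSeries.coeff_map]
  · obtain ⟨i, hi⟩ : ∃ i, ¬ (p : ℕ) ∣ e i := by
      by_contra! h
      choose g hg using h
      exact he ⟨Finsupp.equivFunOnFinite.symm g, Finsupp.ext hg⟩
    simp only [MvPowerSeries.coeff_expand_of_not_dvd _ _ _ hi]
    have h0 : (PowerSeries.mk fun _ => (0 : CycMod ζ (p * m) p n)) = 0 := by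
      ext; simp
    rw [h0, ← PowerSeries.coe_substAlgHom hW, map_zero, map_zero]

end Glue

end Habiro

end

theorem theorem1p5 {N : ℕ} (A : Matrix (Fin N) (Fin N) ℤ) (hA : A.IsSymm)
    (ζ : Habiro.CompatibleRoots) :
    ∃ ι : Habiro.NahmRing A →ₐ[MvPolynomial (Fin N) ℤ] MvPowerSeries (Fin N) ℤ,
      Function.Injective ι ∧
      ∃ F : MvPowerSeries (Fin N) (LaurentPolynomial ℤ),
        MvPowerSeries.map Habiro.laurentToRatFunc F = Habiro.nahmSym A ∧
        ∃ f ∈ Habiro.habiroRing (Fin N) (Habiro.NahmRing A) ζ, Habiro.IsExpansion ζ ι F f := by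
  choose u hu using Habiro.exists_coeff_rootSeries_eq A hA ζ
  have hf : Habiro.IsExpansion ζ (Habiro.nahmSeries A hA) (Habiro.nahmLaurent A)
      fun m => PowerSeries.mk (u m) := fun m n k => by
    rw [PowerSeries.coeff_mk]
    exact hu m k n
  exact ⟨Habiro.nahmSeries A hA, Habiro.nahmSeries_injective A hA, Habiro.nahmLaurent A,
    Habiro.map_nahmLaurent A hA, _, Habiro.mem_habiroRing_of_isExpansion ζ _
      (Habiro.nahm_dvd_of_dvd_coeff A hA) _ _ hf, hf⟩
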